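/- **Setting.** A *normal crossing orbifold* $(\bar X,\varphi)$ of dimension $n$ is a compact connected complex space $\bar X$ of dimension $n$ with only abelian quotient singularities (for instance a projective one), together with connected hypersurfaces $D_1,\dots,D_r$ and indices $n_i=\varphi(D_i)\in\mathbb Z_{\ge 0}$, such that every point $p$ has a neighbourhood isomorphic to $\mathbb D^n/A_p$, where $\mathbb D\subset\mathbb C$ is the open unit disc, $p$ corresponds to $0$, $A_p$ is a finite small group of diagonal linear maps (small: no element other than $1$ fixes a hyperplane pointwise), the components $D_i$ through $p$ are the images of distinct coordinate hyperplanes and the others do not meet the neighbourhood. Put $\nu(p)=|A_p|\prod_{D_i\ni p}n_i$, $X^+_\varphi=\bar X\setminus\bigcup_{n_i=0}D_i$ and $X^\circ=\mathrm{Reg}(\bar X)\setminus\bigcup_i D_i$. The orbifold fundamental group $\pi_1^{\rm orb}(\bar X,\varphi)$ is the quotient of $\pi_1(X^\circ)$ by the normal subgroup generated by all $\mu^{n_i}$, $\mu$ a meridian of $D_i$, and $b_1^{\rm orb}(\bar X,\varphi)$ is the rank of its abelianization. An *unbranched orbifold covering* $\pi:(\bar Y,\varphi_Y)\to(\bar X,\varphi_X)$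 is a dominant proper holomorphic map with finite fibres $Y^+_{\varphi_Y}\to X^+_{\varphi_X}$ such that $\nu(y)\cdot\deg_y\pi=\nu(\pi(y))$ for all $y\in Y^+_{\varphi_Y}$, where $\deg_y\pi$ is the local degree of $\pi$ at $y$. For a finitely generated group $G$, let $M=H_1(G';\mathbb C)=(G'/G'')\otimes\mathbb C$, a module over $\mathbb C[H_1(G)]$ by conjugation. Let $F_k(M)$ be the ideal generated by the minors of order $n-k+1$ of an $n\times m$ presentation matrix of $M$ (it is $0$ for $k\le\max\{0,n-m\}$ and the unit ideal for $k>n$), let $\mathrm{Char}_k(G)\subset\mathrm{Hom}(G,\mathbb C^*)$ be its zero set, and let the depth of a character $\xi$ be the largest $k$ with $\xi\in\mathrm{Char}_k(G)$. **Theorem (extended Sakuma formula).** Let $\pi:(\bar Y,\varphi_Y)\to(\bar X,\varphi_X)$ be an unbranched orbifold covering of normal crossing orbifolds. Let $G_{\varphi_X}=\pi_1^{\rm orb}(\bar X,\varphi_X)$ and let $G_{\varphi_Y}\subset G_{\varphi_X}$ be the image of $\pi_1^{\rm orb}(\bar Y,\varphi_Y)$, that is, the subgroup of classes of $\pi\circ\gamma$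 for loops $\gamma$ in $Y^\circ\cap\pi^{-1}(X^\circ)$. Suppose that $G_{\varphi_Y}$ is normal in $G_{\varphi_X}$ and that $G_\varphi=G_{\varphi_X}/G_{\varphi_Y}$ is finite and abelian. Then $$b_1^{\rm orb}(\bar Y,\varphi_Y)=b_1^{\rm orb}(\bar X,\varphi_X)+\sum_{\xi\in\mathrm{Hom}(G_\varphi,\mathbb C^*)\setminus\{1\}}\mathrm{depth}(\xi),$$ where $\mathrm{depth}(\xi)$ is the depth of $\xi$, regarded as a character of $G_{\varphi_X}$. -/

import Mathlib

open scoped TensorProduct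

noncomputable section

/-! ### Characteristic varieties of a group -/

section CharacteristicVarieties

variable {R : Type*} [CommRing R] {M : Type*} [AddCommGroup M] [Module R M]

/-- `A` is the matrix of a finite presentation `R^m → R^n → M → 0`. -/
def IsPresentation {n m : ℕ} (A : Matrix (Fin n) (Fin m) R) (ψ : (Fin n → R) →ₗ[R] M) : Prop :=
  Function.Surjective ψ ∧ LinearMap.ker ψ = LinearMap.range A.mulVecLin

variable (R M) in
/-- The `k`-th Fitting ideal, indexed so that it is generated by the minors of order `n - k + 1` of
an `n × m` presentation matrix; it is `0` for `k ≤ max 0 (n - m)` (such minors have a repeated row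
or column) and `R` for `k > n` (empty minors).  By Fitting's lemma, the ideal of minors does not
depend on the presentation; the generators from all presentations are listed here so that no
presentation has to be chosen. -/
def fittingIdeal (k : ℕ) : Ideal R :=
  Ideal.span {d | ∃ (n m : ℕ) (A : Matrix (Fin n) (Fin m) R) (ψ : (Fin n → R) →ₗ[R] M),
    IsPresentation A ψ ∧
    ∃ (r : Fin (n + 1 - k) → Fin n) (c : Fin (n + 1 - k) → Fin m), d = (A.submatrix r c).det}

variable (G : Type*) [Group G]

/-- Conjugation by `g`, acting on `H₁(G') = G'/G''`. -/
def conjDerived (g : G) :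
    Additive (Abelianization (commutator G)) →ₗ[ℤ] Additive (Abelianization (commutator G)) :=
  (MonoidHom.toAdditive
    (Abelianization.map (MulAut.conjNormal (H := commutator G) g).toMonoidHom)).toIntLinearMap

theorem conjDerived_of (g : G) (x : commutator G) :
    conjDerived G g (Additive.ofMul (Abelianization.of x)) =
      Additive.ofMul (Abelianization.of (MulAut.conjNormal g x)) := rfl

theorem conjDerived_ext {f h : Additive (Abelianization (commutator G)) →ₗ[ℤ]
      Additive (Abelianization (commutator G))}
    (H : ∀ x : commutator G, f (Additive.ofMul (Abelianization.of x)) =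
      h (Additive.ofMul (Abelianization.of x))) : f = h := by
  ext y
  obtain ⟨x, hx⟩ := QuotientGroup.mk_surjective (s := commutator (commutator G)) y.toMul
  have hy : y = Additive.ofMul (Abelianization.of x) := hx.symm
  rw [hy]
  exact H x

/-- The action of `G` by conjugation on `H₁(G') ⊗ ℂ`. -/
def conjRep : Representation ℂ G (ℂ ⊗[ℤ] Additive (Abelianization (commutator G))) where
  toFun g := (conjDerived G g).baseChange ℂ
  map_one' := by
    have : conjDerived G 1 = LinearMap.id := by
      refine conjDerived_ext G fun x => ?_
      rw [conjDerived_of, map_one]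
      rfl
    rw [this]
    exact LinearMap.baseChange_id
  map_mul' g h := by
    have : conjDerived G (g * h) = conjDerived G g ∘ₗ conjDerived G h := by
      refine conjDerived_ext G fun x => ?_
      rw [LinearMap.comp_apply, conjDerived_of, conjDerived_of, conjDerived_of, map_mul]
      rfl
    rw [this]
    exact LinearMap.baseChange_comp _ _

theorem commutator_le_ker_conjRep : commutator G ≤ (conjRep G).ker := by
  intro g hg
  have : conjDerived G g = LinearMap.id := by
    refine conjDerived_ext G fun x => ?_
    rw [conjDerived_of, LinearMap.id_apply]
    have h1 : MulAut.conjNormal g x = (⟨g, hg⟩ : commutator G) * x * (⟨g, hg⟩ : commutator G)⁻¹ := by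
      ext
      simp [MulAut.conjNormal_apply]
    have h2 : Abelianization.of (MulAut.conjNormal g x) = Abelianization.of x := by
      rw [h1, map_mul, map_mul, map_inv, mul_inv_cancel_comm]
    rw [h2]
  rw [MonoidHom.mem_ker]
  change (conjDerived G g).baseChange ℂ = 1
  rw [this]
  exact LinearMap.baseChange_id

/-- `H₁(G') ⊗ ℂ` as a representation of `H₁(G)`. -/
def alexanderRep :
    Representation ℂ (Abelianization G) (ℂ ⊗[ℤ] Additive (Abelianization (commutator G))) :=
  QuotientGroup.lift (commutator G) (conjRep G) (commutator_le_ker_conjRep G)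

/-- The `ℂ[H₁(G)]`-module `H₁(G') ⊗ ℂ`. -/
abbrev AlexanderModule : Type _ := (alexanderRep G).asModule

variable {G} in
/-- Evaluation of elements of `ℂ[H₁(G)]` at a character `χ` of `G`. -/
def evalChar (χ : G →* ℂˣ) : MonoidAlgebra ℂ (Abelianization G) →ₐ[ℂ] ℂ :=
  MonoidAlgebra.lift ℂ ℂ (Abelianization G) ((Units.coeHom ℂ).comp (Abelianization.lift χ))

/-- The `k`-th characteristic variety of `G`, in the space of characters of `G`: the zero set of the
`k`-th Fitting ideal of `H₁(G') ⊗ ℂ`. -/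
def charVar (k : ℕ) : Set (G →* ℂˣ) :=
  {χ | ∀ f ∈ fittingIdeal (MonoidAlgebra ℂ (Abelianization G)) (AlexanderModule G) k,
    evalChar χ f = 0}

variable {G} in
/-- The depth of a character: the largest `k` such that it lies in the `k`-th characteristic
variety. -/
def charDepth (χ : G →* ℂˣ) : ℕ := sSup {k | χ ∈ charVar G k}

/-- The first Betti number: the rank of the abelianization. -/
def groupBetti : ℕ := Module.finrank ℤ (Additive (Abelianization G))

end CharacteristicVarieties

/-! ### Normal crossing orbifolds -/

/-- The open unit polydisc of `ℂⁿ`. -/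
def polydisc (n : ℕ) : Set (Fin n → ℂ) := {z | ∀ k, ‖z k‖ < 1}

/-- A chart identifying an open subset of `X` with the quotient of the unit polydisc by a finite
small abelian group of linear automorphisms (small: no element other than `1` fixes a hyperplane
pointwise).  Coordinates are chosen so that the group is diagonal.  Only the values of the map on
the polydisc are used. -/
structure QuotientChart (n : ℕ) (X : Type*) [TopologicalSpace X] where
  grp : Subgroup (Fin n → ℂˣ)
  finite_grp : Finite grp
  small : ∀ a ∈ grp, ∀ k, (∀ j, j ≠ k → a j = 1) → a = 1
  map : (Fin n → ℂ) → X
  continuousOn_map : ContinuousOn map (polydisc n)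
  isOpen_image : ∀ W ⊆ polydisc n, IsOpen W → IsOpen (map '' W)
  map_eq_iff : ∀ z ∈ polydisc n, ∀ w ∈ polydisc n,
    map z = map w ↔ ∃ a ∈ grp, ∀ k, w k = (a k : ℂ) * z k

/-- A complex analytic orbifold structure with normal crossings on `X`: the structure of a complex
space of dimension `n` with only abelian quotient singularities, hypersurfaces `D 0, …, D (r - 1)`
forming a divisor with normal crossings, and indices in `ℤ_{≥ 0}`. -/
structure NCOrbifold (n : ℕ) (X : Type*) [TopologicalSpace X] where
  /-- a chart centred at each point -/
  chart : X → QuotientChart n X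
  chart_zero : ∀ p, (chart p).map 0 = p
  /-- Compatibility: where charts overlap they differ by local biholomorphisms of `ℂⁿ`. -/
  compatible : ∀ p, ∀ z ∈ polydisc n,
    ∃ h : OpenPartialHomeomorph (Fin n → ℂ) (Fin n → ℂ),
      (0 : Fin n → ℂ) ∈ h.source ∧ h 0 = z ∧
      h.source ⊆ polydisc n ∧ h.target ⊆ polydisc n ∧
      DifferentiableOn ℂ h h.source ∧ DifferentiableOn ℂ h.symm h.target ∧
      ∀ w ∈ h.source, (chart p).map (h w) = (chart ((chart p).map z)).map w
  /-- the number of irreducible components of the divisor -/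
  r : ℕ
  /-- the irreducible components of the divisor -/
  D : Fin r → Set X
  isConnected_D : ∀ i, IsConnected (D i)
  /-- In the chart at `p`, the components of the divisor passing through `p` are given by distinct
  coordinate hyperplanes, and the other ones are not met. -/
  coord : ∀ (p : X) (i : Fin r), p ∈ D i → Fin n
  coord_injective : ∀ (p : X) (i j : Fin r) (hi : p ∈ D i) (hj : p ∈ D j),
    coord p i hi = coord p j hj → i = j
  map_mem_D_iff : ∀ (p : X) (i : Fin r) (hi : p ∈ D i), ∀ z ∈ polydisc n,
    (chart p).map z ∈ D i ↔ z (coord p i hi) = 0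
  map_notMem_D : ∀ (p : X) (i : Fin r), p ∉ D i → ∀ z ∈ polydisc n, (chart p).map z ∉ D i
  /-- the orbifold index of each component -/
  index : Fin r → ℕ

namespace NCOrbifold

variable {n : ℕ} {X : Type*} [TopologicalSpace X] (O : NCOrbifold n X)

/-- The function `f` is holomorphic on the open set `U`. -/
def IsHolomorphicOn (f : X → ℂ) (U : Set X) : Prop :=
  ∀ p, DifferentiableOn ℂ (fun z => f ((O.chart p).map z)) {z ∈ polydisc n | (O.chart p).map z ∈ U}

/-- The positive part: the complement of the components of index `0`. -/
def posPart : Set X := {x | ∀ i, x ∈ O.D i → O.index i ≠ 0}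

/-- The complement of the divisor and of the singular points of `X`. -/
def regPart : Set X := {x | (O.chart x).grp = ⊥ ∧ ∀ i, x ∉ O.D i}

theorem regPart_subset_posPart : O.regPart ⊆ O.posPart :=
  fun _ hx i hi => absurd hi (hx.2 i)

open scoped Classical in
/-- The orbifold index of a point `p`: the order of the group `A` such that `X` is `ℂⁿ/A` at `p`,
times the indices of the components of the divisor through `p`. -/
def pointIndex (p : X) : ℕ :=
  Nat.card (O.chart p).grp * ∏ i with p ∈ O.D i, O.index i

/-- Meridians of the component `D i`: in a chart, turn once around the hyperplane over `D i`; join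
this loop to the base point by a path in the complement of the divisor. -/
def IsMeridian {x₀ : O.regPart} (i : Fin O.r) (g : FundamentalGroup O.regPart x₀) : Prop :=
  ∃ (p : X) (hp : p ∈ O.D i), ∃ z ∈ polydisc n,
    ∃ (x : O.regPart) (δ : Path x₀ x) (γ : Path x x),
      (∀ t : unitInterval, (γ t : X) = (O.chart p).map (Function.update z (O.coord p i hp)
        (Complex.exp (2 * Real.pi * Complex.I * ((t : ℝ) : ℂ)) * z (O.coord p i hp)))) ∧
      g = FundamentalGroup.fromPath (Path.Homotopic.Quotient.mk ((δ.trans γ).trans δ.symm))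

/-- The orbifold fundamental group: the fundamental group of the regular part of the complement of
the divisor, modulo the powers of the meridians prescribed by the indices. -/
abbrev orbGroup (x₀ : O.regPart) : Type _ :=
  FundamentalGroup O.regPart x₀ ⧸
    Subgroup.normalClosure {g | ∃ i h, O.IsMeridian i h ∧ g = h ^ O.index i}

/-- The first orbifold Betti number. -/
def orbBetti (x₀ : O.regPart) : ℕ := groupBetti (O.orbGroup x₀)

end NCOrbifold

/-! ### Unbranched orbifold coverings -/

/-- The local degree of `f` at `y` is `d`: arbitrarily small open neighbourhoods `V` of `y` have an
open image, a generic point of which has exactly `d` preimages in `V`. -/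
def HasLocalDegree {Y X : Type*} [TopologicalSpace Y] [TopologicalSpace X] (f : Y → X) (y : Y)
    (d : ℕ) : Prop :=
  ∀ W ∈ nhds y, ∃ V ⊆ W, IsOpen V ∧ y ∈ V ∧ IsOpen (f '' V) ∧
    ∃ U, IsOpen U ∧ U ⊆ f '' V ∧ f '' V ⊆ closure U ∧ ∀ u ∈ U, (V ∩ f ⁻¹' {u}).ncard = d

/-- `π` (of which only the restriction to the positive part matters) is an unbranched orbifold
covering: a dominant holomorphic map between the positive parts, proper with finite fibres, such
that `ν(y) · deg_y π = ν(π y)`.  The divisibility conditions on the pull-backs of the divisors,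
which define orbifold maps, follow from these equalities at the generic points of the divisors. -/
structure IsUnbranchedCover {n : ℕ} {Y X : Type*} [TopologicalSpace Y] [TopologicalSpace X]
    (OY : NCOrbifold n Y) (OX : NCOrbifold n X) (π : Y → X) : Prop where
  mapsTo : Set.MapsTo π OY.posPart OX.posPart
  proper : IsProperMap (mapsTo.restrict π OY.posPart OX.posPart)
  dominant : DenseRange (mapsTo.restrict π OY.posPart OX.posPart)
  finite_fiber : ∀ x, (mapsTo.restrict π OY.posPart OX.posPart ⁻¹' {x}).Finite
  holomorphic : ∀ (U : Set X) (g : X → ℂ), IsOpen U → OX.IsHolomorphicOn g U →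
    OY.IsHolomorphicOn (g ∘ π) (OY.posPart ∩ π ⁻¹' U)
  index_mul_degree : ∀ y : OY.posPart,
    ∃ d, HasLocalDegree (mapsTo.restrict π OY.posPart OX.posPart) y d ∧
      OY.pointIndex y * d = OX.pointIndex (π y)

namespace IsUnbranchedCover

variable {n : ℕ} {Y X : Type*} [TopologicalSpace Y] [TopologicalSpace X]
  {OY : NCOrbifold n Y} {OX : NCOrbifold n X} {π : Y → X}

/-- The points of the regular part of `Y` lying over the regular part of `X`. -/
def commonPart (_ : IsUnbranchedCover OY OX π) : Set Y := OY.regPart ∩ π ⁻¹' OX.regPart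

/-- The inclusion into the regular part of `Y`, used for base points. -/
def inc (h : IsUnbranchedCover OY OX π) (y : h.commonPart) : OY.regPart := ⟨y, y.2.1⟩

/-- The restriction of `π` to `commonPart`. -/
def proj (h : IsUnbranchedCover OY OX π) : C(h.commonPart, OX.regPart) where
  toFun y := ⟨π y, y.2.2⟩
  continuous_toFun := by
    have h1 : Continuous fun y : h.commonPart =>
        h.mapsTo.restrict π OY.posPart OX.posPart ⟨y, OY.regPart_subset_posPart y.2.1⟩ :=
      h.proper.continuous.comp (Continuous.subtype_mk continuous_subtype_val _)
    exact Continuous.subtype_mk (continuous_subtype_val.comp h1) _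

/-- The image of the orbifold fundamental group of `Y` in that of `X`.  The classes of loops in
`commonPart` exhaust the orbifold fundamental group of `Y`, and such loops are mapped by `π` into
the regular part of `X`. -/
def imageGroup (h : IsUnbranchedCover OY OX π) (y₀ : h.commonPart) :
    Subgroup (OX.orbGroup (h.proj y₀)) :=
  ((QuotientGroup.mk' _).comp (FundamentalGroup.map h.proj y₀)).range

end IsUnbranchedCover

end

/-! The proof has a topological half, that the orbifold fundamental group of `Y` is isomorphic to
its image `imageGroup` in that of `X`, and an algebraic half, that the formula holds for every
normal subgroup with finite abelian quotient of a finitely generated group.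

Topology. Both groups are quotients of the fundamental group of `commonPart`, and the point is that
the two kernels agree (`ker_toOrbBase_le`, `ker_toOrbCover_le`). Locally this is a computation with
lattices. In logarithmic coordinates the torus part of the chart at `p` has a convex universal cover
whose deck group is a lattice Λ (`lattice`); the prescribed powers of the meridians span a
sublattice Λ' (`merLattice`), and [Λ : Λ'] = ν(p) (`relIndex_merLattice`). Over the regular part of
`X` the relation ν(y) deg_y π = ν(π y) = 1 forces degree one, so π is a covering there
(`isCoveringMap_projStar`). Near a point y over p, the translations whose paths lift to closed paths
form a lattice Λ_y of index deg_y π in Λ (`deckLattice`, `relIndex_deckLattice`). If a loop near p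
corresponds to v in Λ, then deg_y π · v closes up near y, and the ν(y)-th power of the lifted loop
is trivial in the group of `Y`. Hence the relations of `X` hold in the group of `Y`. Conversely Λ' ⊆
Λ_y, so [Λ_y : Λ'] = ν(y), and the ν(y)-th power of a loop near y is trivial in the group of `X`.
Hence the relations of `Y` hold in the group of `X`. Homomorphisms from fundamental groups are
treated as cocycles on path classes, so that they can be restricted to charts and extended across
thin sets (`PathCocycle.exists_extend`). Meridians are moved to generic points of their components,
where ν is the index of the component (`TurnsAround.exists_conj`).

Algebra. The number b₁(N) is the dimension of Hom(N, ℂ), which splits according to the characters of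
G/N. The trivial part is Hom(G, ℂ), by the transfer. For ξ ≠ 1, restriction to G' identifies the
ξ-part with the ξ-equivariant homomorphisms G' → ℂ (`finrank_eqHomSpace_commutator`), which are the
functionals on the fibre of the Alexander module at ξ (`finrank_semilinear`). The Fitting ideals
detect the dimension of this fibre, which is therefore the depth (`charDepth_eq`). The finite
generation of G needed for a finite presentation comes from the compactness of `X`
(`fg_fundamentalGroup`). -/

open Topology

/-! ### Homotopy classes of paths -/

/-- Homotopy classes of paths from `a` to `b`. -/
abbrev PathClass {T : Type*} [TopologicalSpace T] (a b : T) := Path.Homotopic.Quotient a b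

namespace PathClass

variable {T : Type*} [TopologicalSpace T]

/-- The class of a path. -/
abbrev mk {a b : T} (γ : Path a b) : PathClass a b := Path.Homotopic.Quotient.mk γ

@[simp]
theorem symm_trans_cancel {a b c : T} (p : PathClass a b) (q : PathClass b c) :
    p.symm.trans (p.trans q) = q := by
  rw [← Path.Homotopic.Quotient.trans_assoc]; simp

@[simp]
theorem trans_symm_cancel {a b c : T} (p : PathClass b a) (q : PathClass b c) :
    p.trans (p.symm.trans q) = q := by
  rw [← Path.Homotopic.Quotient.trans_assoc]; simp

@[simp]
theorem symm_symm {a b : T} (p : PathClass a b) : p.symm.symm = p := by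
  induction p using Path.Homotopic.Quotient.ind with | mk γ =>
  simp [← Path.Homotopic.Quotient.mk_symm]

@[simp]
theorem symm_trans_rev {a b c : T} (p : PathClass a b) (q : PathClass b c) :
    (p.trans q).symm = q.symm.trans p.symm := by
  induction p using Path.Homotopic.Quotient.ind with | mk γ =>
  induction q using Path.Homotopic.Quotient.ind with | mk δ =>
  simp [← Path.Homotopic.Quotient.mk_symm, ← Path.Homotopic.Quotient.mk_trans]

variable {T' : Type*} [TopologicalSpace T']

@[simp]
theorem map_trans {a b c : T} (f : C(T, T')) (p : PathClass a b) (q : PathClass b c) :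
    (p.trans q).map f = (p.map f).trans (q.map f) :=
  (FundamentalGroupoid.map f).map_comp (X := ⟨a⟩) (Y := ⟨b⟩) (Z := ⟨c⟩) p q

@[simp]
theorem map_symm {a b : T} (f : C(T, T')) (p : PathClass a b) :
    p.symm.map f = (p.map f).symm := by
  induction p using Path.Homotopic.Quotient.ind with | mk γ => rfl

@[simp]
theorem map_refl {a : T} (f : C(T, T')) :
    (Path.Homotopic.Quotient.refl a).map f = Path.Homotopic.Quotient.refl (f a) := rfl

theorem map_map {T'' : Type*} [TopologicalSpace T''] {a b : T} (f : C(T, T')) (g : C(T', T''))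
    (p : PathClass a b) : (p.map f).map g = p.map (g.comp f) := by
  induction p using Path.Homotopic.Quotient.ind with | mk γ => rfl

/-- A property of path classes that is stable under composition and holds for short paths holds for
all paths. -/
theorem induction_local (P : ∀ a b : T, PathClass a b → Prop)
    (htrans : ∀ a b c (p : PathClass a b) (q : PathClass b c),
      P a b p → P b c q → P a c (p.trans q))
    (hloc : ∀ t : T, ∃ V ∈ 𝓝 t, ∀ a b (γ : Path a b), (∀ s, γ s ∈ V) → P a b (mk γ))
    {a b : T} (p : PathClass a b) : P a b p := by
  have hcast : ∀ {a b a' b' : T} (γ : Path a b) (ha : a' = a) (hb : b' = b),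
      P a' b' (mk (γ.cast ha hb)) → P a b (mk γ) := by
    rintro a b _ _ γ rfl rfl h; exact h
  induction p using Path.Homotopic.Quotient.ind with | mk γ =>
  choose V hV hVP using hloc
  obtain ⟨t, t0, tmono, ⟨n, hn⟩, ht⟩ :=
    exists_monotone_Icc_subset_open_cover_unitInterval (c := fun x : T => γ ⁻¹' interior (V x))
      (fun x => isOpen_interior.preimage γ.continuous)
      (fun s _ => Set.mem_iUnion.2 ⟨γ s, mem_interior_iff_mem_nhds.2 (hV _)⟩)
  have key : ∀ m, P _ _ (mk (γ.subpath 0 (t m))) := by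
    intro m
    induction m with
    | zero =>
      refine hVP (γ 0) _ _ _ fun s => ?_
      have : γ.subpath 0 (t 0) s ∈ Set.range (γ.subpath 0 (t 0)) := ⟨s, rfl⟩
      rw [Path.range_subpath, show Set.uIcc 0 (t 0) = {0} by rw [t0, Set.uIcc_self]] at this
      rw [Set.image_singleton, Set.mem_singleton_iff] at this
      exact this.symm ▸ mem_of_mem_nhds (hV _)
    | succ m ih =>
      obtain ⟨x, hx⟩ := ht m
      have h1 : P _ _ (mk (γ.subpath (t m) (t (m + 1)))) := by
        refine hVP x _ _ _ fun s => ?_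
        have : γ.subpath (t m) (t (m + 1)) s ∈ Set.range (γ.subpath (t m) (t (m + 1))) := ⟨s, rfl⟩
        rw [Path.range_subpath_of_le _ _ _ (tmono m.le_succ)] at this
        obtain ⟨r, hr, hrs⟩ := this
        rw [← hrs]
        exact interior_subset (hx hr)
      have h2 := htrans _ _ _ _ _ ih h1
      rw [← Path.Homotopic.Quotient.mk_trans, Path.Homotopic.Quotient.eq.2
        ⟨Path.Homotopy.subpathTransSubpath γ 0 (t m) (t (m + 1))⟩] at h2
      exact h2
  have := key n
  rw [hn n le_rfl, Path.subpath_zero_one] at this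
  exact hcast γ _ _ this

end PathClass

/-- A path with values in `U`, as a path in the subtype. -/
def Path.toSubtype {T : Type*} [TopologicalSpace T] {a b : T} (γ : Path a b) {U : Set T}
    (h : ∀ t, γ t ∈ U) : Path (⟨a, γ.source ▸ h 0⟩ : U) ⟨b, γ.target ▸ h 1⟩ where
  toFun t := ⟨γ t, h t⟩
  continuous_toFun := by fun_prop
  source' := Subtype.ext γ.source
  target' := Subtype.ext γ.target

/-- The inclusion of a subset. -/
abbrev subtypeMap {T : Type*} [TopologicalSpace T] (U : Set T) : C(U, T) :=
  ⟨Subtype.val, continuous_subtype_val⟩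

theorem Path.map_toSubtype {T : Type*} [TopologicalSpace T] {a b : T} (γ : Path a b) {U : Set T}
    (h : ∀ t, γ t ∈ U) :
    (PathClass.mk (γ.toSubtype h)).map (subtypeMap U) = PathClass.mk γ := rfl

/-! ### Cocycles -/

/-- A functor from the fundamental groupoid of `T` to the group `Γ`. -/
structure PathCocycle (T Γ : Type*) [TopologicalSpace T] [Group Γ] where
  toFun : ∀ {a b : T}, PathClass a b → Γ
  -- The factors are reversed because the product `p * q` in `FundamentalGroup` is the class of `q`
  -- followed by `p`.
  map_trans' : ∀ {a b c : T} (p : PathClass a b) (q : PathClass b c),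
    toFun (p.trans q) = toFun q * toFun p

namespace PathCocycle

variable {T Γ : Type*} [TopologicalSpace T] [Group Γ]

instance : CoeFun (PathCocycle T Γ) fun _ => ∀ {a b : T}, PathClass a b → Γ :=
  ⟨@PathCocycle.toFun T Γ _ _⟩

variable (F : PathCocycle T Γ)

@[simp]
theorem map_trans {a b c : T} (p : PathClass a b) (q : PathClass b c) :
    F (p.trans q) = F q * F p := F.map_trans' p q

@[simp]
theorem map_refl (a : T) : F (Path.Homotopic.Quotient.refl a) = 1 := by
  have := F.map_trans (Path.Homotopic.Quotient.refl a) (Path.Homotopic.Quotient.refl a)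
  simpa using this

@[simp]
theorem map_symm {a b : T} (p : PathClass a b) : F p.symm = (F p)⁻¹ := by
  have := F.map_trans p p.symm
  rw [Path.Homotopic.Quotient.trans_symm, F.map_refl] at this
  exact eq_inv_of_mul_eq_one_left this.symm

/-- The pull-back of a cocycle by a continuous map. -/
def comap {T' : Type*} [TopologicalSpace T'] (f : C(T', T)) : PathCocycle T' Γ where
  toFun p := F (p.map f)
  map_trans' p q := by simp

@[simp]
theorem comap_apply {T' : Type*} [TopologicalSpace T'] (f : C(T', T)) {a b : T'}
    (p : PathClass a b) : F.comap f p = F (p.map f) := rfl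

/-- The restriction of a cocycle to the fundamental group. -/
def toHom (x : T) : FundamentalGroup T x →* Γ where
  toFun p := F.toFun (a := x) (b := x) p
  map_one' := F.map_refl x
  map_mul' p q := F.map_trans (a := x) (b := x) (c := x) q p

/-- A cocycle extending a given homomorphism from the fundamental group. -/
theorem exists_toHom_eq [PathConnectedSpace T] (x : T) (φ : FundamentalGroup T x →* Γ) :
    ∃ F : PathCocycle T Γ, F.toHom x = φ := by
  classical
  -- A path from the base point to each `a`, constant for `a = x`. Conjugation by these paths
  -- extends `φ`, and the normalization at `x` makes the restriction equal to `φ`, not just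
  -- conjugate to it.
  have : ∀ a : T, ∃ p : PathClass x a, ∀ h : a = x, p = (Path.Homotopic.Quotient.refl x).cast rfl h := by
    intro a
    by_cases h : a = x
    · exact ⟨(Path.Homotopic.Quotient.refl x).cast rfl h, fun _ => rfl⟩
    · exact ⟨PathClass.mk (PathConnectedSpace.somePath x a), fun h' => absurd h' h⟩
  choose τ hτ using this
  have hx : τ x = Path.Homotopic.Quotient.refl x := hτ x rfl
  refine ⟨⟨fun {a b} p => φ (show PathClass x x from (τ a).trans (p.trans (τ b).symm)), ?_⟩, ?_⟩
  · intro a b c p q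
    rw [← map_mul]
    congr 1
    rw [FundamentalGroup.mul_def]
    simp
  · ext p
    change φ _ = φ _
    congr 1
    rw [hx, ← Path.Homotopic.Quotient.mk_refl, ← Path.Homotopic.Quotient.mk_symm, Path.refl_symm]
    simp

end PathCocycle

/-! ### Sets with thin complement -/

/-- The set `U` is dense and its complement is so thin that it does not locally disconnect the
space, which is locally simply connected. -/
def IsPathThick {T : Type*} [TopologicalSpace T] (U : Set T) : Prop :=
  ∀ t, ∀ N ∈ 𝓝 t, ∃ V ⊆ N, IsOpen V ∧ t ∈ V ∧ IsPathConnected V ∧ IsPathConnected (V ∩ U) ∧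
    ∀ a b : T, ∀ γ γ' : Path a b, (∀ s, γ s ∈ V) → (∀ s, γ' s ∈ V) → γ.Homotopic γ'

theorem IsPathThick.dense {T : Type*} [TopologicalSpace T] {U : Set T} (hU : IsPathThick U) :
    Dense U := by
  intro t
  rw [mem_closure_iff_nhds]
  intro N hN
  obtain ⟨V, hVN, -, -, -, ⟨x, hx, -⟩, -⟩ := hU t N hN
  exact ⟨x, hVN hx.1, hx.2⟩

theorem IsPathConnected.exists_path {T : Type*} [TopologicalSpace T] {V : Set T}
    (hV : IsPathConnected V) {a b : T} (ha : a ∈ V) (hb : b ∈ V) :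
    ∃ γ : Path a b, ∀ s, γ s ∈ V := by
  obtain ⟨γ, hγ⟩ := hV.joinedIn a ha b hb
  exact ⟨γ, hγ⟩

theorem Path.trans_mem {T : Type*} [TopologicalSpace T] {V : Set T} {a b c : T} {γ : Path a b}
    {δ : Path b c} (hγ : ∀ s, γ s ∈ V) (hδ : ∀ s, δ s ∈ V) : ∀ s, γ.trans δ s ∈ V := by
  intro s
  have : γ.trans δ s ∈ Set.range (γ.trans δ) := ⟨s, rfl⟩
  rw [Path.trans_range] at this
  rcases this with ⟨r, hr⟩ | ⟨r, hr⟩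
  · rw [← hr]; exact hγ r
  · rw [← hr]; exact hδ r

namespace IsPathThick

variable {T : Type*} [TopologicalSpace T] {U : Set T}

/-- A path in `T` with end points in `U` is homotopic to a path in `U`. -/
theorem exists_map_eq (hU : IsPathThick U) {a b : U} (p : PathClass (a : T) b) :
    ∃ q : PathClass a b, q.map (subtypeMap U) = p := by
  let good (V : Set T) : Prop := IsOpen V ∧ IsPathConnected V ∧ IsPathConnected (V ∩ U) ∧
    ∀ a b : T, ∀ γ γ' : Path a b, (∀ s, γ s ∈ V) → (∀ s, γ' s ∈ V) → γ.Homotopic γ'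
  -- The intermediate points of a path need not lie in `U`; they are joined to `U` by paths inside a
  -- single good set.
  let short (t : T) (u : U) (σ : PathClass t (u : T)) : Prop :=
    ∃ V, good V ∧ ∃ γ : Path t (u : T), (∀ s, γ s ∈ V) ∧ σ = PathClass.mk γ
  let Im {u v : U} (p : PathClass (u : T) v) : Prop := ∃ q : PathClass u v, q.map (subtypeMap U) = p
  have Im_trans : ∀ {u v w : U} (p : PathClass (u : T) v) (q : PathClass (v : T) w),
      Im p → Im q → Im (p.trans q) := by
    rintro u v w _ _ ⟨p, rfl⟩ ⟨q, rfl⟩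
    exact ⟨p.trans q, by simp⟩
  have Im_symm : ∀ {u v : U} (p : PathClass (u : T) v), Im p → Im p.symm := by
    rintro u v _ ⟨p, rfl⟩
    exact ⟨p.symm, by simp⟩
  have Im_loc : ∀ {V : Set T}, good V → ∀ {u v : U} (γ : Path (u : T) v), (∀ s, γ s ∈ V) →
      Im (PathClass.mk γ) := by
    rintro V ⟨-, -, h2, h3⟩ u v γ hγ
    obtain ⟨δ, hδ⟩ := h2.exists_path (a := (u : T)) (b := v)
      ⟨by simpa using hγ 0, u.2⟩ ⟨by simpa using hγ 1, v.2⟩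
    refine ⟨PathClass.mk (δ.toSubtype fun s => (hδ s).2), ?_⟩
    rw [Path.map_toSubtype δ, Path.Homotopic.Quotient.eq]
    exact h3 _ _ _ _ (fun s => (hδ s).1) hγ
  have ex_short : ∀ t : T, ∀ N ∈ 𝓝 t, ∃ (u : U) (γ : Path t (u : T)), (∀ s, γ s ∈ N) ∧
      short t u (PathClass.mk γ) := by
    intro t N hN
    obtain ⟨V, hVN, hV, htV, h1, h2, h3⟩ := hU t N hN
    obtain ⟨u, hu, -⟩ := id h2
    obtain ⟨γ, hγ⟩ := h1.exists_path htV hu.1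
    exact ⟨⟨u, hu.2⟩, γ, fun s => hVN (hγ s), V, ⟨hV, h1, h2, h3⟩, γ, hγ, rfl⟩
  have short_aux : ∀ (t : T) (u v : U) (σ : PathClass t (u : T)) (V : Set T), good V → ∀ γ : Path t (u : T),
      (∀ s, γ s ∈ V) → ∀ (δ : Path t (v : T)), (∀ s, δ s ∈ V) →
      Im ((PathClass.mk γ).symm.trans (PathClass.mk δ)) := by
    intro t u v σ V hV γ hγ δ hδ
    rw [← Path.Homotopic.Quotient.mk_symm, ← Path.Homotopic.Quotient.mk_trans]
    exact Im_loc hV _ (Path.trans_mem (fun s => by simpa using hγ _) hδ)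
  have short_short : ∀ (t : T) (u v : U) (σ : PathClass t (u : T)) (τ : PathClass t (v : T)), short t u σ →
      short t v τ → Im (σ.symm.trans τ) := by
    rintro t u v _ _ ⟨V, hV, γ, hγ, rfl⟩ ⟨W, hW, δ, hδ, rfl⟩
    -- The two short paths live in different good sets; a third one inside the intersection is
    -- comparable with both.
    obtain ⟨w, ε, hε, -⟩ := ex_short t (V ∩ W) (Filter.inter_mem
      (hV.1.mem_nhds (by simpa using hγ 0)) (hW.1.mem_nhds (by simpa using hδ 0)))
    have h1 := short_aux t u w (PathClass.mk γ) V hV γ hγ ε fun s => (hε s).1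
    have h2 := short_aux t w v (PathClass.mk ε) W hW ε (fun s => (hε s).2) δ hδ
    simpa using Im_trans _ _ h1 h2
  -- Closing up both ends by arbitrary short paths gives a property that composes: the same short
  -- path is used on both sides of a division point.
  have key := PathClass.induction_local (fun a b p => ∀ (u v : U) (σ : PathClass a (u : T))
    (τ : PathClass b (v : T)), short a u σ → short b v τ → Im (σ.symm.trans (p.trans τ)))
    (by
      intro a b c p q hp hq u v σ τ hσ hτ
      obtain ⟨w, ε, -, hε⟩ := ex_short b Set.univ Filter.univ_mem
      simpa using Im_trans _ _ (hp u w σ _ hσ hε) (hq w v _ τ hε hτ))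
    (by
      intro t
      obtain ⟨V, -, hV, htV, h1, h2, h3⟩ := hU t Set.univ Filter.univ_mem
      refine ⟨V, hV.mem_nhds htV, fun a b γ hγ u v σ τ hσ hτ => ?_⟩
      obtain ⟨u', σ', hσ'V, hσ'⟩ := ex_short a V (hV.mem_nhds (by simpa using hγ 0))
      obtain ⟨v', τ', hτ'V, hτ'⟩ := ex_short b V (hV.mem_nhds (by simpa using hγ 1))
      have h4 : Im ((PathClass.mk σ').symm.trans ((PathClass.mk γ).trans (PathClass.mk τ'))) := by
        rw [← Path.Homotopic.Quotient.mk_symm, ← Path.Homotopic.Quotient.mk_trans,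
          ← Path.Homotopic.Quotient.mk_trans]
        exact Im_loc ⟨hV, h1, h2, h3⟩ _
          (Path.trans_mem (fun s => by simpa using hσ'V _) (Path.trans_mem hγ hτ'V))
      have h5 := short_short _ _ _ _ _ hσ hσ'
      have h6 := short_short _ _ _ _ _ hτ' hτ
      simpa using Im_trans _ _ h5 (Im_trans _ _ h4 h6))
    p
  have refl_short : ∀ u : U, short u u (Path.Homotopic.Quotient.refl _) := by
    intro u
    obtain ⟨V, -, hV, htV, h1, h2, h3⟩ := hU u Set.univ Filter.univ_mem
    exact ⟨V, ⟨hV, h1, h2, h3⟩, Path.refl _, fun s => by simpa using htV, rfl⟩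
  have := key a b _ _ (refl_short a) (refl_short b)
  rw [← Path.Homotopic.Quotient.mk_refl, ← Path.Homotopic.Quotient.mk_symm, Path.refl_symm] at this
  simpa using this

end IsPathThick

namespace PathCocycle

variable {T Γ : Type*} [TopologicalSpace T] [Group Γ]

/-- A cocycle that is trivial on loops has a potential. -/
theorem exists_potential {U V : Set T} (F : PathCocycle U Γ) (hV : IsPathConnected (V ∩ U))
    (hF : ∀ (a : U) (γ : Path a a), (∀ s, (γ s : T) ∈ V) → F (PathClass.mk γ) = 1) :
    ∃ f : U → Γ, ∀ (a b : U) (γ : Path a b), (∀ s, (γ s : T) ∈ V) →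
      F (PathClass.mk γ) = f b * (f a)⁻¹ := by
  classical
  obtain ⟨u, hu⟩ := id hV.nonempty
  have : ∀ b : U, ∃ c : Γ, (b : T) ∈ V → ∃ δ : Path (⟨u, hu.2⟩ : U) b, (∀ s, (δ s : T) ∈ V) ∧
      c = F (PathClass.mk δ) := by
    intro b
    by_cases hb : (b : T) ∈ V
    · obtain ⟨δ, hδ⟩ := hV.exists_path hu ⟨hb, b.2⟩
      exact ⟨_, fun _ => ⟨δ.toSubtype fun s => (hδ s).2, fun s => (hδ s).1, rfl⟩⟩
    · exact ⟨1, fun h => absurd h hb⟩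
  choose f hf using this
  refine ⟨f, fun a b γ hγ => ?_⟩
  obtain ⟨α, hα, hfa⟩ := hf a (by simpa using hγ 0)
  obtain ⟨β, hβ, hfb⟩ := hf b (by simpa using hγ 1)
  rw [hfa, hfb]
  have := hF _ (α.trans (γ.trans β.symm)) (Path.trans_mem (V := Subtype.val ⁻¹' V) hα
    (Path.trans_mem (V := Subtype.val ⁻¹' V) hγ fun s => hβ _))
  rw [PathClass.mk, Path.Homotopic.Quotient.mk_trans, Path.Homotopic.Quotient.mk_trans,
    Path.Homotopic.Quotient.mk_symm, map_trans, map_trans, map_symm, mul_assoc,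
    inv_mul_eq_one] at this
  rw [← this.symm]
  group

/-- A cocycle on `U` that is locally trivial on `T` takes the same values on paths of `U` that are
homotopic in `T`. -/
theorem eq_of_map_eq {U : Set T} (hU : IsPathThick U) (F : PathCocycle U Γ)
    (hF : ∀ t : T, ∃ V ∈ 𝓝 t, ∀ (a : U) (γ : Path a a), (∀ s, (γ s : T) ∈ V) →
      F (PathClass.mk γ) = 1)
    {a b : U} {p q : PathClass a b} (hpq : p.map (subtypeMap U) = q.map (subtypeMap U)) :
    F p = F q := by
  classical
  -- The cocycle is realized as the monodromy of a covering of `T` with fibre `Γ`, glued by means of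
  -- local potentials. Monodromy depends only on the homotopy class in `T`.
  have : ∀ t : T, ∃ (V : Set T) (f : U → Γ), IsOpen V ∧ t ∈ V ∧ ∀ (a b : U) (γ : Path a b),
      (∀ s, (γ s : T) ∈ V) → F (PathClass.mk γ) = f b * (f a)⁻¹ := by
    intro t
    obtain ⟨N, hN, hNF⟩ := hF t
    obtain ⟨V, hVN, hV, htV, -, h, -⟩ := hU t N hN
    obtain ⟨f, hf⟩ := F.exists_potential h fun a γ hγ => hNF a γ fun s => hVN (hγ s)
    exact ⟨V, f, hV, htV, hf⟩
  choose V f hV htV hf using this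
  let l (x : T) : Filter U := Filter.comap Subtype.val (𝓝 x)
  have hl : ∀ x, (l x).NeBot := fun x => by
    rw [Filter.comap_neBot_iff]
    intro N hN
    obtain ⟨y, hy, hyU⟩ := mem_closure_iff_nhds.1 (hU.dense x) N hN
    exact ⟨⟨y, hyU⟩, hy⟩
  -- Two potentials on a path connected piece of `U` differ by a constant right factor. So the
  -- transition function is locally constant on `U`, and its limit along `U` defines it at all
  -- points of `T`.
  have hk : ∀ s t x, ∃ k : Γ, x ∈ V s ∩ V t → ∀ᶠ v in l x, (f t v)⁻¹ * f s v = k := by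
    intro s t x
    by_cases hx : x ∈ V s ∩ V t
    · obtain ⟨W, hW, hWo, hxW, -, h, -⟩ := hU x _ (((hV s).inter (hV t)).mem_nhds hx)
      obtain ⟨u, hu⟩ := id h.nonempty
      refine ⟨(f t ⟨u, hu.2⟩)⁻¹ * f s ⟨u, hu.2⟩, fun _ => ?_⟩
      refine Filter.eventually_comap.2 ?_
      filter_upwards [hWo.mem_nhds hxW] with y hy
      rintro v rfl
      obtain ⟨δ, hδ⟩ := h.exists_path hu ⟨hy, v.2⟩
      have h1 := hf s _ _ (δ.toSubtype fun s => (hδ s).2) fun r => (hW (hδ r).1).1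
      have h2 := hf t _ _ (δ.toSubtype fun s => (hδ s).2) fun r => (hW (hδ r).1).2
      rw [h1] at h2
      rw [inv_mul_eq_iff_eq_mul, ← mul_assoc, ← h2]
      group
    · exact ⟨1, fun h => absurd h hx⟩
  choose k hk using hk
  have hk_eq : ∀ s t x, x ∈ V s ∩ V t → ∀ c, (∀ᶠ v in l x, (f t v)⁻¹ * f s v = c) → k s t x = c := by
    intro s t x hx c hc
    have := hl x
    obtain ⟨v, h1, h2⟩ := ((hk s t x hx).and hc).exists
    rw [← h1, h2]
  have hk_self : ∀ s x, x ∈ V s → k s s x = 1 := fun s x hx =>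
    hk_eq s s x ⟨hx, hx⟩ 1 (by simp)
  have hk_mul : ∀ s t r x, x ∈ V s ∩ V t ∩ V r → k t r x * k s t x = k s r x := by
    intro s t r x hx
    refine (hk_eq s r x ⟨hx.1.1, hx.2⟩ _ ?_).symm
    filter_upwards [hk s t x hx.1, hk t r x ⟨hx.1.2, hx.2⟩] with v h1 h2
    rw [← h1, ← h2]
    group
  have hk_loc : ∀ s t x, x ∈ V s ∩ V t → ∀ᶠ y in 𝓝 x, k s t y = k s t x := by
    intro s t x hx
    have h1 := eventually_eventually_nhds.2 (Filter.eventually_comap.1 (hk s t x hx))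
    filter_upwards [h1, ((hV s).inter (hV t)).mem_nhds hx] with y hy hyV
    exact hk_eq s t y hyV _ (Filter.eventually_comap.2 hy)
  have hk_U : ∀ s t (x : U), (x : T) ∈ V s ∩ V t → k s t x = (f t x)⁻¹ * f s x := by
    intro s t x hx
    have h1 := (Filter.eventually_comap.1 (hk s t x hx)).self_of_nhds
    exact (h1 x rfl).symm
  let _ : TopologicalSpace Γ := ⊥
  have : DiscreteTopology Γ := ⟨rfl⟩
  let Z : FiberBundleCore T T Γ :=
    { baseSet := V
      isOpen_baseSet := hV
      indexAt := id
      mem_baseSet_at := htV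
      coordChange := fun s t x g => k s t x * g
      coordChange_self := fun s x hx g => by rw [hk_self s x hx, one_mul]
      continuousOn_coordChange := by
        intro s t
        rintro ⟨x, g⟩ ⟨hx, -⟩
        refine ContinuousAt.continuousWithinAt ?_
        have h1 : (fun p : T × Γ => k s t p.1 * p.2) =ᶠ[𝓝 (x, g)] fun _ => k s t x * g := by
          rw [nhds_prod_eq, nhds_discrete Γ, Filter.EventuallyEq, Filter.prod_pure, Filter.eventually_map]
          filter_upwards [hk_loc s t x hx] with y hy
          rw [hy]
        exact continuousAt_const.congr h1.symm
      coordChange_comp := fun s t r x hx g => by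
        rw [← mul_assoc, hk_mul s t r x hx] }
  have cov : IsCoveringMap (Z.proj) := FiberBundle.isCoveringMap (F := Γ) (E := Z.Fiber)
  -- This point has coordinate `(f t a)⁻¹ * h` in every trivialization `t` around `a`. Keeping that
  -- coordinate constant along `γ` from `a` to `b` turns `h` into `F γ * h`.
  let e (a : U) (h : Γ) : Z.proj ⁻¹' {(a : T)} := ⟨⟨(a : T), ((f a a)⁻¹ * h : Γ)⟩, rfl⟩
  have key : ∀ {a b : U} (p : PathClass a b), ∀ h : Γ, cov.monodromy (p.map (subtypeMap U)) (e a h) =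
      e b (F p * h) := fun p => PathClass.induction_local (T := U) (fun a b p => ∀ h : Γ,
      cov.monodromy (p.map (subtypeMap U)) (e a h) = e b (F p * h))
    (by
      intro a b c p q hp hq h
      rw [PathClass.map_trans, cov.monodromy_trans_apply, hp, hq, F.map_trans, mul_assoc])
    (by
      intro t
      refine ⟨Subtype.val ⁻¹' V t, (hV t).preimage continuous_subtype_val |>.mem_nhds (htV t), ?_⟩
      intro a b γ hγ h
      have hcont : Continuous fun s => (Z.localTriv (t : T)).toOpenPartialHomeomorph.symm
          ((γ s : T), (f t a)⁻¹ * h) := by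
        rw [← continuousOn_univ]
        refine (Z.localTriv (t : T)).toOpenPartialHomeomorph.symm.continuousOn.comp
          (t := (Z.localTriv (t : T)).toOpenPartialHomeomorph.symm.source) ?_ ?_
        · fun_prop
        · intro s _
          exact (Z.localTriv (t : T)).mem_target.2 (hγ s)
      have hval : ∀ c : U, (c : T) ∈ V t → ∀ h : Γ,
          (Z.localTriv (t : T)).toOpenPartialHomeomorph.symm ((c : T), (f t c)⁻¹ * h) = (e c h).1 := by
        intro c hc h
        rw [FiberBundleCore.localTriv_symm_apply]
        change (⟨(c : T), k t c c * ((f t c)⁻¹ * h)⟩ : Z.TotalSpace) = _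
        rw [hk_U _ _ _ ⟨hc, htV c⟩]
        simp [e]
      have hFγ := hf t a b γ hγ
      let δ : Path (e a h).1 (e b (F (PathClass.mk γ) * h)).1 :=
        { toFun := fun s => (Z.localTriv (t : T)).toOpenPartialHomeomorph.symm
            ((γ s : T), (f t a)⁻¹ * h)
          continuous_toFun := hcont
          source' := by simpa using hval a (by simpa using hγ 0) h
          target' := by
            rw [← hval b (by simpa using hγ 1), hFγ]
            simp [mul_assoc] }
      refine cov.monodromy_eq_of_map_eq (PathClass.mk δ) ?_
      exact congrArg PathClass.mk (a₁ := δ.map cov.continuous)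
        (a₂ := (γ.map (subtypeMap U).continuous).cast (e a h).2 (e b _).2) (Path.ext rfl))
    p
  have h1 := key p 1
  have h2 := key q 1
  rw [hpq, h2] at h1
  have h3 : (f b b)⁻¹ * (F q * 1) = (f b b)⁻¹ * (F p * 1) :=
    eq_of_heq (Bundle.TotalSpace.mk.inj (congrArg Subtype.val h1)).2
  simpa using h3.symm

/-- A locally trivial cocycle on a path thick subset extends. -/
theorem exists_extend {U : Set T} (hU : IsPathThick U) (F : PathCocycle U Γ)
    (hF : ∀ t : T, ∃ V ∈ 𝓝 t, ∀ (a : U) (γ : Path a a), (∀ s, (γ s : T) ∈ V) →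
      F (PathClass.mk γ) = 1) :
    ∃ F' : PathCocycle T Γ, ∀ {a b : U} (p : PathClass a b), F' (p.map (subtypeMap U)) = F p := by
  classical
  choose lift hlift using fun (a b : U) (p : PathClass (a : T) b) => hU.exists_map_eq p
  have hG : ∀ {a b : U} (p : PathClass a b), F (lift a b (p.map (subtypeMap U))) = F p :=
    fun p => F.eq_of_map_eq hU hF (hlift _ _ _)
  have hG' : ∀ {a b c : U} (p : PathClass (a : T) b) (q : PathClass (b : T) c),
      F (lift a c (p.trans q)) = F (lift b c q) * F (lift a b p) := by
    intro a b c p q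
    rw [← F.map_trans]
    refine F.eq_of_map_eq hU hF ?_
    rw [hlift, PathClass.map_trans, hlift, hlift]
  have : ∀ t : T, ∃ (u : U), Nonempty (PathClass t (u : T)) := by
    intro t
    obtain ⟨V, -, -, htV, h1, ⟨u, hu, -⟩, -⟩ := hU t Set.univ Filter.univ_mem
    obtain ⟨γ, -⟩ := h1.exists_path htV hu.1
    exact ⟨⟨u, hu.2⟩, ⟨PathClass.mk γ⟩⟩
  choose u σ using this
  replace σ := fun t => (σ t).some
  -- On `U` this is the value of `F` on the auxiliary path `σ t`; it undoes the conjugation by `σ`,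
  -- so that the extension restricts to `F` itself. Off `U` any value would do.
  let c (t : T) : Γ := if h : t ∈ U then F (lift ⟨t, h⟩ (u t) (σ t)) else 1
  have hc : ∀ a : U, c a = F (lift a (u a) (σ a)) := fun a => dif_pos a.2
  refine ⟨⟨fun {a b} p => (c b)⁻¹ * F (lift (u a) (u b) ((σ a).symm.trans (p.trans (σ b)))) * c a,
    ?_⟩, ?_⟩
  · intro x y z p q
    have : (σ x).symm.trans ((p.trans q).trans (σ z)) =
      ((σ x).symm.trans (p.trans (σ y))).trans ((σ y).symm.trans (q.trans (σ z))) := by simp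
    rw [this, hG']
    group
  · intro a b p
    change (c b)⁻¹ * F (lift (u a) (u b) ((σ a).symm.trans ((p.map (subtypeMap U)).trans (σ b)))) * c a = F p
    have h2 : F (lift _ _ (σ b).symm) = (F (lift b (u b) (σ b)))⁻¹ := by
      rw [← F.map_symm]
      refine F.eq_of_map_eq hU hF ?_
      rw [hlift, PathClass.map_symm, hlift]
    have h1 : F p = F (lift _ _ (σ b).symm) * (F (lift _ _ ((σ a).symm.trans
        ((p.map (subtypeMap U)).trans (σ b)))) * F (lift _ _ (σ a))) := by
      rw [← hG', ← hG', ← hG p]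
      simp
    rw [hc, hc, h1, h2]
    group

end PathCocycle

/-- A dense subset that locally does not disconnect a connected space is path connected. -/
theorem isPathConnected_of_locally {T : Type*} [TopologicalSpace T] [ConnectedSpace T] {U : Set T}
    (hd : Dense U) (hU : ∀ t : T, ∃ V ∈ 𝓝 t, IsPathConnected (V ∩ U)) : IsPathConnected U := by
  choose V hV hVU using hU
  choose u hu using fun t => (hVU t).nonempty
  have hloc : ∀ t, ∀ᶠ s in 𝓝 t, JoinedIn U (u t) (u s) := by
    intro t
    filter_upwards [eventually_mem_nhds_iff.2 (hV t)] with s hs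
    obtain ⟨x, hx, hxU⟩ := mem_closure_iff_nhds.1 (hd s) _ (Filter.inter_mem hs (hV s))
    exact (((hVU t).joinedIn _ (hu t) _ ⟨hx.1, hxU⟩).mono Set.inter_subset_right).trans
      (((hVU s).joinedIn _ ⟨hx.2, hxU⟩ _ (hu s)).mono Set.inter_subset_right)
  obtain ⟨t₀⟩ := (inferInstance : Nonempty T)
  have hcl : IsClopen {t | JoinedIn U (u t₀) (u t)} := by
    refine ⟨⟨isOpen_iff_mem_nhds.2 fun t ht => ?_⟩, isOpen_iff_mem_nhds.2 fun t ht => ?_⟩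
    · filter_upwards [hloc t] with s hs h
      exact ht (JoinedIn.trans h hs.symm)
    · filter_upwards [hloc t] with s hs
      exact JoinedIn.trans ht hs
  have huniv := hcl.eq_univ ⟨t₀, JoinedIn.refl (hu t₀).2⟩
  refine ⟨u t₀, (hu t₀).2, fun {y} hy => ?_⟩
  have h1 : JoinedIn U (u t₀) (u y) := (Set.ext_iff.1 huniv y).2 trivial
  exact h1.trans (((hVU y).joinedIn _ (hu y) _ ⟨mem_of_mem_nhds (hV y), hy⟩).mono
    Set.inter_subset_right)

/-! ### Path classes supported in a set, and finite generation of fundamental groups -/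

namespace PathClass

variable {T : Type*} [TopologicalSpace T]

/-- The class has a representative with values in `V`. -/
def _root_.Path.Homotopic.Quotient.InSet (V : Set T) {a b : T} (p : PathClass a b) : Prop :=
  ∃ γ : Path a b, (∀ s, γ s ∈ V) ∧ mk γ = p

end PathClass

namespace Path.Homotopic.Quotient.InSet

variable {T : Type*} [TopologicalSpace T]

variable {V W : Set T} {a b c : T} {p : PathClass a b} {q : PathClass b c}

theorem mk (γ : Path a b) (h : ∀ s, γ s ∈ V) : InSet V (PathClass.mk γ) := ⟨γ, h, rfl⟩

theorem trans (hp : p.InSet V) (hq : q.InSet V) : (p.trans q).InSet V := by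
  obtain ⟨γ, hγ, rfl⟩ := hp
  obtain ⟨δ, hδ, rfl⟩ := hq
  exact ⟨γ.trans δ, Path.trans_mem hγ hδ, rfl⟩

theorem symm (hp : p.InSet V) : p.symm.InSet V := by
  obtain ⟨γ, hγ, rfl⟩ := hp
  exact ⟨γ.symm, fun s => hγ _, rfl⟩

theorem mono (hp : p.InSet V) (h : V ⊆ W) : p.InSet W := by
  obtain ⟨γ, hγ, rfl⟩ := hp
  exact ⟨γ, fun s => h (hγ s), rfl⟩

theorem left (hp : p.InSet V) : a ∈ V := by
  obtain ⟨γ, hγ, rfl⟩ := hp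
  simpa using hγ 0

theorem right (hp : p.InSet V) : b ∈ V := by
  obtain ⟨γ, hγ, rfl⟩ := hp
  simpa using hγ 1

theorem map {T' : Type*} [TopologicalSpace T'] {V' : Set T'} (hp : p.InSet V) (f : C(T, T'))
    (h : Set.MapsTo f V V') : InSet V' (p.map f) := by
  obtain ⟨γ, hγ, rfl⟩ := hp
  exact ⟨γ.map f.continuous, fun s => h (hγ s), rfl⟩

end Path.Homotopic.Quotient.InSet

namespace PathClass

variable {T : Type*} [TopologicalSpace T]

end PathClass

theorem IsPathConnected.exists_pathClass {T : Type*} [TopologicalSpace T] {V : Set T}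
    (hV : IsPathConnected V) {a b : T} (ha : a ∈ V) (hb : b ∈ V) :
    ∃ p : PathClass a b, p.InSet V := by
  obtain ⟨γ, hγ⟩ := hV.exists_path ha hb
  exact ⟨PathClass.mk γ, γ, hγ, rfl⟩

/-- Finite generation of the fundamental group of a space with a finite open cover by path connected
sets, the unions of intersecting members of which lie in sets with finitely generated image. -/
theorem fundamentalGroup_fg {T : Type*} [TopologicalSpace T] [PathConnectedSpace T] (x₀ : T)
    {ι : Type*} [Finite ι] (W V : ι → Set T) (hW : ∀ i, IsOpen (W i)) (hcov : ∀ t, ∃ i, t ∈ W i)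
    (hWc : ∀ i, IsPathConnected (W i)) (hV : ∀ i j, (W i ∩ W j).Nonempty → W j ⊆ V i)
    (hfg : ∀ i, ∀ b ∈ W i, ∃ S : Set (FundamentalGroup T b), S.Finite ∧
      ∀ p : PathClass b b, p.InSet (V i) →
        FundamentalGroup.fromPath p ∈ Subgroup.closure S) :
    Group.FG (FundamentalGroup T x₀) := by
  classical
  choose b hb using fun i => (hWc i).nonempty
  choose S hS hSV using fun i => hfg i (b i) (hb i)
  let τ (i : ι) : PathClass x₀ (b i) := PathClass.mk (PathConnectedSpace.somePath _ _)
  have : ∀ i j, ∃ e : PathClass (b i) (b j), (W i ∩ W j).Nonempty → e.InSet (V i) := by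
    intro i j
    by_cases h : (W i ∩ W j).Nonempty
    · have hWi : W i ⊆ V i := hV i i (by simpa using (hWc i).nonempty)
      obtain ⟨x, hx⟩ := id h
      obtain ⟨p, hp⟩ := (hWc i).exists_pathClass (hb i) hx.1
      obtain ⟨q, hq⟩ := (hWc j).exists_pathClass hx.2 (hb j)
      exact ⟨p.trans q, fun _ => (hp.mono hWi).trans (hq.mono (hV i j h))⟩
    · exact ⟨PathClass.mk (PathConnectedSpace.somePath _ _), fun h' => absurd h' h⟩
  choose e he using this
  let cl {i j : ι} (p : PathClass (b i) (b j)) : FundamentalGroup T x₀ :=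
    FundamentalGroup.fromPath ((τ i).trans (p.trans (τ j).symm))
  have cl_trans : ∀ {i j k : ι} (p : PathClass (b i) (b j)) (q : PathClass (b j) (b k)),
      cl (p.trans q) = cl q * cl p := by
    intro i j k p q
    change _ = (FundamentalGroup.fromPath (Path.Homotopic.Quotient.trans _ _))
    simp [cl]
  have cl_symm : ∀ {i j : ι} (p : PathClass (b i) (b j)), cl p.symm = (cl p)⁻¹ := by
    intro i j p
    refine eq_inv_of_mul_eq_one_left ?_
    rw [← cl_trans]
    change FundamentalGroup.fromPath _ = FundamentalGroup.fromPath (Path.Homotopic.Quotient.refl _)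
    simp
  let φ (i : ι) : FundamentalGroup T (b i) →* FundamentalGroup T x₀ :=
    { toFun := fun p => cl (i := i) (j := i) p
      map_one' := by
        have := cl_trans (Path.Homotopic.Quotient.refl (b i)) (Path.Homotopic.Quotient.refl (b i))
        rw [Path.Homotopic.Quotient.refl_trans] at this
        exact left_eq_mul.1 this
      map_mul' := fun p q => cl_trans (i := i) (j := i) (k := i) q p }
  -- The local generators and the transition paths between the base points, all closed up through
  -- `τ`.
  let G : Set (FundamentalGroup T x₀) := (⋃ i, φ i '' S i) ∪ ⋃ i, ⋃ j, {cl (e i j)}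
  have hG : G.Finite := (Set.finite_iUnion fun i => (hS i).image _).union
    (Set.finite_iUnion fun i => Set.finite_iUnion fun j => Set.finite_singleton _)
  let H := Subgroup.closure G
  have hloop : ∀ i (p : PathClass (b i) (b i)), p.InSet (V i) → cl p ∈ H := by
    intro i p hp
    have h1 : Subgroup.closure (S i) ≤ H.comap (φ i) := by
      rw [Subgroup.closure_le]
      intro s hs
      exact Subgroup.subset_closure (Or.inl (Set.mem_iUnion.2 ⟨i, s, hs, rfl⟩))
    exact h1 (hSV i p hp)
  have hpath : ∀ i j (p : PathClass (b i) (b j)), (W i ∩ W j).Nonempty → p.InSet (V i) →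
      cl p ∈ H := by
    intro i j p hij hp
    have h1 : p = (p.trans (e i j).symm).trans (e i j) := by simp
    rw [h1, cl_trans]
    exact H.mul_mem (Subgroup.subset_closure (Or.inr (Set.mem_iUnion₂.2 ⟨i, j, rfl⟩)))
      (hloop i _ (hp.trans (he i j hij).symm))
  have key := fun (p : PathClass x₀ x₀) => PathClass.induction_local (fun x y p => ∀ i j
    (σ : PathClass (b i) x) (τ : PathClass (b j) y), σ.InSet (W i) → τ.InSet (W j) →
      cl (σ.trans (p.trans τ.symm)) ∈ H)
    (by
      intro x y z p q hp hq i j σ τ hσ hτ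
      obtain ⟨k, hk⟩ := hcov y
      obtain ⟨ρ, hρ⟩ := (hWc k).exists_pathClass (hb k) hk
      have := H.mul_mem (hq k j ρ τ hρ hτ) (hp i k σ ρ hσ hρ)
      rw [← cl_trans] at this
      simpa using this)
    (by
      intro t
      obtain ⟨k, hk⟩ := hcov t
      refine ⟨W k, (hW k).mem_nhds hk, fun x y γ hγ i j σ τ hσ hτ => ?_⟩
      have hx : x ∈ W k := by simpa using hγ 0
      have hy : y ∈ W k := by simpa using hγ 1
      obtain ⟨σ', hσ'⟩ := (hWc k).exists_pathClass (hb k) hx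
      obtain ⟨τ', hτ'⟩ := (hWc k).exists_pathClass (hb k) hy
      have hWi : ∀ i, W i ⊆ V i := fun i => hV i i (by simpa using (hWc i).nonempty)
      have hik : (W i ∩ W k).Nonempty := ⟨x, hσ.right, hx⟩
      have hjk : (W j ∩ W k).Nonempty := ⟨y, hτ.right, hy⟩
      -- A path inside `W k` factors into a transition from `b i` to `b k`, a loop at `b k` and a
      -- transition to `b j`. The hypothesis on intersecting members keeps each factor inside one of
      -- the sets `V`.
      have h1 := hpath i k (σ.trans σ'.symm) hik
        ((hσ.mono (hWi i)).trans (hσ'.symm.mono (hV i k hik)))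
      have h2 := hloop k (σ'.trans ((PathClass.mk γ).trans τ'.symm)) 
        ((hσ'.trans ((Path.Homotopic.Quotient.InSet.mk γ hγ).trans hτ'.symm)).mono (hWi k))
      have h3 := hpath j k (τ.trans τ'.symm) hjk
        ((hτ.mono (hWi j)).trans (hτ'.symm.mono (hV j k hjk)))
      rw [← H.inv_mem_iff, ← cl_symm] at h3
      have h4 := H.mul_mem (H.mul_mem h3 h2) h1
      rw [← cl_trans, ← cl_trans] at h4
      simpa using h4)
    p
  refine Group.fg_iff.2 ⟨G, ?_, hG⟩
  rw [eq_top_iff]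
  intro g _
  obtain ⟨i, hi⟩ := hcov x₀
  obtain ⟨ρ, hρ⟩ := (hWc i).exists_pathClass (hb i) hi
  have h1 : ∀ p : PathClass x₀ x₀, cl (ρ.trans (p.trans ρ.symm)) ∈ H :=
    fun p => key p i i ρ ρ hρ hρ
  let c : PathClass x₀ x₀ := (τ i).trans ρ
  have h2 := h1 (c.symm.trans ((show PathClass x₀ x₀ from g).trans c))
  simpa [cl, c] using h2

/-! ### Complements of analytic hypersurfaces -/

section Holomorphic

variable {E : Type*} [NormedAddCommGroup E] [NormedSpace ℂ E]
  {Ω : Set E} {G : E → ℂ}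

theorem isOpen_line_preimage (ho : IsOpen Ω) (a v : E) : IsOpen {t : ℂ | a + t • v ∈ Ω} :=
  ho.preimage (by fun_prop)

theorem convex_line_preimage (hΩ : Convex ℝ Ω) (a v : E) : Convex ℝ {t : ℂ | a + t • v ∈ Ω} := by
  intro s hs t ht p q hp hq hpq
  have := hΩ hs ht hp hq hpq
  have h1 : p • (a + s • v) + q • (a + t • v) = a + (p • s + q • t) • v := by
    have : a = p • a + q • a := by rw [← add_smul, hpq, one_smul]
    conv_rhs => rw [this]
    rw [add_smul, smul_add, smul_add, smul_assoc, smul_assoc]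
    abel
  rw [h1] at this
  exact this

theorem analyticOnNhd_line (ho : IsOpen Ω) (hG : DifferentiableOn ℂ G Ω) (a v : E) :
    AnalyticOnNhd ℂ (fun t : ℂ => G (a + t • v)) {t : ℂ | a + t • v ∈ Ω} :=
  DifferentiableOn.analyticOnNhd
    (hG.comp (f := fun t : ℂ => a + t • v) (by fun_prop) fun _ ht => ht) (isOpen_line_preimage ho a v)

/-- The complement of a hypersurface is dense. -/
theorem exists_ne_zero_of_mem_nhds (hΩ : Convex ℝ Ω) (ho : IsOpen Ω) (hG : DifferentiableOn ℂ G Ω)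
    (hne : ∃ b ∈ Ω, G b ≠ 0) {a : E} (ha : a ∈ Ω) {N : Set E} (hN : N ∈ 𝓝 a) :
    ∃ c ∈ N, c ∈ Ω ∧ G c ≠ 0 := by
  obtain ⟨b, hb, hGb⟩ := hne
  by_contra! h
  have h0 : (0 : ℂ) ∈ {t : ℂ | a + t • (b - a) ∈ Ω} := by simpa using ha
  have h1 : (1 : ℂ) ∈ {t : ℂ | a + t • (b - a) ∈ Ω} := by simpa using hb
  have hcont : Filter.Tendsto (fun t : ℂ => a + t • (b - a)) (𝓝 0) (𝓝 a) := by
    have : Continuous fun t : ℂ => a + t • (b - a) := by fun_prop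
    simpa using this.tendsto 0
  have hev : (fun t : ℂ => G (a + t • (b - a))) =ᶠ[𝓝 0] 0 := by
    filter_upwards [hcont hN, hcont (ho.mem_nhds ha)] with t ht htΩ using h _ ht htΩ
  -- Identity theorem on the complex line through `a` and `b`.
  have := (analyticOnNhd_line ho hG a (b - a)).eqOn_zero_of_preconnected_of_eventuallyEq_zero
    (convex_line_preimage hΩ a (b - a)).isPreconnected h0 hev h1
  simp at this
  exact hGb this

/-- The complement of a hypersurface in a convex open set is path connected. -/
theorem joinedIn_ne_zero (hΩ : Convex ℝ Ω) (ho : IsOpen Ω) (hG : DifferentiableOn ℂ G Ω)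
    {a b : E} (ha : a ∈ Ω) (hGa : G a ≠ 0) (hb : b ∈ Ω) (hGb : G b ≠ 0) :
    JoinedIn (Ω ∩ {x | G x ≠ 0}) a b := by
  set D := {t : ℂ | a + t • (b - a) ∈ Ω} with hD
  have hDo : IsOpen D := isOpen_line_preimage ho a (b - a)
  have hDc : Convex ℝ D := convex_line_preimage hΩ a (b - a)
  have hg := analyticOnNhd_line ho hG a (b - a)
  set g := fun t : ℂ => G (a + t • (b - a)) with hgdef
  have h0 : (0 : ℂ) ∈ D := by simpa [hD] using ha
  have h1 : (1 : ℂ) ∈ D := by simpa [hD] using hb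
  have hsc : IsCompact ((fun x : ℝ => (x : ℂ)) '' Set.Icc 0 1) :=
    isCompact_Icc.image Complex.continuous_ofReal
  have hsD : (fun x : ℝ => (x : ℂ)) '' Set.Icc 0 1 ⊆ D := by
    rintro _ ⟨x, hx, rfl⟩
    have := hDc h0 h1 (sub_nonneg.2 hx.2) hx.1 (by ring)
    simpa using this
  obtain ⟨δ, hδ, hδD⟩ := hsc.exists_cthickening_subset_open hDo hsD
  set K := Metric.cthickening δ ((fun x : ℝ => (x : ℂ)) '' Set.Icc 0 1)
  have hK : IsCompact K := hsc.cthickening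
  have hfin : (K ∩ {t | g t = 0}).Finite := by
    by_contra hinf
    obtain ⟨z, hzK, hz⟩ := Set.Infinite.exists_accPt_of_subset_isCompact hinf hK
      Set.inter_subset_left
    rw [accPt_iff_frequently_nhdsNE] at hz
    have := hg.eqOn_zero_of_preconnected_of_frequently_eq_zero hDc.isPreconnected (hδD hzK)
      (hz.mono fun t ht => ht.2) h1
    simp [hgdef] at this
    exact hGb this
  -- A pencil of arcs from `0` to `1` in the complex parameter line, bulging by `s`; for `s ≤ δ`
  -- they stay in the compact set `K`, which contains finitely many zeros.
  let c (s x : ℝ) : ℂ := x + (s * (x * (1 - x)) : ℝ) * Complex.I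
  have hcK : ∀ s ∈ Set.Icc 0 δ, ∀ x ∈ Set.Icc (0 : ℝ) 1, c s x ∈ K := by
    intro s hs x hx
    refine Metric.mem_cthickening_of_dist_le _ (x : ℂ) _ _ ⟨x, hx, rfl⟩ ?_
    rw [dist_eq_norm]
    simp only [c, add_sub_cancel_left, norm_mul, Complex.norm_real, Complex.norm_I, mul_one]
    have h2 : 0 ≤ x * (1 - x) := mul_nonneg hx.1 (by linarith [hx.2])
    have h3 : x * (1 - x) ≤ 1 := by nlinarith [hx.1, hx.2]
    rw [Real.norm_eq_abs, abs_of_nonneg hs.1, Real.norm_eq_abs,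
      abs_of_nonneg hx.1, Real.norm_eq_abs, abs_of_nonneg (by linarith [hx.2] : (0 : ℝ) ≤ 1 - x)]
    nlinarith [hs.1, hs.2]
  obtain ⟨s, hs, hsne⟩ : ∃ s ∈ Set.Icc 0 δ, ∀ x ∈ Set.Icc (0 : ℝ) 1, g (c s x) ≠ 0 := by
    by_contra! hbad
    -- Distinct arcs meet only at their ends: `s` is recovered from any inner point of its arc. So
    -- finitely many zeros spoil only finitely many arcs.
    refine (Set.Icc_infinite hδ).mono (t := (fun z : ℂ => z.im / (z.re * (1 - z.re))) ''
      (K ∩ {t | g t = 0})) ?_ (hfin.image _)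
    intro s hs
    obtain ⟨x, hx, hgx⟩ := hbad s hs
    refine ⟨c s x, ⟨hcK s hs x hx, hgx⟩, ?_⟩
    have hx0 : x ≠ 0 := by
      rintro rfl
      simp [c, hgdef] at hgx
      exact hGa hgx
    have hx1 : 1 - x ≠ 0 := by
      intro h
      obtain rfl : x = 1 := by linarith
      simp [c, hgdef] at hgx
      exact hGb hgx
    simp [c]
    field_simp
  let γ : Path a b :=
    { toFun := fun x => a + c s x • (b - a)
      continuous_toFun := by simp only [c]; fun_prop
      source' := by simp [c]
      target' := by simp [c] }
  exact ⟨γ, fun x => And.intro (hδD (hcK s hs x x.2)) (hsne x x.2)⟩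

/-- A subset of a convex open set, open and containing the complement of a hypersurface, is path
connected. -/
theorem isPathConnected_of_ne_zero (hΩ : Convex ℝ Ω) (ho : IsOpen Ω)
    (hG : DifferentiableOn ℂ G Ω) (hne : ∃ b ∈ Ω, G b ≠ 0) {U : Set E} (hU : IsOpen (Ω ∩ U))
    (hGU : ∀ x ∈ Ω, G x ≠ 0 → x ∈ U) : IsPathConnected (Ω ∩ U) := by
  have key : ∀ a ∈ Ω ∩ U, ∃ c ∈ Ω, G c ≠ 0 ∧ JoinedIn (Ω ∩ U) a c := by
    intro a ha
    obtain ⟨r, hr, hrU⟩ := Metric.isOpen_iff.1 hU a ha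
    obtain ⟨c, hcB, hcΩ, hGc⟩ := exists_ne_zero_of_mem_nhds hΩ ho hG hne ha.1
      (Metric.ball_mem_nhds a hr)
    refine ⟨c, hcΩ, hGc, JoinedIn.mono ?_ hrU⟩
    exact ((convex_ball a r).isPathConnected ⟨a, Metric.mem_ball_self hr⟩).joinedIn _
      (Metric.mem_ball_self hr) _ hcB
  obtain ⟨b, hb, hGb⟩ := hne
  refine ⟨b, ⟨hb, hGU b hb hGb⟩, fun {y} hy => ?_⟩
  obtain ⟨c, hc, hGc, hyc⟩ := key y hy
  have hsub : Ω ∩ {x | G x ≠ 0} ⊆ Ω ∩ U := fun x hx => ⟨hx.1, hGU x hx.1 hx.2⟩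
  exact ((joinedIn_ne_zero hΩ ho hG hb hGb hc hGc).mono hsub).trans hyc.symm

end Holomorphic

noncomputable section

/-! ### Polydiscs and charts -/

/-- The polydisc of radius `ε`. -/
def polyball (n : ℕ) (ε : ℝ) : Set (Fin n → ℂ) := {z | ∀ k, ‖z k‖ < ε}

theorem polyball_eq_pi (n : ℕ) (ε : ℝ) :
    polyball n ε = Set.univ.pi fun _ => Metric.ball (0 : ℂ) ε := by
  ext z; simp [polyball]

theorem isOpen_polyball (n : ℕ) (ε : ℝ) : IsOpen (polyball n ε) := by
  rw [polyball_eq_pi]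
  exact isOpen_set_pi Set.finite_univ fun _ _ => Metric.isOpen_ball

theorem isOpen_polydisc (n : ℕ) : IsOpen (polydisc n) := isOpen_polyball n 1

theorem convex_polyball (n : ℕ) (ε : ℝ) : Convex ℝ (polyball n ε) := by
  rw [polyball_eq_pi]
  exact convex_pi fun _ _ => convex_ball _ _

theorem zero_mem_polyball {n : ℕ} {ε : ℝ} (hε : 0 < ε) : (0 : Fin n → ℂ) ∈ polyball n ε := by
  intro k; simpa using hε

theorem zero_mem_polydisc (n : ℕ) : (0 : Fin n → ℂ) ∈ polydisc n := zero_mem_polyball one_pos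

theorem polyball_mono {n : ℕ} {ε δ : ℝ} (h : ε ≤ δ) : polyball n ε ⊆ polyball n δ :=
  fun _ hz k => (hz k).trans_le h

theorem polyball_subset_polydisc {n : ℕ} {ε : ℝ} (h : ε ≤ 1) : polyball n ε ⊆ polydisc n :=
  polyball_mono h

theorem exists_polyball_subset {n : ℕ} {N : Set (Fin n → ℂ)} (hN : N ∈ 𝓝 0) :
    ∃ ε, 0 < ε ∧ ε ≤ 1 ∧ polyball n ε ⊆ N := by
  obtain ⟨r, hr, hrN⟩ := Metric.mem_nhds_iff.1 hN
  refine ⟨min r 1, lt_min hr one_pos, min_le_right _ _, fun z hz => hrN ?_⟩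
  rw [mem_ball_zero_iff, pi_norm_lt_iff hr]
  exact fun k => (hz k).trans_le (min_le_left _ _)

/-- The points with nonzero coordinates. -/
def torus (n : ℕ) : Set (Fin n → ℂ) := {z | ∀ k, z k ≠ 0}

theorem mem_torus_iff_prod {n : ℕ} {z : Fin n → ℂ} : z ∈ torus n ↔ ∏ k, z k ≠ 0 := by
  simp [torus, Finset.prod_ne_zero_iff]

theorem differentiable_prod_coord (n : ℕ) : Differentiable ℂ fun z : Fin n → ℂ => ∏ k, z k := by
  fun_prop

theorem exists_mem_torus_of_mem_nhds {n : ℕ} {a : Fin n → ℂ} {N : Set (Fin n → ℂ)}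
    (hN : N ∈ 𝓝 a) : ∃ c ∈ N, c ∈ torus n := by
  obtain ⟨c, hc, -, h⟩ := exists_ne_zero_of_mem_nhds (Ω := Set.univ) convex_univ isOpen_univ
    (differentiable_prod_coord n).differentiableOn ⟨fun _ => 1, trivial, by simp⟩ trivial hN
  exact ⟨c, hc, mem_torus_iff_prod.2 h⟩

/-- Lifting of paths through a locally injective open map. -/
theorem exists_path_lift_of_injOn {Z T : Type*} [TopologicalSpace Z] [TopologicalSpace T]
    {f : Z → T} {B : Set Z} (hB : IsOpen B) (hf : ∀ W ⊆ B, IsOpen W → IsOpen (f '' W))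
    (hinj : Set.InjOn f B) {a b : T} (γ : Path a b) (hγ : ∀ s, γ s ∈ f '' B) :
    ∃ (w w' : Z) (δ : Path w w'), (∀ s, δ s ∈ B) ∧ ∀ s, f (δ s) = γ s := by
  choose g hgB hg using hγ
  have hcont : Continuous g := by
    rw [continuous_iff_continuousAt]
    intro s
    rw [ContinuousAt, Filter.tendsto_def]
    intro N hN
    obtain ⟨N', hN'N, hN'o, hsN'⟩ := mem_nhds_iff.1 hN
    have h1 : γ ⁻¹' (f '' (N' ∩ B)) ∈ 𝓝 s :=
      ((hf _ Set.inter_subset_right (hN'o.inter hB)).preimage γ.continuous).mem_nhds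
        ⟨g s, ⟨hsN', hgB s⟩, hg s⟩
    filter_upwards [h1] with r hr
    obtain ⟨u, hu, hur⟩ := hr
    have : u = g r := hinj hu.2 (hgB r) (hur.trans (hg r).symm)
    exact hN'N (this ▸ hu.1)
  exact ⟨g 0, g 1, ⟨⟨g, hcont⟩, rfl, rfl⟩, hgB, hg⟩

namespace QuotientChart

variable {n : ℕ} {X : Type*} [TopologicalSpace X] (c : QuotientChart n X)

theorem norm_eq_one {a : Fin n → ℂˣ} (ha : a ∈ c.grp) (k : Fin n) : ‖(a k : ℂ)‖ = 1 := by
  have := c.finite_grp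
  have h1 : IsOfFinOrder (⟨a, ha⟩ : c.grp) := isOfFinOrder_of_finite _
  obtain ⟨m, hm, h⟩ := h1.exists_pow_eq_one
  have h2 : (a k : ℂ) ^ m = 1 := by
    have := congrArg (fun x : c.grp => ((x.1 k : ℂˣ) : ℂ)) h
    simpa using this
  exact Complex.norm_eq_one_of_pow_eq_one h2 hm.ne'

/-- Action of a diagonal matrix. -/
def act (a : Fin n → ℂˣ) (z : Fin n → ℂ) : Fin n → ℂ := fun k => (a k : ℂ) * z k

theorem continuous_act (a : Fin n → ℂˣ) : Continuous (act a) := by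
  unfold act; fun_prop

variable {c} in
theorem act_mem_polyball {a : Fin n → ℂˣ} (ha : a ∈ c.grp) {ε : ℝ} {z : Fin n → ℂ}
    (hz : z ∈ polyball n ε) : act a z ∈ polyball n ε := by
  intro k
  rw [act, norm_mul, c.norm_eq_one ha, one_mul]
  exact hz k

variable {c} in
theorem map_act {a : Fin n → ℂˣ} (ha : a ∈ c.grp) {z : Fin n → ℂ} (hz : z ∈ polydisc n) :
    c.map (act a z) = c.map z :=
  ((c.map_eq_iff z hz _ (act_mem_polyball (ε := 1) ha hz)).2 ⟨a, ha, fun _ => rfl⟩).symm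

variable {c} in
theorem exists_act_of_map_eq {z w : Fin n → ℂ} (hz : z ∈ polydisc n) (hw : w ∈ polydisc n)
    (h : c.map z = c.map w) : ∃ a ∈ c.grp, w = act a z := by
  obtain ⟨a, ha, h⟩ := (c.map_eq_iff z hz w hw).1 h
  exact ⟨a, ha, funext h⟩

/-- The stabilizer of a point. -/
def stab (z : Fin n → ℂ) : Subgroup (Fin n → ℂˣ) where
  carrier := {a | a ∈ c.grp ∧ ∀ k, z k ≠ 0 → a k = 1}
  one_mem' := ⟨c.grp.one_mem, fun _ _ => rfl⟩
  mul_mem' ha hb := ⟨c.grp.mul_mem ha.1 hb.1, fun k hk => by simp [ha.2 k hk, hb.2 k hk]⟩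
  inv_mem' ha := ⟨c.grp.inv_mem ha.1, fun k hk => by simp [ha.2 k hk]⟩

theorem act_eq_iff {z : Fin n → ℂ} {a : Fin n → ℂˣ} :
    act a z = z ↔ ∀ k, z k ≠ 0 → a k = 1 := by
  rw [funext_iff]
  refine forall_congr' fun k => ?_
  by_cases hk : z k = 0
  · simp [act, hk]
  · simp [act, hk]

theorem stab_mono {z w : Fin n → ℂ} (h : ∀ k, z k ≠ 0 → w k ≠ 0) : c.stab w ≤ c.stab z :=
  fun _ ha => ⟨ha.1, fun k hk => ha.2 k (h k hk)⟩

theorem stab_eq_bot_of_torus {z : Fin n → ℂ} (h : z ∈ torus n) : c.stab z = ⊥ := by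
  rw [eq_bot_iff]
  exact fun a ha => Subgroup.mem_bot.2 (funext fun k => ha.2 k (h k))

/-- An element fixing such a point can differ from `1` only in the entry `j`, so it fixes the
hyperplane `z j = 0` pointwise. Smallness of the group excludes this, which makes generic points of
every coordinate hyperplane smooth. -/
theorem stab_eq_bot_of_ne {z : Fin n → ℂ} (j : Fin n) (h : ∀ k, k ≠ j → z k ≠ 0) :
    c.stab z = ⊥ := by
  rw [eq_bot_iff]
  exact fun a ha => Subgroup.mem_bot.2 (c.small a ha.1 j fun k hk => ha.2 k (h k hk))

theorem stab_eq_bot_of_grp (h : c.grp = ⊥) (z : Fin n → ℂ) : c.stab z = ⊥ := by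
  rw [eq_bot_iff, ← h]
  exact fun a ha => ha.1

/-- The image of a polydisc. -/
def nbhd (ε : ℝ) : Set X := c.map '' polyball n ε

theorem isOpen_nbhd {ε : ℝ} (hε : ε ≤ 1) : IsOpen (c.nbhd ε) :=
  c.isOpen_image _ (polyball_subset_polydisc hε) (isOpen_polyball n ε)

theorem nbhd_mono {ε δ : ℝ} (h : ε ≤ δ) : c.nbhd ε ⊆ c.nbhd δ :=
  Set.image_mono (polyball_mono h)

theorem continuousAt_map {z : Fin n → ℂ} (hz : z ∈ polydisc n) : ContinuousAt c.map z :=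
  c.continuousOn_map.continuousAt ((isOpen_polydisc n).mem_nhds hz)

theorem exists_nbhd_subset {N : Set X} (hN : N ∈ 𝓝 (c.map 0)) :
    ∃ ε, 0 < ε ∧ ε ≤ 1 ∧ c.nbhd ε ⊆ N := by
  obtain ⟨ε, h0, h1, h⟩ := exists_polyball_subset (c.continuousAt_map (zero_mem_polydisc n) hN)
  exact ⟨ε, h0, h1, by rintro _ ⟨z, hz, rfl⟩; exact h hz⟩

theorem injOn_of_grp (h : c.grp = ⊥) : Set.InjOn c.map (polydisc n) := by
  intro z hz w hw hzw
  obtain ⟨a, ha, rfl⟩ := exists_act_of_map_eq hz hw hzw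
  rw [h, Subgroup.mem_bot] at ha
  subst ha
  funext k; simp [act]

end QuotientChart

namespace NCOrbifold

open QuotientChart

variable {n : ℕ} {X : Type*} [TopologicalSpace X] (O : NCOrbifold n X)

/-- The isotropy group at a point of a chart has the order of the stabilizer. -/
theorem card_grp_chart (p : X) {z : Fin n → ℂ} (hz : z ∈ polydisc n) :
    Nat.card (O.chart ((O.chart p).map z)).grp = Nat.card ((O.chart p).stab z) := by
  classical
  obtain ⟨h, h0s, h0, hsrc, htgt, -, -, hcomp⟩ := O.compatible p z hz
  set c := O.chart p
  set d := O.chart (c.map z)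
  have := c.finite_grp
  have := d.finite_grp
  -- As the group is finite, near `z` only elements fixing `z` can carry a point to another nearby
  -- point.
  have hev : ∀ᶠ x : (Fin n → ℂ) × (Fin n → ℂ) in 𝓝 z ×ˢ 𝓝 z,
      ∀ a : c.grp, x.2 = act a x.1 → act a z = z := by
    rw [Filter.eventually_all]
    intro a
    by_cases ha : act a z = z
    · exact Filter.Eventually.of_forall fun _ _ => ha
    · rw [← nhds_prod_eq]
      have hc : Continuous fun x : (Fin n → ℂ) × (Fin n → ℂ) => x.2 - act a x.1 :=
        continuous_snd.sub ((continuous_act (a : Fin n → ℂˣ)).comp continuous_fst)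
      filter_upwards [hc.continuousAt.eventually_ne (x := (z, z)) (y := 0)
        (by simpa [sub_eq_zero] using fun h => ha h.symm)] with x hx h
      exact absurd (sub_eq_zero.2 h) hx
  obtain ⟨O', hO', hO'a⟩ := Filter.eventually_prod_self_iff'.1 hev
  have hz_t : z ∈ h.target := h0 ▸ h.map_source h0s
  have hcont0 : Filter.Tendsto h (𝓝 0) (𝓝 z) := by
    have := h.continuousAt h0s
    rwa [ContinuousAt, h0] at this
  obtain ⟨r, hr, hr1, hrs⟩ := exists_polyball_subset (N := h.source ∩ h ⁻¹' O')
    (Filter.inter_mem (h.open_source.mem_nhds h0s) (hcont0 hO'))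
  have hst : ∀ a : c.stab z, act a z = z := fun a => by
    funext k
    by_cases hk : z k = 0
    · simp [act, hk]
    · simp [act, a.2.2 k hk]
  have hN : ∀ᶠ w in 𝓝 (0 : Fin n → ℂ), w ∈ polyball n r ∧ ∀ a : c.stab z,
      act a (h w) ∈ h.target ∧ h.symm (act a (h w)) ∈ polyball n r := by
    have : Finite (c.stab z) := Finite.of_injective (fun a : c.stab z => (⟨a, a.2.1⟩ : c.grp))
      fun a b hab => Subtype.ext (congrArg (fun x : c.grp => x.1) hab)
    refine Filter.Eventually.and ((isOpen_polyball n r).mem_nhds (zero_mem_polyball hr))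
      (Filter.eventually_all.2 ?_)
    intro a
    have h1 : Filter.Tendsto (fun w => act a (h w)) (𝓝 0) (𝓝 z) := by
      have := ((continuous_act a.1).tendsto z).comp hcont0
      rwa [hst a] at this
    have h2 : Filter.Tendsto (fun w => h.symm (act a (h w))) (𝓝 0) (𝓝 0) := by
      have h3 := h.symm.continuousAt (x := z) hz_t
      have h4 : h.symm z = 0 := by rw [← h0, h.left_inv h0s]
      rw [ContinuousAt, h4] at h3
      exact h3.comp h1
    exact Filter.Eventually.and (h1 (h.open_target.mem_nhds hz_t))
      (h2 ((isOpen_polyball n r).mem_nhds (zero_mem_polyball hr)))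
  obtain ⟨N, hNsub, hNo, h0N⟩ := mem_nhds_iff.1 hN
  obtain ⟨w₀, hw₀N, hw₀⟩ := exists_mem_torus_of_mem_nhds (hNo.mem_nhds h0N)
  have htorus : IsOpen (torus n) := by
    have : torus n = {z | ∏ k, z k ≠ 0} := Set.ext fun z => mem_torus_iff_prod
    rw [this]
    exact isOpen_ne_fun (differentiable_prod_coord n).continuous continuous_const
  have hNs : N ⊆ h.source := fun w hw => (hrs (hNsub hw).1).1
  have himg : IsOpen (h '' (N ∩ torus n)) :=
    h.isOpen_image_of_subset_source (hNo.inter htorus) (Set.inter_subset_left.trans hNs)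
  -- Both `w` and `h w` have nonzero coordinates, so an element of either group is determined by its
  -- effect on one point. Transport through `h` then gives injections between the two groups in both
  -- directions.
  obtain ⟨_, ⟨w, hw, rfl⟩, hhw⟩ := exists_mem_torus_of_mem_nhds
    (himg.mem_nhds ⟨w₀, ⟨hw₀N, hw₀⟩, rfl⟩)
  obtain ⟨hwr, hwa⟩ := hNsub hw.1
  have hinj : ∀ {a b : Fin n → ℂˣ} {u : Fin n → ℂ}, u ∈ torus n → act a u = act b u → a = b := by
    intro a b u hu hab
    funext k
    have := congrFun hab k
    exact Units.ext (mul_right_cancel₀ (hu k) this)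
  have hws := hNs hw.1
  apply le_antisymm
  · have : ∀ b : d.grp, ∃ a : c.stab z, h (act b w) = act a (h w) := by
      intro b
      have hbw : act b w ∈ polyball n r := act_mem_polyball b.2 hwr
      have h1 : c.map (h w) = c.map (h (act b w)) := by
        rw [hcomp w hws, hcomp _ (hrs hbw).1,
          map_act b.2 (polyball_subset_polydisc hr1 hwr)]
      obtain ⟨a, ha, hab⟩ := exists_act_of_map_eq (htgt (h.map_source hws))
        (htgt (h.map_source (hrs hbw).1)) h1
      refine ⟨⟨a, ha, act_eq_iff.1 ?_⟩, hab⟩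
      exact hO'a _ (hrs hwr).2 _ (hrs hbw).2 ⟨a, ha⟩ hab
    choose f hf using this
    have : Finite (c.stab z) := Finite.of_injective (fun a : c.stab z => (⟨a, a.2.1⟩ : c.grp))
      fun a b hab => Subtype.ext (congrArg (fun x : c.grp => x.1) hab)
    refine Nat.card_le_card_of_injective f fun b b' hbb => ?_
    have h1 : h (act b w) = h (act b' w) := by rw [hf, hf, hbb]
    exact Subtype.ext (hinj hw.2 (h.injOn (hrs (act_mem_polyball b.2 hwr)).1
      (hrs (act_mem_polyball b'.2 hwr)).1 h1))
  · have : ∀ a : c.stab z, ∃ b : d.grp, h.symm (act a (h w)) = act b w := by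
      intro a
      obtain ⟨h1, h2⟩ := hwa a
      have h3 : d.map w = d.map (h.symm (act a (h w))) := by
        rw [← hcomp w hws, ← hcomp _ (hrs h2).1, h.right_inv h1,
          map_act a.2.1 (htgt (h.map_source hws))]
      obtain ⟨b, hb, hab⟩ := exists_act_of_map_eq (hsrc hws) (hsrc (hrs h2).1) h3
      exact ⟨⟨b, hb⟩, hab⟩
    choose f hf using this
    refine Nat.card_le_card_of_injective f fun a a' haa => ?_
    have h1 : h.symm (act a (h w)) = h.symm (act a' (h w)) := by rw [hf, hf, haa]
    exact Subtype.ext (hinj hhw (h.symm.injOn (hwa a).1 (hwa a').1 h1))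

theorem chart_grp_eq_bot_iff (p : X) {z : Fin n → ℂ} (hz : z ∈ polydisc n) :
    (O.chart ((O.chart p).map z)).grp = ⊥ ↔ (O.chart p).stab z = ⊥ := by
  have := (O.chart ((O.chart p).map z)).finite_grp
  rw [← Subgroup.card_eq_one, ← Subgroup.card_eq_one, O.card_grp_chart p hz]

/-- The points at which the complex space is smooth. -/
def smoothPart : Set X := {x | (O.chart x).grp = ⊥}

/-- The points at which the orbifold structure is trivial. -/
def trivialPart : Set X := {x | (O.chart x).grp = ⊥ ∧ ∀ i, x ∈ O.D i → O.index i = 1}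

theorem regPart_subset_trivialPart : O.regPart ⊆ O.trivialPart :=
  fun _ hx => ⟨hx.1, fun i hi => absurd hi (hx.2 i)⟩

theorem trivialPart_subset_smoothPart : O.trivialPart ⊆ O.smoothPart := fun _ hx => hx.1

theorem regPart_subset_smoothPart : O.regPart ⊆ O.smoothPart := fun _ hx => hx.1

theorem mem_trivialPart_iff {x : X} : x ∈ O.trivialPart ↔ O.pointIndex x = 1 := by
  have := (O.chart x).finite_grp
  rw [pointIndex, mul_eq_one, Subgroup.card_eq_one, Finset.prod_eq_one_iff]
  simp [trivialPart]

theorem mem_posPart_iff {x : X} : x ∈ O.posPart ↔ O.pointIndex x ≠ 0 := by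
  have := (O.chart x).finite_grp
  rw [pointIndex, mul_ne_zero_iff, Finset.prod_ne_zero_iff]
  simp [posPart, Nat.card_pos.ne']

theorem map_mem_nhds (p : X) {ε : ℝ} (h0 : 0 < ε) (h1 : ε ≤ 1) : (O.chart p).nbhd ε ∈ 𝓝 p :=
  ((O.chart p).isOpen_nbhd h1).mem_nhds ⟨0, zero_mem_polyball h0, O.chart_zero p⟩

theorem exists_nbhd_subset {p : X} {N : Set X} (hN : N ∈ 𝓝 p) :
    ∃ ε, 0 < ε ∧ ε ≤ 1 ∧ (O.chart p).nbhd ε ⊆ N :=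
  (O.chart p).exists_nbhd_subset (by rwa [O.chart_zero])

theorem mem_D_of_map_mem {p : X} {i : Fin O.r} {z : Fin n → ℂ} (hz : z ∈ polydisc n)
    (h : (O.chart p).map z ∈ O.D i) : p ∈ O.D i := by
  by_contra hp
  exact O.map_notMem_D p i hp z hz h

theorem map_mem_regPart_iff (p : X) {z : Fin n → ℂ} (hz : z ∈ polydisc n) :
    (O.chart p).map z ∈ O.regPart ↔ (O.chart p).stab z = ⊥ ∧
      ∀ i (hi : p ∈ O.D i), z (O.coord p i hi) ≠ 0 := by
  rw [regPart, Set.mem_ofPred_eq, O.chart_grp_eq_bot_iff p hz]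
  refine and_congr_right fun _ => ⟨fun h i hi h0 => h i ((O.map_mem_D_iff p i hi z hz).2 h0),
    fun h i hi => ?_⟩
  have hp := O.mem_D_of_map_mem hz hi
  exact h i hp ((O.map_mem_D_iff p i hp z hz).1 hi)

theorem map_mem_regPart_of_torus (p : X) {z : Fin n → ℂ} (hz : z ∈ polydisc n)
    (ht : z ∈ torus n) : (O.chart p).map z ∈ O.regPart :=
  (O.map_mem_regPart_iff p hz).2 ⟨(O.chart p).stab_eq_bot_of_torus ht, fun _ _ => ht _⟩

theorem map_mem_regPart_mono (p : X) {z w : Fin n → ℂ} (hz : z ∈ polydisc n)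
    (hw : w ∈ polydisc n) (h : ∀ k, z k ≠ 0 → w k ≠ 0) (hreg : (O.chart p).map z ∈ O.regPart) :
    (O.chart p).map w ∈ O.regPart := by
  rw [map_mem_regPart_iff _ _ hz] at hreg
  exact (O.map_mem_regPart_iff p hw).2
    ⟨eq_bot_iff.2 (((O.chart p).stab_mono h).trans hreg.1.le), fun i hi => h _ (hreg.2 i hi)⟩

theorem isOpen_of_nbhd {S : Set X} (h : ∀ x ∈ S, ∀ z ∈ polydisc n, (O.chart x).map z ∈ S) :
    IsOpen S := by
  rw [isOpen_iff_mem_nhds]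
  intro x hx
  filter_upwards [O.map_mem_nhds x one_pos le_rfl]
  rintro _ ⟨z, hz, rfl⟩
  exact h x hx z hz

theorem isOpen_regPart : IsOpen O.regPart :=
  O.isOpen_of_nbhd fun x hx z hz => (O.map_mem_regPart_iff x hz).2
    ⟨(O.chart x).stab_eq_bot_of_grp hx.1 z, fun i hi => absurd hi (hx.2 i)⟩

theorem isOpen_posPart : IsOpen O.posPart :=
  O.isOpen_of_nbhd fun _ hx _ hz i hi => hx i (O.mem_D_of_map_mem hz hi)

theorem isOpen_trivialPart : IsOpen O.trivialPart :=
  O.isOpen_of_nbhd fun x hx z hz => ⟨(O.chart_grp_eq_bot_iff x hz).2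
    ((O.chart x).stab_eq_bot_of_grp hx.1 z), fun i hi => hx.2 i (O.mem_D_of_map_mem hz hi)⟩

theorem dense_regPart : Dense O.regPart := by
  intro x
  rw [mem_closure_iff_nhds]
  intro N hN
  obtain ⟨ε, h0, h1, h⟩ := O.exists_nbhd_subset hN
  obtain ⟨z, hz, hzt⟩ := exists_mem_torus_of_mem_nhds
    ((isOpen_polyball n ε).mem_nhds (zero_mem_polyball h0))
  exact ⟨_, h ⟨z, hz, rfl⟩, O.map_mem_regPart_of_torus x (polyball_subset_polydisc h1 hz) hzt⟩

end NCOrbifold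
end

noncomputable section

/-! ### Inclusions of subsets -/

section Inclusion

variable {X : Type*} [TopologicalSpace X] {U T : Set X}

/-- The inclusion between subsets. -/
abbrev inclMap (h : U ⊆ T) : C(U, T) := ⟨Set.inclusion h, continuous_inclusion h⟩

/-- `U` is a path thick subset of `T`. -/
def IsPathThickIn (U T : Set X) : Prop := IsPathThick (Subtype.val ⁻¹' U : Set T)

theorem IsPathThickIn.exists_map_eq (h : IsPathThickIn U T) (hUT : U ⊆ T) {a b : U}
    (p : PathClass (inclMap hUT a) (inclMap hUT b)) :
    ∃ q : PathClass a b, q.map (inclMap hUT) = p := by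
  obtain ⟨q, hq⟩ := IsPathThick.exists_map_eq h (a := ⟨inclMap hUT a, a.2⟩)
    (b := ⟨inclMap hUT b, b.2⟩) p
  let f : C((Subtype.val ⁻¹' U : Set T), U) := ⟨fun x => ⟨x.1.1, x.2⟩, by fun_prop⟩
  refine ⟨q.map f, ?_⟩
  rw [PathClass.map_map]
  exact hq

theorem PathCocycle.exists_extend_inclusion {Γ : Type*} [Group Γ] (h : IsPathThickIn U T)
    (hUT : U ⊆ T) (F : PathCocycle U Γ)
    (hF : ∀ t ∈ T, ∃ V ∈ 𝓝 t, ∀ (a : U) (p : PathClass a a), p.InSet (Subtype.val ⁻¹' V) →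
      F p = 1) :
    ∃ F' : PathCocycle T Γ, F'.comap (inclMap hUT) = F := by
  let f : C((Subtype.val ⁻¹' U : Set T), U) := ⟨fun x => ⟨x.1.1, x.2⟩, by fun_prop⟩
  obtain ⟨F', hF'⟩ := PathCocycle.exists_extend h (F.comap f) (by
    intro t
    obtain ⟨V, hV, hVF⟩ := hF t t.2
    refine ⟨Subtype.val ⁻¹' V, continuous_subtype_val.continuousAt hV, fun a γ hγ => ?_⟩
    exact hVF _ _ ⟨γ.map f.continuous, hγ, rfl⟩)
  refine ⟨F', ?_⟩
  cases F with | mk F hFt =>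
  rw [PathCocycle.comap, PathCocycle.mk.injEq]
  funext a b p
  let g : C(U, (Subtype.val ⁻¹' U : Set T)) := ⟨fun x => ⟨inclMap hUT x, x.2⟩, by fun_prop⟩
  have := hF' (p.map g)
  rw [PathClass.map_map, PathCocycle.comap_apply, PathClass.map_map] at this
  refine this.trans ?_
  induction p using Path.Homotopic.Quotient.ind with | mk γ => rfl

theorem Path.Homotopic.Quotient.InSet.exists_inclusion {a b : T} {p : PathClass a b} {V : Set X}
    (hp : p.InSet (Subtype.val ⁻¹' V)) :
    ∃ q : PathClass (⟨a, a.2, hp.left⟩ : (T ∩ V : Set X)) ⟨b, b.2, hp.right⟩,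
      q.map (inclMap Set.inter_subset_left) = p := by
  obtain ⟨γ, hγ, rfl⟩ := id hp
  exact ⟨PathClass.mk ((γ.map continuous_subtype_val).toSubtype (U := T ∩ V)
    fun s => ⟨(γ s).2, hγ s⟩), rfl⟩

end Inclusion

theorem PathCocycle.map_cast {T Γ : Type*} [TopologicalSpace T] [Group Γ] (F : PathCocycle T Γ)
    {a b a' b' : T} (p : PathClass a b) (ha : a' = a) (hb : b' = b) : F (p.cast ha hb) = F p := by
  subst ha hb; rw [Path.Homotopic.Quotient.cast_rfl_rfl]

/-! ### Logarithmic coordinates -/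

/-- The universal cover of the points of the polydisc with nonzero coordinates. -/
def logBall (n : ℕ) (ε : ℝ) : Set (Fin n → ℂ) := {w | ∀ k, Real.exp (w k).re < ε}

/-- The exponential map in each coordinate. -/
def expMap {n : ℕ} (w : Fin n → ℂ) : Fin n → ℂ := fun k => Complex.exp (w k)

section LogBall

variable {n : ℕ} {ε : ℝ}

theorem continuous_expMap : Continuous (expMap : (Fin n → ℂ) → Fin n → ℂ) := by
  unfold expMap; fun_prop

theorem expMap_mem_polyball {w : Fin n → ℂ} : expMap w ∈ polyball n ε ↔ w ∈ logBall n ε := by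
  simp [polyball, logBall, expMap, Complex.norm_exp]

theorem expMap_mem_torus (w : Fin n → ℂ) : expMap w ∈ torus n := fun _ => Complex.exp_ne_zero _

theorem exists_expMap_eq {z : Fin n → ℂ} (hz : z ∈ torus n) : ∃ w, expMap w = z :=
  ⟨fun k => Complex.log (z k), funext fun k => Complex.exp_log (hz k)⟩

theorem isOpen_logBall : IsOpen (logBall n ε) := by
  have : logBall n ε = expMap ⁻¹' polyball n ε := Set.ext fun w => expMap_mem_polyball.symm
  rw [this]
  exact (isOpen_polyball n ε).preimage continuous_expMap

theorem convex_logBall : Convex ℝ (logBall n ε) := by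
  have : logBall n ε = Set.univ.pi fun _ => {z : ℂ | Real.exp z.re < ε} := by
    ext; simp [logBall]
  rw [this]
  refine convex_pi fun _ _ => ?_
  have h1 : Convex ℝ {x : ℝ | Real.exp x < ε} := by
    simpa using convexOn_exp.convex_lt ε
  exact h1.linear_preimage Complex.reLm

theorem logBall_mono {δ : ℝ} (h : ε ≤ δ) : logBall n ε ⊆ logBall n δ :=
  fun _ hw k => (hw k).trans_le h

/-- The set is convex, since only the real parts of the coordinates are constrained, hence simply
connected. Identities between classes in logarithmic coordinates therefore need no explicit
homotopies, and `seg` does not depend on a choice. -/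
theorem pathClass_logBall_eq {w w' : logBall n ε} (p q : PathClass w w') : p = q := by
  have : ContractibleSpace (logBall n ε) := convex_logBall.contractibleSpace ⟨w, w.2⟩
  induction p using Path.Homotopic.Quotient.ind with | mk γ =>
  induction q using Path.Homotopic.Quotient.ind with | mk δ =>
  exact Path.Homotopic.Quotient.eq.2 (SimplyConnectedSpace.paths_homotopic γ δ)

/-- The class of the paths between two points. -/
def seg (w w' : logBall n ε) : PathClass w w' :=
  have : ContractibleSpace (logBall n ε) := convex_logBall.contractibleSpace ⟨w, w.2⟩
  PathClass.mk (PathConnectedSpace.somePath w w')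

theorem seg_trans (w w' w'' : logBall n ε) : (seg w w').trans (seg w' w'') = seg w w'' :=
  pathClass_logBall_eq _ _

theorem seg_self (w : logBall n ε) : seg w w = Path.Homotopic.Quotient.refl w :=
  pathClass_logBall_eq _ _

/-- The vectors with purely imaginary coordinates. -/
def imagVectors (n : ℕ) : AddSubgroup (Fin n → ℂ) where
  carrier := {v | ∀ k, (v k).re = 0}
  zero_mem' := fun _ => rfl
  add_mem' ha hb k := by simp [ha k, hb k]
  neg_mem' ha k := by simp [ha k]

theorem add_mem_logBall {v : Fin n → ℂ} (hv : v ∈ imagVectors n) {w : Fin n → ℂ}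
    (hw : w ∈ logBall n ε) : w + v ∈ logBall n ε := by
  intro k
  simpa [hv k] using hw k

/-- Translation by an imaginary vector. -/
def shift (v : imagVectors n) : C(logBall n ε, logBall n ε) :=
  ⟨fun w => ⟨w + v, add_mem_logBall v.2 w.2⟩, by fun_prop⟩

@[simp]
theorem coe_shift (v : imagVectors n) (w : logBall n ε) : (shift v w : Fin n → ℂ) = w + v := rfl

@[simp]
theorem shift_zero (w : logBall n ε) : shift 0 w = w := Subtype.ext (by simp)

theorem shift_add (u v : imagVectors n) (w : logBall n ε) :
    shift (u + v) w = shift v (shift u w) := Subtype.ext (by simp [add_assoc])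

theorem seg_map_shift (v : imagVectors n) (w w' : logBall n ε) :
    (seg w w').map (shift v) = seg (shift v w) (shift v w') := pathClass_logBall_eq _ _

/-- The periods of a cocycle on `logBall` that is invariant under a group of translations. -/
def periodHom {Γ : Type*} [Group Γ] (H : PathCocycle (logBall n ε) Γ)
    (Λ : AddSubgroup (imagVectors n))
    (hinv : ∀ v ∈ Λ, ∀ w w', H (seg (shift v w) (shift v w')) = H (seg w w'))
    (w : logBall n ε) : Multiplicative Λ →* Γ where
  toFun v := H (seg w (shift v.toAdd w))
  map_one' := by
    change H (seg w (shift 0 w)) = 1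
    rw [shift_zero, seg_self, H.map_refl]
  map_mul' u v := by
    change H (seg w (shift (u.toAdd + v.toAdd : imagVectors n) w)) = _
    rw [← seg_trans w (shift v.toAdd w), H.map_trans, shift_add,
      hinv _ v.toAdd.2]

end LogBall
end

/-! ### Thin complements and torus parts in orbifold charts -/

noncomputable section

namespace NCOrbifold

open QuotientChart

variable {n : ℕ} {X : Type*} [TopologicalSpace X] (O : NCOrbifold n X)

theorem isPathConnected_map_image (x : X) {ε : ℝ} (h1 : ε ≤ 1) {S : Set (Fin n → ℂ)}
    (hS : IsPathConnected (polyball n ε ∩ S)) :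
    IsPathConnected ((O.chart x).map '' (polyball n ε ∩ S)) :=
  hS.image' ((O.chart x).continuousOn_map.mono
    (Set.inter_subset_left.trans (polyball_subset_polydisc h1)))

/-- Criterion for the complement of a hypersurface in the smooth part to be path thick. -/
theorem isPathThickIn {T U : Set X} (hT : IsOpen T) (hTs : T ⊆ O.smoothPart) (hU : IsOpen U)
    (h : ∀ x ∈ T, ∃ ε, 0 < ε ∧ ε ≤ 1 ∧ ∃ G : (Fin n → ℂ) → ℂ,
      DifferentiableOn ℂ G (polyball n ε) ∧ (∃ b ∈ polyball n ε, G b ≠ 0) ∧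
      ∀ z ∈ polyball n ε, G z ≠ 0 → (O.chart x).map z ∈ U) : IsPathThickIn U T := by
  rintro ⟨x, hx⟩ N hN
  obtain ⟨ε, h0, h1, G, hG, hGne, hGU⟩ := h x hx
  rw [nhds_subtype_eq_comap, Filter.mem_comap] at hN
  obtain ⟨N', hN', hN'N⟩ := hN
  obtain ⟨δ', hδ0, hδ1, hδ⟩ := O.exists_nbhd_subset (Filter.inter_mem hN' (hT.mem_nhds hx))
  set c := O.chart x
  set δ := min ε δ' with hδdef
  have hpos : 0 < δ := lt_min h0 hδ0
  have hle : δ ≤ 1 := (min_le_left _ _).trans h1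
  have hδε : polyball n δ ⊆ polyball n ε := polyball_mono (min_le_left _ _)
  have hsub : c.nbhd δ ⊆ N' ∩ T := (c.nbhd_mono (min_le_right _ _)).trans hδ
  have hdisc : polyball n δ ⊆ polydisc n := polyball_subset_polydisc hle
  have hinj : Set.InjOn c.map (polyball n δ) := (c.injOn_of_grp (hTs hx)).mono hdisc
  refine ⟨Subtype.val ⁻¹' c.nbhd δ, fun t ht => hN'N (hsub ht).1,
    (c.isOpen_nbhd hle).preimage continuous_subtype_val, ?_, ?_, ?_, ?_⟩
  · exact ⟨0, zero_mem_polyball hpos, O.chart_zero x⟩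
  · refine IsPathConnected.preimage_coe ?_ fun y hy => (hsub hy).2
    have := O.isPathConnected_map_image x hle (S := Set.univ) (by
      rw [Set.inter_univ]
      exact (convex_polyball n δ).isPathConnected ⟨0, zero_mem_polyball hpos⟩)
    rwa [Set.inter_univ] at this
  · rw [← Set.preimage_inter]
    refine IsPathConnected.preimage_coe ?_ fun y hy => (hsub hy.1).2
    have := O.isPathConnected_map_image x hle (S := c.map ⁻¹' U) (by
      refine isPathConnected_of_ne_zero (convex_polyball n δ) (isOpen_polyball n δ)
        (hG.mono hδε) ?_ ?_ fun z hz hGz => hGU z (hδε hz) hGz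
      · obtain ⟨b, hb, -, hGb⟩ := exists_ne_zero_of_mem_nhds (convex_polyball n ε)
          (isOpen_polyball n ε) hG hGne (zero_mem_polyball h0)
          ((isOpen_polyball n δ).mem_nhds (zero_mem_polyball hpos))
        exact ⟨b, hb, hGb⟩
      · exact (c.continuousOn_map.mono hdisc).isOpen_inter_preimage (isOpen_polyball n δ) hU)
    rwa [Set.image_inter_preimage] at this
  · intro a b γ γ' hγ hγ'
    -- The chart at a smooth point is injective, so both paths lift to a convex polydisc, where they
    -- are homotopic.
    have hlift : ∀ γ : Path a b, (∀ s, γ s ∈ Subtype.val ⁻¹' c.nbhd δ) →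
        ∃ (w w' : Fin n → ℂ) (β : Path w w'), (∀ s, β s ∈ polyball n δ) ∧
          ∀ s, c.map (β s) = (γ s : X) := fun γ hγ =>
      exists_path_lift_of_injOn (isOpen_polyball n δ)
        (fun W hW hWo => c.isOpen_image W (hW.trans hdisc) hWo) hinj
        (γ.map continuous_subtype_val) hγ
    obtain ⟨w, w', β, hβ, hβγ⟩ := hlift γ hγ
    obtain ⟨v, v', β', hβ', hβγ'⟩ := hlift γ' hγ'
    have hcont : Continuous fun z : polyball n δ => c.map z :=
      (c.continuousOn_map.mono hdisc).domRestrict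
    let f : C(polyball n δ, T) := ⟨fun z => ⟨c.map z, (hsub ⟨z, z.2, rfl⟩).2⟩, by fun_prop⟩
    have hw : w ∈ polyball n δ := by simpa using hβ 0
    have hw' : w' ∈ polyball n δ := by simpa using hβ 1
    have hv : v ∈ polyball n δ := by simpa using hβ' 0
    have hv' : v' ∈ polyball n δ := by simpa using hβ' 1
    obtain rfl : w = v := hinj hw hv (by
      have e1 := hβγ 0; have e2 := hβγ' 0; simp only [Path.source] at e1 e2; rw [e1, e2])
    obtain rfl : w' = v' := hinj hw' hv' (by
      have e1 := hβγ 1; have e2 := hβγ' 1; simp only [Path.target] at e1 e2; rw [e1, e2])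
    have ha : a = f ⟨w, hw⟩ := Subtype.ext (by
      have e1 := hβγ 0; simp only [Path.source] at e1; exact e1.symm)
    have hb : b = f ⟨w', hw'⟩ := Subtype.ext (by
      have e1 := hβγ 1; simp only [Path.target] at e1; exact e1.symm)
    subst ha hb
    have : ContractibleSpace (polyball n δ) := (convex_polyball n δ).contractibleSpace ⟨w, hw⟩
    have h2 := (SimplyConnectedSpace.paths_homotopic (β.toSubtype hβ) (β'.toSubtype hβ')).map f
    have e1 : (β.toSubtype hβ).map f.continuous = γ :=
      Path.ext (funext fun s => Subtype.ext (hβγ s))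
    have e2 : (β'.toSubtype hβ').map f.continuous = γ' :=
      Path.ext (funext fun s => Subtype.ext (hβγ' s))
    rw [e1, e2] at h2
    exact h2

/-- An invariant holomorphic function defining the union of the coordinate hyperplanes. -/
theorem exists_coordFunction (q : X) : ∃ g : X → ℂ, O.IsHolomorphicOn g ((O.chart q).nbhd 1) ∧
    ∀ z ∈ polydisc n, g ((O.chart q).map z) ≠ 0 ↔ z ∈ torus n := by
  classical
  set c := O.chart q
  have := c.finite_grp
  -- The group multiplies the product of the coordinates by roots of unity of order dividing `N`;
  -- the `N`-th power is therefore invariant and descends to `X`.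
  let N := Nat.card c.grp
  have hN : N ≠ 0 := Nat.card_pos.ne'
  have hinv : ∀ z ∈ polydisc n, ∀ w ∈ polydisc n, c.map z = c.map w →
      (∏ k, z k) ^ N = (∏ k, w k) ^ N := by
    intro z hz w hw h
    obtain ⟨a, ha, rfl⟩ := exists_act_of_map_eq hz hw h
    have h1 : (∏ k, (a k : ℂ)) ^ N = 1 := by
      rw [← Finset.prod_pow]
      refine Finset.prod_eq_one fun k _ => ?_
      have h2 : (⟨a, ha⟩ : c.grp) ^ N = 1 := pow_card_eq_one'
      have := congrArg (fun x : c.grp => ((x.1 k : ℂˣ) : ℂ)) h2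
      simpa using this
    simp only [act]
    rw [Finset.prod_mul_distrib, mul_pow, h1, one_mul]
  let g : X → ℂ := fun x => if h : ∃ z ∈ polydisc n, c.map z = x then (∏ k, h.choose k) ^ N else 0
  have hg : ∀ z ∈ polydisc n, g (c.map z) = (∏ k, z k) ^ N := by
    intro z hz
    have h : ∃ w ∈ polydisc n, c.map w = c.map z := ⟨z, hz, rfl⟩
    change dite _ _ _ = _
    rw [dif_pos h]
    exact hinv _ h.choose_spec.1 _ hz h.choose_spec.2
  refine ⟨g, ?_, fun z hz => by rw [hg z hz, mem_torus_iff_prod, pow_ne_zero_iff hN]⟩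
  rintro p z ⟨hz, w, hw, hwz⟩
  -- Both charts are compared with the chart centred at the common image point; `h' ∘ h.symm` is
  -- then a holomorphic change of coordinates from the chart at `p` to the chart at `q`.
  obtain ⟨h, h0s, h0, hsrc, htgt, -, hsymm, hcomp⟩ := O.compatible p z hz
  obtain ⟨h', h0s', h0', hsrc', htgt', hd', -, hcomp'⟩ := O.compatible q w hw
  change w ∈ polydisc n at hw
  have hwz' : (O.chart q).map w = (O.chart p).map z := hwz
  rw [hwz'] at hcomp'
  have hzt : z ∈ h.target := h0 ▸ h.map_source h0s
  have hs0 : h.symm z = 0 := by rw [← h0, h.left_inv h0s]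
  have hev : ∀ᶠ u in 𝓝 z, u ∈ h.target ∧ h.symm u ∈ h'.source :=
    Filter.Eventually.and (h.open_target.mem_nhds hzt)
      (h.symm.continuousAt hzt (h'.open_source.mem_nhds (by rw [hs0]; exact h0s')))
  refine DifferentiableAt.differentiableWithinAt ?_
  have heq : (fun u => g ((O.chart p).map u)) =ᶠ[𝓝 z] fun u => (∏ k, h' (h.symm u) k) ^ N := by
    filter_upwards [hev] with u hu
    have e1 : (O.chart p).map u = c.map (h' (h.symm u)) := by
      rw [hcomp' _ hu.2, ← hcomp _ (h.map_target hu.1), h.right_inv hu.1]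
    rw [e1, hg _ (htgt' (h'.map_source hu.2))]
  refine DifferentiableAt.congr_of_eventuallyEq ?_ heq
  have d1 : DifferentiableAt ℂ h.symm z := hsymm.differentiableAt (h.open_target.mem_nhds hzt)
  have d2 : DifferentiableAt ℂ h' (h.symm z) :=
    hd'.differentiableAt (h'.open_source.mem_nhds (by rw [hs0]; exact h0s'))
  have d3 : DifferentiableAt ℂ (fun u => h' (h.symm u)) z := d2.comp z d1
  exact ((differentiable_prod_coord n).differentiableAt.comp z d3).pow N

/-- The image in `X` of the points with nonzero coordinates. -/
def torusNbhd (q : X) (ε : ℝ) : Set X := (fun w => (O.chart q).map (expMap w)) '' logBall n ε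

theorem torusNbhd_eq (q : X) (ε : ℝ) :
    O.torusNbhd q ε = (O.chart q).map '' (polyball n ε ∩ torus n) := by
  ext x
  constructor
  · rintro ⟨w, hw, rfl⟩
    exact ⟨_, ⟨expMap_mem_polyball.2 hw, expMap_mem_torus w⟩, rfl⟩
  · rintro ⟨z, ⟨hz, hzt⟩, rfl⟩
    obtain ⟨w, rfl⟩ := exists_expMap_eq hzt
    exact ⟨w, expMap_mem_polyball.1 hz, rfl⟩

theorem isOpen_torus (n : ℕ) : IsOpen (torus n) := by
  have : torus n = {z | ∏ k, z k ≠ 0} := Set.ext fun z => mem_torus_iff_prod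
  rw [this]
  exact isOpen_ne_fun (differentiable_prod_coord n).continuous continuous_const

theorem isOpen_torusNbhd (q : X) {ε : ℝ} (h1 : ε ≤ 1) : IsOpen (O.torusNbhd q ε) := by
  rw [torusNbhd_eq]
  exact (O.chart q).isOpen_image _ (Set.inter_subset_left.trans (polyball_subset_polydisc h1))
    ((isOpen_polyball n ε).inter (isOpen_torus n))

theorem torusNbhd_subset_nbhd (q : X) (ε : ℝ) : O.torusNbhd q ε ⊆ (O.chart q).nbhd ε := by
  rw [torusNbhd_eq]
  exact Set.image_mono Set.inter_subset_left

theorem torusNbhd_subset_regPart (q : X) {ε : ℝ} (h1 : ε ≤ 1) :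
    O.torusNbhd q ε ⊆ O.regPart := by
  rw [torusNbhd_eq]
  rintro _ ⟨z, ⟨hz, hzt⟩, rfl⟩
  exact O.map_mem_regPart_of_torus q (polyball_subset_polydisc h1 hz) hzt

/-- A holomorphic function that does not vanish on a nonempty open subset of the torus part. -/
theorem mem_torusNbhd_of_ne_zero {q : X} {g : X → ℂ}
    (hg : ∀ z ∈ polydisc n, g ((O.chart q).map z) ≠ 0 ↔ z ∈ torus n) {ε : ℝ} (h1 : ε ≤ 1) {x : X}
    (hx : x ∈ (O.chart q).nbhd ε) : g x ≠ 0 ↔ x ∈ O.torusNbhd q ε := by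
  obtain ⟨z, hz, rfl⟩ := hx
  rw [hg z (polyball_subset_polydisc h1 hz), torusNbhd_eq]
  constructor
  · exact fun h => ⟨z, ⟨hz, h⟩, rfl⟩
  · rintro ⟨w, ⟨hw, hwt⟩, hwz⟩
    rw [← hg z (polyball_subset_polydisc h1 hz), ← hwz,
      hg w (polyball_subset_polydisc h1 hw)]
    exact hwt

theorem exists_mem_torusNbhd {q : X} {ε : ℝ} (h1 : ε ≤ 1) {N : Set X} (hN : IsOpen N)
    (hne : (N ∩ (O.chart q).nbhd ε).Nonempty) : ∃ x ∈ N, x ∈ O.torusNbhd q ε := by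
  obtain ⟨_, hx, z, hz, rfl⟩ := hne
  have hzd := polyball_subset_polydisc h1 hz
  obtain ⟨w, hw, hwt⟩ := exists_mem_torus_of_mem_nhds (Filter.inter_mem
    ((O.chart q).continuousAt_map hzd (hN.mem_nhds hx)) ((isOpen_polyball n ε).mem_nhds hz))
  exact ⟨_, hw.1, by rw [torusNbhd_eq]; exact ⟨w, ⟨hw.2, hwt⟩, rfl⟩⟩

/-- In the chart at a smooth point the torus part of the chart at `q` is where the function of
`exists_coordFunction` does not vanish. That function is holomorphic there and not identically zero.
-/
theorem isPathThickIn_torusNbhd {R : Set X} (hR : IsOpen R) (hRs : R ⊆ O.smoothPart)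
    (q : X) {ε : ℝ} (h1 : ε ≤ 1) :
    IsPathThickIn (O.torusNbhd q ε) (R ∩ (O.chart q).nbhd ε) := by
  have hT : IsOpen (R ∩ (O.chart q).nbhd ε) := hR.inter ((O.chart q).isOpen_nbhd h1)
  refine O.isPathThickIn hT (Set.inter_subset_left.trans hRs) (O.isOpen_torusNbhd q h1) ?_
  intro x hx
  obtain ⟨g, hg, hgt⟩ := O.exists_coordFunction q
  obtain ⟨δ, hδ0, hδ1, hδ⟩ := O.exists_nbhd_subset (hT.mem_nhds hx)
  refine ⟨δ, hδ0, hδ1, fun z => g ((O.chart x).map z), (hg x).mono fun z hz => ?_, ?_, ?_⟩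
  · exact ⟨polyball_subset_polydisc hδ1 hz, (O.chart q).nbhd_mono h1 (hδ ⟨z, hz, rfl⟩).2⟩
  · obtain ⟨y, ⟨z, hz, rfl⟩, hyt⟩ := O.exists_mem_torusNbhd h1 ((O.chart x).isOpen_nbhd hδ1)
      ⟨x, ⟨0, zero_mem_polyball hδ0, O.chart_zero x⟩, hx.2⟩
    exact ⟨z, hz, (O.mem_torusNbhd_of_ne_zero hgt h1 (hδ ⟨z, hz, rfl⟩).2).2 hyt⟩
  · intro z hz hgz
    exact (O.mem_torusNbhd_of_ne_zero hgt h1 (hδ ⟨z, hz, rfl⟩).2).1 hgz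

/-- The regular part is a path thick subset of the smooth open sets containing it. -/
theorem isPathThickIn_regPart {R : Set X} (hR : IsOpen R) (hRs : R ⊆ O.smoothPart) :
    IsPathThickIn O.regPart R := by
  refine O.isPathThickIn hR hRs O.isOpen_regPart fun x hx => ?_
  refine ⟨1, one_pos, le_rfl, _, (differentiable_prod_coord n).differentiableOn, ?_, ?_⟩
  · exact ⟨fun _ => 1 / 2, fun k => by norm_num, by simp⟩
  · exact fun z hz h => O.map_mem_regPart_of_torus x hz (mem_torus_iff_prod.2 h)

/-- In each chart the regular part contains the complement of the coordinate hyperplanes, so it is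
dense and is not locally disconnected. -/
theorem isPathConnected_regPart [ConnectedSpace X] : IsPathConnected O.regPart := by
  refine isPathConnected_of_locally O.dense_regPart fun x => ⟨_, O.map_mem_nhds x one_pos le_rfl, ?_⟩
  have := O.isPathConnected_map_image x le_rfl (S := (O.chart x).map ⁻¹' O.regPart) (by
    refine isPathConnected_of_ne_zero (convex_polyball n 1) (isOpen_polyball n 1)
      (differentiable_prod_coord n).differentiableOn ?_ ?_ fun z hz hGz => ?_
    · exact ⟨fun _ => 1 / 2, fun k => by norm_num, by simp⟩
    · exact (O.chart x).continuousOn_map.isOpen_inter_preimage (isOpen_polyball n 1)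
        O.isOpen_regPart
    · exact O.map_mem_regPart_of_torus x hz (mem_torus_iff_prod.2 hGz))
  rwa [Set.image_inter_preimage] at this

end NCOrbifold
end

/-! ### The universal cover of the torus part of a chart -/

noncomputable section

theorem PathClass.cast_trans_cast {T : Type*} [TopologicalSpace T] {a b c a' b' c' : T}
    (p : PathClass a b) (q : PathClass b c) (ha : a' = a) (hb : b' = b) (hc : c' = c) :
    (p.cast ha hb).trans (q.cast hb hc) = (p.trans q).cast ha hc := by
  subst ha hb hc
  simp only [Path.Homotopic.Quotient.cast_rfl_rfl]

theorem isOpenMap_expMap {n : ℕ} : IsOpenMap (expMap : (Fin n → ℂ) → Fin n → ℂ) :=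
  IsOpenMap.piMap (f := fun _ : Fin n => Complex.exp) (fun _ => Complex.isOpenMap_exp)
    (by simp [Filter.cofinite_eq_bot])

theorem seg_eq_mk {n : ℕ} {ε : ℝ} {w w' : logBall n ε} (γ : Path w w') :
    seg w w' = PathClass.mk γ := pathClass_logBall_eq _ _

theorem seg_inSet {n : ℕ} {ε δ : ℝ} {w w' : logBall n δ} (hw : (w : Fin n → ℂ) ∈ logBall n ε)
    (hw' : (w' : Fin n → ℂ) ∈ logBall n ε) : (seg w w').InSet (Subtype.val ⁻¹' logBall n ε) := by
  have hc : Convex ℝ (logBall n δ ∩ logBall n ε) := convex_logBall.inter convex_logBall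
  have h1 : IsPathConnected (logBall n δ ∩ logBall n ε) := hc.isPathConnected ⟨w, w.2, hw⟩
  obtain ⟨γ, hγ⟩ := h1.exists_path ⟨w.2, hw⟩ ⟨w'.2, hw'⟩
  exact ⟨γ.toSubtype fun s => (hγ s).1, fun s => (hγ s).2, pathClass_logBall_eq _ _⟩

namespace NCOrbifold

open QuotientChart

variable {n : ℕ} {X : Type*} [TopologicalSpace X] (O : NCOrbifold n X)

/-- The lattice of deck transformations of the universal cover of the torus part. -/
def lattice (p : X) : AddSubgroup (imagVectors n) where
  carrier := {v | ∃ a ∈ (O.chart p).grp, ∀ k, Complex.exp ((v : Fin n → ℂ) k) = a k}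
  zero_mem' := ⟨1, Subgroup.one_mem _, by simp⟩
  add_mem' := by
    rintro u v ⟨a, ha, hu⟩ ⟨b, hb, hv⟩
    exact ⟨a * b, mul_mem ha hb, fun k => by simp [Complex.exp_add, hu k, hv k]⟩
  neg_mem' := by
    rintro u ⟨a, ha, hu⟩
    exact ⟨a⁻¹, inv_mem ha, fun k => by simp [Complex.exp_neg, hu k]⟩

/-- The universal cover of the torus part of a chart. -/
def theta (p : X) : C(logBall n 1, O.regPart) where
  toFun w := ⟨(O.chart p).map (expMap w), O.map_mem_regPart_of_torus p
    (expMap_mem_polyball (ε := 1).2 w.2)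
    (expMap_mem_torus (w : Fin n → ℂ))⟩
  continuous_toFun := by
    refine Continuous.subtype_mk ?_ _
    exact (O.chart p).continuousOn_map.comp_continuous
      (continuous_expMap.comp continuous_subtype_val) fun w => expMap_mem_polyball (ε := 1).2 w.2

theorem coe_theta (p : X) (w : logBall n 1) :
    (O.theta p w : X) = (O.chart p).map (expMap w) := rfl

variable {O}

theorem theta_mem_torusNbhd {p : X} {w : logBall n 1} {ε : ℝ}
    (hw : (w : Fin n → ℂ) ∈ logBall n ε) : (O.theta p w : X) ∈ O.torusNbhd p ε := ⟨w, hw, rfl⟩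

theorem theta_mem_nbhd {p : X} {w : logBall n 1} {ε : ℝ}
    (hw : (w : Fin n → ℂ) ∈ logBall n ε) : (O.theta p w : X) ∈ (O.chart p).nbhd ε :=
  O.torusNbhd_subset_nbhd p ε (theta_mem_torusNbhd hw)

theorem exists_theta_eq {p x : X} {ε : ℝ} (h1 : ε ≤ 1) (hx : x ∈ O.torusNbhd p ε) :
    ∃ w : logBall n 1, (w : Fin n → ℂ) ∈ logBall n ε ∧ (O.theta p w : X) = x := by
  obtain ⟨w, hw, rfl⟩ := hx
  exact ⟨⟨w, logBall_mono h1 hw⟩, hw, rfl⟩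

theorem theta_shift {p : X} {v : imagVectors n} (hv : v ∈ O.lattice p) (w : logBall n 1) :
    O.theta p (shift v w) = O.theta p w := by
  obtain ⟨a, ha, hva⟩ := hv
  refine Subtype.ext ?_
  rw [coe_theta, coe_theta, ← map_act ha (expMap_mem_polyball (ε := 1).2 w.2)]
  congr 1
  funext k
  simp [expMap, act, Complex.exp_add, hva k, mul_comm]

theorem exists_shift_of_theta_eq {p : X} {w w' : logBall n 1} (h : O.theta p w = O.theta p w') :
    ∃ v ∈ O.lattice p, w' = shift v w := by
  obtain ⟨a, ha, hab⟩ := exists_act_of_map_eq (expMap_mem_polyball (ε := 1).2 w.2)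
    (expMap_mem_polyball (ε := 1).2 w'.2) (congrArg Subtype.val h)
  have h1 : ∀ k, Complex.exp ((w' : Fin n → ℂ) k - (w : Fin n → ℂ) k) = a k := by
    intro k
    have := congrFun hab k
    simp only [expMap, act] at this
    rw [Complex.exp_sub, this, mul_div_cancel_right₀ _ (Complex.exp_ne_zero _)]
  refine ⟨⟨fun k => (w' : Fin n → ℂ) k - (w : Fin n → ℂ) k, fun k => ?_⟩, ⟨a, ha, h1⟩,
    Subtype.ext (funext fun k => by simp)⟩
  have h2 := congrArg norm (h1 k)
  rwa [(O.chart p).norm_eq_one ha, Complex.norm_exp, Real.exp_eq_one_iff] at h2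

theorem theta_eq_iff {p : X} {w w' : logBall n 1} :
    O.theta p w = O.theta p w' ↔ ∃ v ∈ O.lattice p, w' = shift v w := by
  refine ⟨exists_shift_of_theta_eq, ?_⟩
  rintro ⟨v, hv, rfl⟩
  exact (theta_shift hv w).symm

theorem isOpenMap_theta (p : X) (W : Set (logBall n 1)) (hW : IsOpen W) :
    IsOpen ((fun w => (O.theta p w : X)) '' W) := by
  have h1 : IsOpen (expMap '' (Subtype.val '' W)) :=
    isOpenMap_expMap _ (isOpen_logBall.isOpenMap_subtype_val _ hW)
  have h2 := (O.chart p).isOpen_image _ (by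
    rintro _ ⟨_, ⟨w, -, rfl⟩, rfl⟩
    exact expMap_mem_polyball (ε := 1).2 w.2) h1
  rwa [Set.image_image, Set.image_image] at h2

/-- With `N` the order of the group, the coordinates of a lattice vector are integral multiples of
2πi/N. Points in a ball of radius π/N differ by less than 2π/N, so no nonzero lattice vector relates
two of them. -/
theorem exists_injOn_theta (p : X) (w : logBall n 1) :
    ∃ B : Set (logBall n 1), IsOpen B ∧ w ∈ B ∧ Set.InjOn (O.theta p) B := by
  have := (O.chart p).finite_grp
  set N := Nat.card (O.chart p).grp
  have hN : 0 < N := Nat.card_pos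
  refine ⟨Metric.ball w (Real.pi / N), Metric.isOpen_ball, Metric.mem_ball_self (by positivity), ?_⟩
  intro u hu u' hu' h
  obtain ⟨v, ⟨a, ha, hva⟩, rfl⟩ := theta_eq_iff.1 h
  have hd : dist (shift v u) u < 2 * Real.pi / N := by
    calc dist (shift v u) u ≤ dist (shift v u) w + dist u w := dist_triangle_right _ _ _
      _ < Real.pi / N + Real.pi / N := add_lt_add hu' hu
      _ = _ := by ring
  rw [Subtype.dist_eq, dist_eq_norm, coe_shift, add_sub_cancel_left] at hd
  have hv0 : v = 0 := by
    ext k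
    have h1 : (a k : ℂ) ^ N = 1 := by
      have h2 : (⟨a, ha⟩ : (O.chart p).grp) ^ N = 1 := pow_card_eq_one'
      have := congrArg (fun x : (O.chart p).grp => ((x.1 k : ℂˣ) : ℂ)) h2
      simpa using this
    rw [← hva k, ← Complex.exp_nat_mul, Complex.exp_eq_one_iff] at h1
    obtain ⟨m, hm⟩ := h1
    have h3 : ‖(v : Fin n → ℂ) k‖ < 2 * Real.pi / N := (norm_le_pi_norm _ k).trans_lt hd
    have h4 : (N : ℝ) * ‖(v : Fin n → ℂ) k‖ = |(m : ℝ)| * (2 * Real.pi) := by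
      have := congrArg norm hm
      simpa [abs_of_pos Real.pi_pos] using this
    rw [lt_div_iff₀ (by positivity), mul_comm, h4] at h3
    have h5 : |(m : ℝ)| < 1 := by nlinarith [Real.pi_pos]
    have h6 : m = 0 := by
      rw [← Int.abs_lt_one_iff]; exact_mod_cast h5
    rw [h6, abs_of_nonneg (by simp)] at h4
    simpa [hN.ne'] using h4
  rw [hv0, shift_zero]

/-- A path in the torus part lifts to the universal cover of the torus part. -/
theorem exists_seg_of_torusNbhd {p : X} {ε : ℝ} (h1 : ε ≤ 1) {a b : O.torusNbhd p ε}
    (q : PathClass a b) : ∀ (w : logBall n 1),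
    ∀ ha : O.theta p w = inclMap (O.torusNbhd_subset_regPart p h1) a,
    ∃ (w' : logBall n 1) (hb : O.theta p w' = inclMap (O.torusNbhd_subset_regPart p h1) b),
      q.map (inclMap (O.torusNbhd_subset_regPart p h1)) =
        ((seg w w').map (O.theta p)).cast ha.symm hb.symm := by
  set i := inclMap (O.torusNbhd_subset_regPart p h1)
  refine PathClass.induction_local (fun a b q => ∀ (w : logBall n 1) (ha : O.theta p w = i a),
    ∃ (w' : logBall n 1) (hb : O.theta p w' = i b),
      q.map i = ((seg w w').map (O.theta p)).cast ha.symm hb.symm) ?_ ?_ q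
  · intro a b c q q' hq hq' w ha
    obtain ⟨w', hb, h2⟩ := hq w ha
    obtain ⟨w'', hc, h3⟩ := hq' w' hb
    refine ⟨w'', hc, ?_⟩
    rw [PathClass.map_trans, h2, h3, ← seg_trans w w' w'', PathClass.map_trans]
    exact PathClass.cast_trans_cast _ _ _ _ _
  · intro t
    obtain ⟨w₀, hw₀, hw₀t⟩ := exists_theta_eq h1 t.2
    obtain ⟨B, hBo, hwB, hB⟩ := exists_injOn_theta (O := O) p w₀
    refine ⟨Subtype.val ⁻¹' ((fun w => (O.theta p w : X)) '' B),
      ((isOpenMap_theta p B hBo).preimage continuous_subtype_val).mem_nhds ⟨w₀, hwB, hw₀t⟩, ?_⟩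
    intro a b γ hγ w ha
    obtain ⟨u, u', δ, hδ, hδγ⟩ := exists_path_lift_of_injOn (f := fun w => (O.theta p w : X)) hBo
      (fun W _ hW => isOpenMap_theta p W hW) (fun x hx y hy h => hB hx hy (Subtype.ext h))
      (γ.map continuous_subtype_val) hγ
    have hu : O.theta p u = i a := Subtype.ext (by
      have := hδγ 0; simp only [Path.source] at this; exact this)
    have hu' : O.theta p u' = i b := Subtype.ext (by
      have := hδγ 1; simp only [Path.target] at this; exact this)
    -- The local lift starts at some point over the given one; a lattice translation makes it start
    -- at `w`.
    obtain ⟨v, hv, rfl⟩ := theta_eq_iff.1 (hu.trans ha.symm)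
    refine ⟨shift v u', (theta_shift hv u').trans hu', ?_⟩
    rw [seg_eq_mk (δ.map (shift v).continuous)]
    refine congrArg PathClass.mk (Path.ext (funext fun s => Subtype.ext ?_))
    exact ((congrArg Subtype.val (theta_shift hv (δ s))).trans (hδγ s)).symm

variable (O) in
/-- The universal cover of the torus part, as a map to a set containing the regular part. -/
def thetaIn {R : Set X} (hR : O.regPart ⊆ R) (p : X) : C(logBall n 1, R) :=
  (inclMap hR).comp (O.theta p)

theorem thetaIn_shift {R : Set X} (hR : O.regPart ⊆ R) {p : X} {v : imagVectors n}
    (hv : v ∈ O.lattice p) (w : logBall n 1) : O.thetaIn hR p (shift v w) = O.thetaIn hR p w :=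
  congrArg (inclMap hR) (theta_shift hv w)

/-- A path in a chart, with ends in the torus part, comes from the universal cover. -/
theorem exists_seg_of_inSet {R : Set X} (hRo : IsOpen R) (hR : O.regPart ⊆ R)
    (hRs : R ⊆ O.smoothPart) {p : X} {ε : ℝ} (h1 : ε ≤ 1) {b : R} {w : logBall n 1}
    (hw : (w : Fin n → ℂ) ∈ logBall n ε) (hb : (b : X) ∈ O.torusNbhd p ε)
    (q : PathClass (O.thetaIn hR p w) b) (hq : q.InSet (Subtype.val ⁻¹' (O.chart p).nbhd ε)) :
    ∃ (w' : logBall n 1) (h : b = O.thetaIn hR p w'),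
      q = ((seg w w').map (O.thetaIn hR p)).cast rfl h := by
  obtain ⟨q₁, hq₁⟩ := hq.exists_inclusion
  have hsub : O.torusNbhd p ε ⊆ R ∩ (O.chart p).nbhd ε := Set.subset_inter
    ((O.torusNbhd_subset_regPart p h1).trans hR) (O.torusNbhd_subset_nbhd p ε)
  -- Thickness of the torus part pushes the path off the coordinate hyperplanes; after that it can
  -- be lifted.
  obtain ⟨q₂, rfl⟩ := (O.isPathThickIn_torusNbhd hRo hRs p h1).exists_map_eq hsub
    (a := ⟨_, theta_mem_torusNbhd hw⟩) (b := ⟨b, hb⟩) q₁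
  rw [← hq₁]
  obtain ⟨w', h2, h3⟩ := exists_seg_of_torusNbhd h1 q₂ w rfl
  have h4 : b = O.thetaIn hR p w' := Subtype.ext (congrArg Subtype.val h2).symm
  refine ⟨w', h4, ?_⟩
  subst h4
  have h5 := congrArg (Path.Homotopic.Quotient.map · (inclMap hR)) h3
  simp only [PathClass.map_map] at h5
  rw [Path.Homotopic.Quotient.cast_rfl_rfl]
  refine (PathClass.map_map _ _ _).trans (h5.trans ?_)
  generalize seg w w' = s
  induction s using Path.Homotopic.Quotient.ind with | mk γ => rfl

/-- Points of a chart can be joined to the torus part. -/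
theorem exists_path_thetaIn {R : Set X} (hRo : IsOpen R) (hR : O.regPart ⊆ R) {p : X} {ε : ℝ}
    (h1 : ε ≤ 1) (a : R) (ha : (a : X) ∈ (O.chart p).nbhd ε) :
    ∃ (w : logBall n 1) (σ : PathClass a (O.thetaIn hR p w)), (w : Fin n → ℂ) ∈ logBall n ε ∧
      σ.InSet (Subtype.val ⁻¹' (O.chart p).nbhd ε) := by
  obtain ⟨δ, hδ0, hδ1, hδ⟩ := O.exists_nbhd_subset
    (((hRo.inter ((O.chart p).isOpen_nbhd h1)).mem_nhds ⟨a.2, ha⟩))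
  have haδ : (a : X) ∈ (O.chart (a : X)).nbhd δ := mem_of_mem_nhds (O.map_mem_nhds _ hδ0 hδ1)
  obtain ⟨x, hx, hxt⟩ := O.exists_mem_torusNbhd h1 ((O.chart (a : X)).isOpen_nbhd hδ1)
    ⟨a, haδ, ha⟩
  obtain ⟨w, hw, rfl⟩ := exists_theta_eq h1 hxt
  have h2 : IsPathConnected ((O.chart (a : X)).nbhd δ) := by
    have := O.isPathConnected_map_image a hδ1 (S := Set.univ) (by
      rw [Set.inter_univ]
      exact (convex_polyball n δ).isPathConnected ⟨0, zero_mem_polyball hδ0⟩)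
    rwa [Set.inter_univ] at this
  obtain ⟨γ, hγ⟩ := h2.exists_path haδ hx
  exact ⟨w, PathClass.mk (γ.toSubtype (U := R) fun s => (hδ (hγ s)).1), hw, _,
    fun s => (hδ (hγ s)).2, rfl⟩

/-- Loops in a chart are conjugate to loops given by lattice translations. -/
theorem exists_loop_eq {R : Set X} (hRo : IsOpen R) (hR : O.regPart ⊆ R)
    (hRs : R ⊆ O.smoothPart) {p : X} {ε : ℝ} (h1 : ε ≤ 1) {a : R} (q : PathClass a a)
    (hq : q.InSet (Subtype.val ⁻¹' (O.chart p).nbhd ε)) :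
    ∃ (w : logBall n 1) (σ : PathClass a (O.thetaIn hR p w)) (v : imagVectors n)
      (hv : v ∈ O.lattice p), (w : Fin n → ℂ) ∈ logBall n ε ∧
      σ.InSet (Subtype.val ⁻¹' (O.chart p).nbhd ε) ∧
      q = σ.trans ((((seg w (shift v w)).map (O.thetaIn hR p)).cast rfl
        (thetaIn_shift hR hv w).symm).trans σ.symm) := by
  obtain ⟨w, σ, hw, hσ⟩ := exists_path_thetaIn hRo hR h1 a hq.left
  obtain ⟨w', h2, h3⟩ := exists_seg_of_inSet hRo hR hRs h1 hw
    (theta_mem_torusNbhd hw) (σ.symm.trans (q.trans σ)) (hσ.symm.trans (hq.trans hσ))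
  obtain ⟨v, hv, rfl⟩ := theta_eq_iff.1 (Subtype.ext (congrArg (fun x : R => (x : X)) h2) :
    O.theta p w = O.theta p w')
  refine ⟨w, σ, v, hv, hw, hσ, ?_⟩
  rw [← h3]
  simp

end NCOrbifold
end

/-! ### The orbifold index as a lattice index -/

noncomputable section

namespace NCOrbifold

open QuotientChart

variable {n : ℕ} {X : Type*} [TopologicalSpace X] (O : NCOrbifold n X)

open scoped Classical in
/-- The index attached to a coordinate of a chart: the index of the component on which the
coordinate vanishes if there is one, and `1` otherwise. -/
def coordIndex (q : X) (k : Fin n) : ℕ := ∏ i with ∃ hi : q ∈ O.D i, O.coord q i hi = k, O.index i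

variable {O} in
theorem coordIndex_coord (q : X) (i : Fin O.r) (hi : q ∈ O.D i) :
    O.coordIndex q (O.coord q i hi) = O.index i := by
  classical
  rw [coordIndex, Finset.prod_eq_single i]
  · intro j hj hji
    obtain ⟨hj', h⟩ := (Finset.mem_filter.1 hj).2
    exact absurd (O.coord_injective q j i hj' hi h) hji
  · intro h
    exact absurd (Finset.mem_filter.2 ⟨Finset.mem_univ _, hi, rfl⟩) h

theorem pointIndex_eq (q : X) :
    O.pointIndex q = Nat.card (O.chart q).grp * ∏ k, O.coordIndex q k := by
  classical
  unfold coordIndex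
  rw [pointIndex, Finset.prod_comm' (t' := Finset.univ.filter fun i => q ∈ O.D i)
    (s' := fun i => Finset.univ.filter fun k => ∃ hi : q ∈ O.D i, O.coord q i hi = k)
    (by intro k i; simp only [Finset.mem_filter, Finset.mem_univ, true_and]; constructor
        · rintro ⟨hi, h⟩; exact ⟨⟨hi, h⟩, hi⟩
        · exact fun h => h.1)]
  congr 1
  refine Finset.prod_congr (by congr) fun i hi => ?_
  have hi' : q ∈ O.D i := (Finset.mem_filter.1 hi).2
  rw [Finset.prod_eq_single (O.coord q i hi')]
  · rintro k hk hne
    obtain ⟨-, hj, h⟩ := Finset.mem_filter.1 hk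
    exact absurd h.symm hne
  · intro h
    exact absurd (Finset.mem_filter.2 ⟨Finset.mem_univ _, hi', rfl⟩) h

/-- The lattice generated by the powers of the meridians prescribed by the indices. -/
def merLattice (q : X) : AddSubgroup (imagVectors n) where
  carrier := {v | ∀ k, ∃ a : ℤ, (v : Fin n → ℂ) k =
    a * ((O.coordIndex q k : ℂ) * (2 * Real.pi * Complex.I))}
  zero_mem' := fun k => ⟨0, by simp⟩
  add_mem' := by
    intro u v hu hv k
    obtain ⟨a, ha⟩ := hu k
    obtain ⟨b, hb⟩ := hv k
    exact ⟨a + b, by simp [ha, hb, add_mul]⟩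
  neg_mem' := by
    intro u hu k
    obtain ⟨a, ha⟩ := hu k
    exact ⟨-a, by simp [ha]⟩

theorem merLattice_le (q : X) : O.merLattice q ≤ O.lattice q := by
  intro v hv
  refine ⟨1, Subgroup.one_mem _, fun k => ?_⟩
  obtain ⟨a, ha⟩ := hv k
  rw [ha]
  simp only [Pi.one_apply, Units.val_one]
  exact Complex.exp_eq_one_iff.2 ⟨a * O.coordIndex q k, by push_cast; ring⟩

/-- Coordinatewise powers. -/
def powHom {n : ℕ} (m : Fin n → ℕ) : (Fin n → ℂˣ) →* (Fin n → ℂˣ) where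
  toFun b k := b k ^ m k
  map_one' := by ext; simp
  map_mul' a b := by ext; simp [mul_pow]

theorem card_ker_powHom {n : ℕ} {m : Fin n → ℕ} (hm : ∀ k, m k ≠ 0) :
    Nat.card (powHom m).ker = ∏ k, m k := by
  have e : (powHom m).ker ≃ ∀ k, rootsOfUnity (m k) ℂ :=
    { toFun := fun b k => ⟨b.1 k, congrFun b.2 k⟩
      invFun := fun b => ⟨fun k => (b k).1, funext fun k => (b k).2⟩
      left_inv := fun b => rfl
      right_inv := fun b => rfl }
  rw [Nat.card_congr e, Nat.card_pi]
  refine Finset.prod_congr rfl fun k _ => ?_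
  have : NeZero (m k) := ⟨hm k⟩
  exact Complex.card_rootsOfUnity (m k)

theorem powHom_surjective {n : ℕ} {m : Fin n → ℕ} (hm : ∀ k, m k ≠ 0) :
    Function.Surjective (powHom m) := by
  intro a
  have : ∀ k, ∃ b : ℂˣ, b ^ m k = a k := by
    intro k
    obtain ⟨b, hb⟩ := IsAlgClosed.exists_pow_nat_eq (a k : ℂ) (Nat.pos_of_ne_zero (hm k))
    have hb0 : b ≠ 0 := by
      rintro rfl
      rw [zero_pow (hm k)] at hb
      exact (a k).ne_zero hb.symm
    exact ⟨Units.mk0 b hb0, Units.ext (by simpa using hb)⟩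
  choose b hb using this
  exact ⟨b, funext hb⟩

theorem card_comap_powHom {n : ℕ} {m : Fin n → ℕ} (hm : ∀ k, m k ≠ 0)
    (A : Subgroup (Fin n → ℂˣ)) :
    Nat.card (A.comap (powHom m)) = Nat.card A * ∏ k, m k := by
  set f := powHom m
  have h1 : Nat.card (f.ker.subgroupOf (A.comap f)) = Nat.card f.ker :=
    Nat.card_congr (Subgroup.subgroupOfEquivOfLe (Subgroup.ker_le_comap f A)).toEquiv
  have h2 : (f.ker.subgroupOf (A.comap f)).index = Nat.card A := by
    change f.ker.relIndex (A.comap f) = _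
    rw [Subgroup.relIndex_ker, Subgroup.map_comap_eq_self_of_surjective (powHom_surjective hm)]
  rw [← Subgroup.card_mul_index (f.ker.subgroupOf (A.comap f)), h1, h2, card_ker_powHom hm,
    mul_comm]

/-- Divide the coordinates by the indices `m k` and exponentiate. The kernel of this map `ψ` is
`merLattice`, and the image of the full lattice is the preimage of the chart group under the
coordinatewise powers. That preimage has order |A| ∏ m k, since the powers are surjective with
kernel a product of groups of roots of unity. -/
theorem relIndex_merLattice {q : X} (hq : q ∈ O.posPart) :
    (O.merLattice q).relIndex (O.lattice q) = O.pointIndex q := by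
  set m := O.coordIndex q
  have hm : ∀ k, m k ≠ 0 := by
    have := O.mem_posPart_iff.1 hq
    rw [pointIndex_eq, mul_ne_zero_iff, Finset.prod_ne_zero_iff] at this
    exact fun k => this.2 k (Finset.mem_univ k)
  let ψ : imagVectors n →+ Additive (Fin n → ℂˣ) := AddMonoidHom.mk'
    (fun v => Additive.ofMul fun k =>
      Units.mk0 (Complex.exp ((v : Fin n → ℂ) k / m k)) (Complex.exp_ne_zero _)) (by
      intro u v
      refine congrArg Additive.ofMul (funext fun k => Units.ext ?_)
      simp [add_div, Complex.exp_add])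
  have hψ : ∀ v k, (((ψ v).toMul k : ℂˣ) : ℂ) = Complex.exp ((v : Fin n → ℂ) k / m k) :=
    fun _ _ => rfl
  have hψm : ∀ v k, (((ψ v).toMul k : ℂˣ) : ℂ) ^ m k = Complex.exp ((v : Fin n → ℂ) k) := by
    intro v k
    rw [hψ, ← Complex.exp_nat_mul, mul_div_cancel₀ _ (Nat.cast_ne_zero.2 (hm k))]
  have hker : ψ.ker = O.merLattice q := by
    ext v
    have : v ∈ ψ.ker ↔ ∀ k, Complex.exp ((v : Fin n → ℂ) k / m k) = 1 := by
      rw [AddMonoidHom.mem_ker]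
      constructor
      · intro h k
        rw [← hψ, h]
        rfl
      · exact fun h => congrArg Additive.ofMul (funext fun k => Units.ext (h k))
    rw [this]
    refine forall_congr' fun k => ?_
    rw [Complex.exp_eq_one_iff]
    refine exists_congr fun a => ?_
    rw [div_eq_iff (Nat.cast_ne_zero.2 (hm k))]
    constructor
    · intro h; rw [h]; ring
    · intro h; rw [h]; ring
  have hmap : ∀ b : Fin n → ℂˣ, Additive.ofMul b ∈ (O.lattice q).map ψ ↔
      b ∈ (O.chart q).grp.comap (powHom m) := by
    intro b
    constructor
    · rintro ⟨v, ⟨a, ha, hva⟩, hv⟩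
      have : powHom m b = a := by
        funext k
        refine Units.ext ?_
        rw [← hva k, ← hψm, hv]
        rfl
      rwa [Subgroup.mem_comap, this]
    · intro hb
      rw [Subgroup.mem_comap] at hb
      have hn : ∀ k, ‖(b k : ℂ)‖ = 1 := by
        intro k
        have h1 := (O.chart q).norm_eq_one hb k
        have h2 : ‖(b k : ℂ)‖ ^ m k = 1 := by
          rw [← norm_pow]; exact h1
        exact (pow_eq_one_iff_of_nonneg (norm_nonneg _) (hm k)).1 h2
      have hlog : ∀ k, ((m k : ℂ) * Complex.log (b k)).re = 0 := by
        intro k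
        rw [← Complex.ofReal_natCast, Complex.re_ofReal_mul, Complex.log_re, hn k, Real.log_one,
          mul_zero]
      have hv : ∀ k, Complex.exp ((m k : ℂ) * Complex.log (b k) / m k) = b k := by
        intro k
        rw [mul_div_cancel_left₀ _ (Nat.cast_ne_zero.2 (hm k)), Complex.exp_log (b k).ne_zero]
      let v : imagVectors n := ⟨fun k => (m k : ℂ) * Complex.log (b k), hlog⟩
      refine ⟨v, ⟨_, hb, fun k => ?_⟩,
        congrArg Additive.ofMul (funext fun k => Units.ext (hv k))⟩
      rw [← hψm]
      change Complex.exp ((m k : ℂ) * Complex.log (b k) / m k) ^ m k = _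
      rw [hv k]
      rfl
  rw [← hker, AddSubgroup.relIndex_ker, pointIndex_eq, ← card_comap_powHom hm]
  exact Nat.card_congr (Equiv.subtypeEquiv Additive.toMul fun b => hmap b.toMul)

theorem pointIndex_nsmul_mem {q : X} {v : imagVectors n} (hv : v ∈ O.lattice q) :
    O.pointIndex q • v ∈ O.merLattice q := by
  by_cases hq : q ∈ O.posPart
  · rw [← O.relIndex_merLattice hq]
    exact (O.merLattice q).nsmul_relIndex_mem hv
  · have : O.pointIndex q = 0 := by
      by_contra h
      exact hq (O.mem_posPart_iff.2 h)
    rw [this, zero_smul]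
    exact zero_mem _

end NCOrbifold
end

/-! ### Meridians and periods of cocycles -/

noncomputable section

theorem pathClass_eq_of_convex {E : Type*} [AddCommGroup E] [Module ℝ E] [TopologicalSpace E]
    [ContinuousAdd E] [ContinuousSMul ℝ E] {C : Set E} (hC : Convex ℝ C) {a b : C}
    (p q : PathClass a b) : p = q := by
  have : ContractibleSpace C := hC.contractibleSpace ⟨a, a.2⟩
  induction p using Path.Homotopic.Quotient.ind with | mk γ =>
  induction q using Path.Homotopic.Quotient.ind with | mk δ =>
  exact Path.Homotopic.Quotient.eq.2 (SimplyConnectedSpace.paths_homotopic γ δ)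

theorem PathCocycle.conj_pow {T Γ : Type*} [TopologicalSpace T] [Group Γ] (F : PathCocycle T Γ) {a b : T}
    (σ : PathClass a b) (q : PathClass b b) (m : ℕ) :
    F (σ.trans (q.trans σ.symm)) ^ m = (F σ)⁻¹ * F q ^ m * F σ := by
  have := _root_.conj_pow (i := m) (a := (F σ)⁻¹) (b := F q)
  simpa using this

theorem PathCocycle.conj_pow_eq_one_iff {T Γ : Type*} [TopologicalSpace T] [Group Γ] (F : PathCocycle T Γ)
    {a b : T} (σ : PathClass a b) (q : PathClass b b) (m : ℕ) :
    F (σ.trans (q.trans σ.symm)) ^ m = 1 ↔ F q ^ m = 1 := by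
  rw [PathCocycle.conj_pow, mul_eq_one_iff_eq_inv, inv_mul_eq_iff_eq_mul]
  simp

theorem PathCocycle.map_congr {T T' Γ : Type*} [TopologicalSpace T] [TopologicalSpace T'] [Group Γ]
    (F : PathCocycle T Γ) {f g : C(T', T)} (h : f = g) {a b : T'} (p : PathClass a b) :
    F (p.map f) = F (p.map g) := by
  subst h; rfl

namespace NCOrbifold

open QuotientChart

variable {n : ℕ} {X : Type*} [TopologicalSpace X] (O : NCOrbifold n X) {Γ : Type*} [Group Γ]

/-- The loop `γ` turns once around `D i` in the chart at `p`. -/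
def TurnsAround (i : Fin O.r) (p : X) (hp : p ∈ O.D i) (z : Fin n → ℂ) {x : O.regPart}
    (γ : Path x x) : Prop :=
  ∀ t : unitInterval, (γ t : X) = (O.chart p).map (Function.update z (O.coord p i hp)
    (Complex.exp (2 * Real.pi * Complex.I * ((t : ℝ) : ℂ)) * z (O.coord p i hp)))

/-- The cocycle is trivial on the powers of the meridians prescribed by the indices. -/
def KillsMeridians (F : PathCocycle O.regPart Γ) : Prop :=
  ∀ (i : Fin O.r) (p : X) (hp : p ∈ O.D i), ∀ z ∈ polydisc n, ∀ (x : O.regPart) (γ : Path x x),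
    O.TurnsAround i p hp z γ → F (PathClass.mk γ) ^ O.index i = 1

variable {O}

/-- Having trivial power is invariant under conjugation, so the path from the base point to a
meridian is irrelevant. The unbased form can be checked locally. -/
theorem killsMeridians_iff [PathConnectedSpace O.regPart] (x₀ : O.regPart)
    (F : PathCocycle O.regPart Γ) :
    O.KillsMeridians F ↔ ∀ i g, O.IsMeridian i g → F.toHom x₀ g ^ O.index i = 1 := by
  constructor
  · rintro h i _ ⟨p, hp, z, hz, x, δ, γ, hγ, rfl⟩
    have h1 := (PathCocycle.conj_pow_eq_one_iff F (PathClass.mk δ) (PathClass.mk γ) _).2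
      (h i p hp z hz x γ hγ)
    rw [← Path.Homotopic.Quotient.trans_assoc, ← Path.Homotopic.Quotient.mk_symm,
      ← Path.Homotopic.Quotient.mk_trans, ← Path.Homotopic.Quotient.mk_trans] at h1
    exact h1
  · intro h i p hp z hz x γ hγ
    let δ : Path x₀ x := PathConnectedSpace.somePath x₀ x
    have h1 := h i _ ⟨p, hp, z, hz, x, δ, γ, hγ, rfl⟩
    refine (PathCocycle.conj_pow_eq_one_iff F (PathClass.mk δ) (PathClass.mk γ) _).1 ?_
    rw [← Path.Homotopic.Quotient.trans_assoc, ← Path.Homotopic.Quotient.mk_symm,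
      ← Path.Homotopic.Quotient.mk_trans, ← Path.Homotopic.Quotient.mk_trans]
    exact h1

/-- The basic periods. -/
def unitPeriod (k : Fin n) : imagVectors n :=
  ⟨Pi.single k (2 * Real.pi * Complex.I), fun j => by
    by_cases h : j = k
    · subst h; simp
    · simp [h]⟩

theorem unitPeriod_mem_lattice (p : X) (k : Fin n) : unitPeriod k ∈ O.lattice p := by
  refine ⟨1, one_mem _, fun j => ?_⟩
  by_cases h : j = k
  · subst h; simp [unitPeriod]
  · simp [unitPeriod, h]

/-- The straight path from a point to its translate. -/
def linePath {ε : ℝ} (w : logBall n ε) (v : imagVectors n) : Path w (shift v w) where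
  toFun t := ⟨(w : Fin n → ℂ) + (t : ℝ) • (v : Fin n → ℂ), add_mem_logBall (fun k => by
    simp [v.2 k]) w.2⟩
  continuous_toFun := by fun_prop
  source' := Subtype.ext (by simp)
  target' := Subtype.ext (by simp)

theorem seg_shift_eq {ε : ℝ} (w : logBall n ε) (v : imagVectors n) :
    seg w (shift v w) = PathClass.mk (linePath w v) := pathClass_logBall_eq _ _

theorem expMap_linePath {ε : ℝ} (w : logBall n ε) (k : Fin n) (t : unitInterval) :
    expMap (linePath w (unitPeriod k) t : Fin n → ℂ) = Function.update (expMap w) k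
      (Complex.exp (2 * Real.pi * Complex.I * ((t : ℝ) : ℂ)) * expMap (w : Fin n → ℂ) k) := by
  funext j
  change Complex.exp ((w : Fin n → ℂ) j +
    (t : ℝ) • (Pi.single k (2 * Real.pi * Complex.I) : Fin n → ℂ) j) = _
  by_cases h : j = k
  · subst h
    rw [Pi.single_eq_same, Function.update_self, Complex.exp_add, mul_comm, Complex.real_smul,
      mul_comm (((t : ℝ)) : ℂ)]
    rfl
  · simp [expMap, h]

/-- No component of the divisor is given by the coordinate `k`, and by smallness the points with
only this coordinate zero are smooth. So the loop bounds a disc in the regular part. -/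
theorem map_linePath_null (p : X) {k : Fin n} (h : ∀ i (hi : p ∈ O.D i), O.coord p i hi ≠ k)
    (w : logBall n 1) (F : PathCocycle O.regPart Γ) :
    F ((PathClass.mk (linePath w (unitPeriod k))).map (O.theta p)) = 1 := by
  set z := expMap (w : Fin n → ℂ)
  have hz : z ∈ polydisc n := expMap_mem_polyball (ε := 1).2 w.2
  have hzt : z ∈ torus n := expMap_mem_torus _
  have hupd : ∀ ζ ∈ Metric.ball (0 : ℂ) 1, Function.update z k ζ ∈ polydisc n := by
    intro ζ hζ j
    by_cases hj : j = k
    · subst hj; simpa using hζ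
    · simpa [hj] using hz j
  let Φ : C(Metric.ball (0 : ℂ) 1, O.regPart) :=
    ⟨fun ζ => ⟨(O.chart p).map (Function.update z k ζ), (O.map_mem_regPart_iff p (hupd ζ ζ.2)).2
      ⟨(O.chart p).stab_eq_bot_of_ne k fun j hj => by rw [Function.update_of_ne hj]; exact hzt j,
        fun i hi => by rw [Function.update_of_ne (h i hi)]; exact hzt _⟩⟩,
      Continuous.subtype_mk ((O.chart p).continuousOn_map.comp_continuous
        (by fun_prop) fun ζ : Metric.ball (0 : ℂ) 1 => hupd ζ ζ.2) _⟩
  have hmem : ∀ t : unitInterval,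
      Complex.exp (2 * Real.pi * Complex.I * ((t : ℝ) : ℂ)) * z k ∈ Metric.ball (0 : ℂ) 1 := by
    intro t
    have h1 : ‖Complex.exp (2 * Real.pi * Complex.I * ((t : ℝ) : ℂ))‖ = 1 := by
      rw [Complex.norm_exp]; simp
    rw [mem_ball_zero_iff, norm_mul, h1, one_mul]
    exact hz k
  let ζ₀ : Metric.ball (0 : ℂ) 1 := ⟨z k, by simpa using hz k⟩
  let γ : Path ζ₀ ζ₀ :=
    { toFun := fun t => ⟨_, hmem t⟩
      continuous_toFun := by fun_prop
      source' := Subtype.ext (by simp [ζ₀])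
      target' := Subtype.ext (by simp [ζ₀]) }
  have h1 : PathClass.mk γ = Path.Homotopic.Quotient.refl ζ₀ :=
    pathClass_eq_of_convex (convex_ball _ _) _ _
  have hΦ : Φ ζ₀ = O.theta p w := Subtype.ext (by
    change (O.chart p).map (Function.update z k (z k)) = _
    rw [Function.update_eq_self]; rfl)
  have h2 : (PathClass.mk (linePath w (unitPeriod k))).map (O.theta p) =
      ((PathClass.mk γ).map Φ).cast hΦ.symm
        ((theta_shift (unitPeriod_mem_lattice p k) w).trans hΦ.symm) := by
    refine congrArg PathClass.mk (Path.ext (funext fun t => Subtype.ext ?_))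
    exact congrArg (O.chart p).map (expMap_linePath w k t)
  rw [h2, F.map_cast, h1, PathClass.map_refl, F.map_refl]

theorem turnsAround_linePath (i : Fin O.r) (p : X) (hp : p ∈ O.D i) (w : logBall n 1) :
    O.TurnsAround i p hp (expMap w) (((linePath w (unitPeriod (O.coord p i hp))).map
      (O.theta p).continuous).cast rfl (theta_shift (unitPeriod_mem_lattice p _) w).symm) :=
  fun t => congrArg (O.chart p).map (expMap_linePath w _ t)

theorem comap_theta_invariant {R : Set X} (hR : O.regPart ⊆ R) (F : PathCocycle R Γ) (p : X)
    {v : imagVectors n} (hv : v ∈ O.lattice p) (w w' : logBall n 1) :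
    F.comap (O.thetaIn hR p) (seg (shift v w) (shift v w')) =
      F.comap (O.thetaIn hR p) (seg w w') := by
  rw [← seg_map_shift, PathCocycle.comap_apply, PathCocycle.comap_apply, PathClass.map_map]
  exact F.map_congr (ContinuousMap.ext fun w => thetaIn_shift hR hv w) _

variable (O) in
/-- The homomorphism of periods of a cocycle in the torus part of a chart. -/
def periods {R : Set X} (hR : O.regPart ⊆ R) (F : PathCocycle R Γ) (p : X) (w : logBall n 1) :
    Multiplicative (O.lattice p) →* Γ :=
  periodHom (F.comap (O.thetaIn hR p)) (O.lattice p)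
    (fun _ hv w w' => comap_theta_invariant hR F p hv w w') w

theorem periods_ofAdd {R : Set X} (hR : O.regPart ⊆ R) (F : PathCocycle R Γ) (p : X)
    (w : logBall n 1) (v : O.lattice p) : O.periods hR F p w (Multiplicative.ofAdd v) =
      F ((seg w (shift v.1 w)).map (O.thetaIn hR p)) := rfl

theorem thetaIn_refl (p : X) : O.thetaIn subset_rfl p = O.theta p := rfl

/-- Cocycles that kill the prescribed powers of the meridians are trivial on `merLattice`. -/
theorem KillsMeridians.eq_one {F : PathCocycle O.regPart Γ} (hF : O.KillsMeridians F) (p : X)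
    {v : imagVectors n} (hv : v ∈ O.merLattice p) (w : logBall n 1) :
    F ((seg w (shift v w)).map (O.theta p)) = 1 := by
  set P := O.periods subset_rfl F p w
  let e (k : Fin n) : O.lattice p := ⟨unitPeriod k, unitPeriod_mem_lattice p k⟩
  have he : ∀ k, P (Multiplicative.ofAdd (e k)) ^ O.coordIndex p k = 1 := by
    intro k
    rw [periods_ofAdd, thetaIn_refl, seg_shift_eq]
    by_cases h : ∃ i, ∃ hi : p ∈ O.D i, O.coord p i hi = k
    · obtain ⟨i, hi, rfl⟩ := h
      rw [coordIndex_coord]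
      have := hF i p hi _ (expMap_mem_polyball (ε := 1).2 w.2) _ _ (turnsAround_linePath i p hi w)
      rwa [PathClass.mk, Path.Homotopic.Quotient.mk_cast, F.map_cast] at this
    · push Not at h
      rw [map_linePath_null p h, one_pow]
  choose a ha using hv
  have hsum : v = ∑ k, ((a k : ℤ) • O.coordIndex p k • (e k : imagVectors n)) := by
    ext j
    rw [ha j, AddSubgroup.val_finsetSum, Finset.sum_apply, Finset.sum_eq_single j]
    · simp [e, unitPeriod]
    · intro k _ hk
      simp [e, unitPeriod, Pi.single_eq_of_ne hk.symm]
    · simp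
  have hsum' : (⟨v, O.merLattice_le p fun k => ⟨a k, ha k⟩⟩ : O.lattice p) =
      ∑ k, ((a k : ℤ) • O.coordIndex p k • e k) := by
    refine Subtype.ext ?_
    rw [AddSubgroup.val_finsetSum]
    exact hsum
  have h1 : P (Multiplicative.ofAdd ⟨v, O.merLattice_le p fun k => ⟨a k, ha k⟩⟩) = 1 := by
    rw [hsum', ofAdd_sum, ← MonoidHom.mem_ker]
    refine Subgroup.prod_mem _ fun k _ => ?_
    rw [ofAdd_zsmul, ofAdd_nsmul]
    refine Subgroup.zpow_mem _ ?_ _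
    rw [MonoidHom.mem_ker, map_pow, he k]
  exact h1

/-- Loops near `p` are killed by the power `pointIndex p`. -/
theorem KillsMeridians.pow_pointIndex {F : PathCocycle O.regPart Γ} (hF : O.KillsMeridians F)
    {R : Set X} (hRo : IsOpen R) (hR : O.regPart ⊆ R) (hRs : R ⊆ O.smoothPart)
    {F' : PathCocycle R Γ} (hF' : F'.comap (inclMap hR) = F) {p : X} {a : R} (q : PathClass a a)
    (hq : q.InSet (Subtype.val ⁻¹' (O.chart p).nbhd 1)) : F' q ^ O.pointIndex p = 1 := by
  -- The loop is conjugate to the period of a lattice vector `v`, and `pointIndex p • v` lies in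
  -- `merLattice p`.
  obtain ⟨w, σ, v, hv, -, -, rfl⟩ := exists_loop_eq hRo hR hRs le_rfl q hq
  rw [PathCocycle.conj_pow_eq_one_iff, F'.map_cast, ← periods_ofAdd hR F' p w ⟨v, hv⟩, ← map_pow,
    ← ofAdd_nsmul]
  have h1 := hF.eq_one p (O.pointIndex_nsmul_mem hv) w
  rw [← hF', PathCocycle.comap_apply, PathClass.map_map] at h1
  exact h1

end NCOrbifold
end

/-! ### Moving a meridian to a generic point of its component -/

noncomputable section

theorem PathClass.map_congr {T T' : Type*} [TopologicalSpace T] [TopologicalSpace T']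
    {f g : C(T', T)} (h : f = g) {a b : T'} (p : PathClass a b) :
    p.map f = (p.map g).cast (congrArg (fun f : C(T', T) => f a) h)
      (congrArg (fun f : C(T', T) => f b) h) := by
  subst h; exact (Path.Homotopic.Quotient.cast_rfl_rfl _).symm

theorem Path.Homotopic.Quotient.InSet.cast {T : Type*} [TopologicalSpace T] {V : Set T}
    {a b a' b' : T} {p : PathClass a b} (hp : p.InSet V) (ha : a' = a) (hb : b' = b) :
    (p.cast ha hb).InSet V := by
  subst ha hb; rwa [Path.Homotopic.Quotient.cast_rfl_rfl]

namespace NCOrbifold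

open QuotientChart

variable {n : ℕ} {X : Type*} [TopologicalSpace X] {O : NCOrbifold n X}

/-- A generic point of a component of the divisor. -/
theorem pointIndex_generic {i : Fin O.r} {p : X} (hp : p ∈ O.D i) {z : Fin n → ℂ}
    (hz : z ∈ polydisc n) (h0 : z (O.coord p i hp) = 0)
    (h : ∀ k, k ≠ O.coord p i hp → z k ≠ 0) :
    O.pointIndex ((O.chart p).map z) = O.index i := by
  classical
  rw [pointIndex, O.card_grp_chart p hz, (O.chart p).stab_eq_bot_of_ne _ h, Subgroup.card_bot,
    one_mul, Finset.prod_eq_single i]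
  · intro j hj hji
    have hj' := (Finset.mem_filter.1 hj).2
    have hpj := O.mem_D_of_map_mem hz hj'
    refine absurd ((O.map_mem_D_iff p j hpj z hz).1 hj') (h _ fun hk => hji ?_)
    exact O.coord_injective p j i hpj hp hk
  · intro hi
    exact absurd (Finset.mem_filter (p := fun i => (O.chart p).map z ∈ O.D i).2
      ⟨Finset.mem_univ i, (O.map_mem_D_iff p i hp z hz).2 h0⟩) hi

/-- A loop turning around `D i` is conjugate to loops near a generic point of `D i`. -/
theorem TurnsAround.exists_conj {i : Fin O.r} {p : X} {hp : p ∈ O.D i} {z : Fin n → ℂ}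
    (hz : z ∈ polydisc n) {x : O.regPart} {γ : Path x x} (hγ : O.TurnsAround i p hp z γ) :
    ∃ p', O.pointIndex p' = O.index i ∧ ∀ N ∈ 𝓝 p', ∃ (x' : O.regPart) (σ : PathClass x x')
      (m : PathClass x' x'), m.InSet (Subtype.val ⁻¹' N) ∧
        PathClass.mk γ = σ.trans (m.trans σ.symm) := by
  set k := O.coord p i hp with hk
  have hx : (x : X) = (O.chart p).map z := by
    have := hγ 0
    simp only [Path.source] at this
    rw [this]
    simp
  have hreg : (O.chart p).map z ∈ O.regPart := hx ▸ x.2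
  have hzk : z k ≠ 0 := ((O.map_mem_regPart_iff p hz).1 hreg).2 i hp
  -- Other coordinates of `z` may vanish without `z` leaving the regular part. Moving along `v`
  -- makes them nonzero and does not change the coordinates that are nonzero already.
  let v : Fin n → ℂ := fun j => if z j = 0 then 1 / 2 else 0
  have hv : ∀ s : ℝ, 0 ≤ s → s ≤ 1 → ∀ j, ‖z j + (s : ℂ) * v j‖ < 1 := by
    intro s h0 h1 j
    by_cases hj : z j = 0
    · simp only [v, hj, if_true, zero_add, norm_mul, Complex.norm_real, Real.norm_of_nonneg h0]
      norm_num
      linarith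
    · simpa [v, hj] using hz j
  have hvk : v k = 0 := if_neg hzk
  -- The first parameter moves the other coordinates, and the second is a logarithm of the
  -- coordinate `k`. Adding 2πi to the latter turns once around the component.
  let f : ℝ × ℂ → Fin n → ℂ := fun c => Function.update (fun j => z j + (c.1 : ℂ) * v j) k
    (Complex.exp c.2)
  have hfc : Continuous f := by
    refine continuous_pi fun j => ?_
    by_cases hj : j = k
    · subst hj; simp only [f, Function.update_self]; fun_prop
    · simp only [f, Function.update_of_ne hj]; fun_prop
  let C : Set (ℝ × ℂ) := Set.Icc 0 1 ×ˢ {u | u.re < 0}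
  have hC : Convex ℝ C := (convex_Icc 0 1).prod (convex_halfSpace_re_lt 0)
  have hf : ∀ c ∈ C, f c ∈ polydisc n := by
    rintro c ⟨hc1, hc2⟩ j
    by_cases hj : j = k
    · subst hj
      simp only [f, Function.update_self, Complex.norm_exp, Real.exp_lt_one_iff]
      exact hc2
    · simp only [f, Function.update_of_ne hj]
      exact hv _ hc1.1 hc1.2 j
  have hfreg : ∀ c ∈ C, (O.chart p).map (f c) ∈ O.regPart := by
    intro c hc
    refine O.map_mem_regPart_mono p hz (hf c hc) (fun j hj => ?_) hreg
    by_cases hjk : j = k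
    · subst hjk
      simp only [f, Function.update_self]
      exact Complex.exp_ne_zero _
    · simp [f, Function.update_of_ne hjk, v, hj]
  let Φ : C(C, O.regPart) := ⟨fun c => ⟨(O.chart p).map (f c), hfreg c c.2⟩,
    Continuous.subtype_mk ((O.chart p).continuousOn_map.comp_continuous
      (hfc.comp continuous_subtype_val) fun c : C => hf c c.2) _⟩
  have hshift : ∀ c : C, ((c : ℝ × ℂ).1, (c : ℝ × ℂ).2 + 2 * Real.pi * Complex.I) ∈ C :=
    fun c => ⟨c.2.1, by simpa using c.2.2⟩
  let S : C(C, C) := ⟨fun c => ⟨_, hshift c⟩, by fun_prop⟩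
  have hΦS : Φ.comp S = Φ := by
    ext c
    change (O.chart p).map (f _) = (O.chart p).map (f _)
    congr 1
    simp [f, S, Complex.exp_add]
  have hline : ∀ c : C, ∀ t : unitInterval, ((c : ℝ × ℂ).1, (c : ℝ × ℂ).2 +
      2 * Real.pi * Complex.I * ((t : ℝ) : ℂ)) ∈ C := fun c t => ⟨c.2.1, by simpa using c.2.2⟩
  let L (c : C) : Path c (S c) :=
    { toFun := fun t => ⟨_, hline c t⟩
      continuous_toFun := by fun_prop
      source' := Subtype.ext (by simp)
      target' := Subtype.ext (by simp [S]) }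
  let z1 : Fin n → ℂ := fun j => z j + v j
  let z' : Fin n → ℂ := Function.update z1 k 0
  have hz' : z' ∈ polydisc n := by
    intro j
    by_cases hj : j = k
    · subst hj; simp [z']
    · simpa [z', Function.update_of_ne hj, z1] using hv 1 zero_le_one le_rfl j
  refine ⟨(O.chart p).map z', pointIndex_generic hp hz' (by simp [z', hk]) fun j hj => ?_,
    fun N hN => ?_⟩
  · rw [← hk] at hj
    simp only [z', Function.update_of_ne hj, z1, v]
    split_ifs with h0
    · rw [h0]; norm_num
    · simpa using h0
  have hcont : ContinuousAt (fun ζ : ℂ => (O.chart p).map (Function.update z1 k ζ)) 0 :=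
    ContinuousAt.comp (f := fun ζ : ℂ => Function.update z1 k ζ)
      ((O.chart p).continuousAt_map hz') (by fun_prop)
  obtain ⟨r, hr, hrN⟩ := Metric.mem_nhds_iff.1 (hcont hN)
  obtain ⟨M, hM⟩ : ∃ M : ℝ, Real.exp M < r ∧ M < 0 := by
    refine ⟨min (Real.log (r / 2)) (-1), ?_, (min_le_right _ _).trans_lt (by norm_num)⟩
    calc Real.exp _ ≤ Real.exp (Real.log (r / 2)) := Real.exp_le_exp.2 (min_le_left _ _)
      _ = r / 2 := Real.exp_log (by positivity)
      _ < r := by linarith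
  let c0 : C := ⟨(0, Complex.log (z k)), ⟨le_rfl, zero_le_one⟩, by
    simp only [Set.mem_ofPred_eq, Complex.log_re]
    exact Real.log_neg (norm_pos_iff.2 hzk) (hz k)⟩
  let c1 : C := ⟨(1, (M : ℂ)), ⟨zero_le_one, le_rfl⟩, by simpa using hM.2⟩
  have hpc : IsPathConnected C := hC.isPathConnected ⟨c0, c0.2⟩
  have : PathConnectedSpace C := isPathConnected_iff_pathConnectedSpace.1 hpc
  let σ₀ : PathClass c0 c1 := PathClass.mk (PathConnectedSpace.somePath c0 c1)
  -- In the convex set `C`, turning and then moving is homotopic to moving and then turning. As `Φ`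
  -- is invariant under `S`, the image of this identity is the conjugation formula.
  have hkey : (PathClass.mk (L c0)).trans (σ₀.map S) = σ₀.trans (PathClass.mk (L c1)) :=
    pathClass_eq_of_convex hC _ _
  have hS : ∀ c, Φ c = Φ (S c) := fun c => (congrArg (fun f : C(C, O.regPart) => f c) hΦS).symm
  have hΦx : x = Φ c0 := Subtype.ext (by
    rw [hx]
    change _ = (O.chart p).map (f _)
    congr 1
    funext j
    by_cases hj : j = k
    · subst hj; simp [f, c0, Complex.exp_log hzk]
    · simp [f, c0, Function.update_of_ne hj])
  have hγL : PathClass.mk γ = ((PathClass.mk (L c0)).map Φ).cast hΦx (hΦx.trans (hS _)) := by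
    refine congrArg PathClass.mk (Path.ext (funext fun t => Subtype.ext ?_))
    refine (hγ t).trans ?_
    change _ = (O.chart p).map (f _)
    congr 1
    funext j
    by_cases hj : j = k
    · subst hj
      simp [f, c0, L, Complex.exp_add, mul_comm, hk, Complex.exp_log (hk ▸ hzk)]
    · simp [f, c0, L, Function.update_of_ne hj, ← hk]
  refine ⟨Φ c1, (σ₀.map Φ).cast hΦx rfl, ((PathClass.mk (L c1)).map Φ).cast rfl (hS _), ?_, ?_⟩
  · refine Path.Homotopic.Quotient.InSet.cast ?_ _ _
    refine ⟨(L c1).map Φ.continuous, fun t => ?_, rfl⟩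
    have : Complex.exp ((M : ℂ) + 2 * Real.pi * Complex.I * ((t : ℝ) : ℂ)) ∈ Metric.ball 0 r := by
      rw [mem_ball_zero_iff, Complex.norm_exp]
      simpa using hM.1
    have h2 := hrN this
    have h3 : f (L c1 t) = Function.update z1 k
        (Complex.exp ((M : ℂ) + 2 * Real.pi * Complex.I * ((t : ℝ) : ℂ))) := by
      funext j
      by_cases hj : j = k
      · subst hj; simp [f, c1, L]
      · simp [f, c1, L, Function.update_of_ne hj, z1]
    change (O.chart p).map (f (L c1 t)) ∈ N
    rw [h3]
    exact h2
  · have h1 : (PathClass.mk γ).trans ((σ₀.map Φ).cast hΦx rfl) =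
        ((σ₀.map Φ).cast hΦx rfl).trans (((PathClass.mk (L c1)).map Φ).cast rfl (hS _)) := by
      rw [hγL, PathClass.cast_trans_cast, ← PathClass.map_trans, ← hkey, PathClass.map_trans,
        ← PathClass.cast_trans_cast _ _ hΦx (hΦx.trans (hS c0)) (hS c1)]
      congr 1
      rw [PathClass.map_map, PathClass.map_congr hΦS, Path.Homotopic.Quotient.cast_cast]
    rw [← Path.Homotopic.Quotient.trans_assoc, ← h1, Path.Homotopic.Quotient.trans_assoc]
    simp

end NCOrbifold
end

/-! ### Finite generation of the fundamental group of the regular part -/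

noncomputable section

namespace NCOrbifold

open QuotientChart

variable {n : ℕ} {X : Type*} [TopologicalSpace X] (O : NCOrbifold n X)

/-- The `N`-th power of every group element is `1`, so the coordinates of lattice vectors are
multiples of 2πi/N. The lattice thus embeds in a finitely generated abelian group. -/
theorem fg_lattice (p : X) : Group.FG (Multiplicative (O.lattice p)) := by
  have := (O.chart p).finite_grp
  set N := Nat.card (O.chart p).grp
  have hN : N ≠ 0 := Nat.card_pos.ne'
  let S : Submodule ℤ (Fin n → ℂ) :=
    Submodule.span ℤ (Set.range fun k => Pi.single k (2 * Real.pi * Complex.I / N))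
  have : IsNoetherian ℤ S := isNoetherian_span_of_finite ℤ (Set.finite_range _)
  let f : O.lattice p →ₗ[ℤ] Fin n → ℂ :=
    ((imagVectors n).subtype.comp (O.lattice p).subtype).toIntLinearMap
  have hf : Function.Injective f := fun a b h => Subtype.ext (Subtype.ext h)
  have hfS : ∀ v, f v ∈ S := by
    intro v
    obtain ⟨a, ha, hva⟩ := v.2
    have : ∀ k, ∃ m : ℤ, f v k = m • (2 * Real.pi * Complex.I / N) := by
      intro k
      have h1 : (a k : ℂ) ^ N = 1 := by
        have h2 : (⟨a, ha⟩ : (O.chart p).grp) ^ N = 1 := pow_card_eq_one'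
        have := congrArg (fun x : (O.chart p).grp => ((x.1 k : ℂˣ) : ℂ)) h2
        simpa using this
      rw [← hva k, ← Complex.exp_nat_mul, Complex.exp_eq_one_iff] at h1
      obtain ⟨m, hm⟩ := h1
      refine ⟨m, ?_⟩
      change ((v : imagVectors n) : Fin n → ℂ) k = _
      rw [zsmul_eq_mul, mul_div_assoc', ← hm, mul_div_cancel_left₀ _ (Nat.cast_ne_zero.2 hN)]
    choose m hm using this
    have h2 : f v = ∑ k, m k • (Pi.single k (2 * Real.pi * Complex.I / N) : Fin n → ℂ) := by
      funext j
      rw [Finset.sum_apply, Finset.sum_eq_single j]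
      · rw [hm j]; simp
      · intro k _ hk
        simp [Pi.single_eq_of_ne hk.symm]
      · simp
    rw [h2]
    exact Submodule.sum_mem _ fun k _ => Submodule.smul_mem _ _
      (Submodule.subset_span ⟨k, rfl⟩)
  have h3 : Module.Finite ℤ (O.lattice p) := by
    have := isNoetherian_of_injective (f.codRestrict S hfS)
      (fun a b h => hf (congrArg (fun x : S => (x : Fin n → ℂ)) h))
    infer_instance
  have h4 : AddGroup.FG (O.lattice p) := Module.Finite.iff_addGroup_fg.1 h3
  infer_instance

theorem isPathConnected_nbhd_inter_regPart (x : X) {ε : ℝ} (h0 : 0 < ε) (h1 : ε ≤ 1) :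
    IsPathConnected ((O.chart x).nbhd ε ∩ O.regPart) := by
  have := O.isPathConnected_map_image x h1 (S := (O.chart x).map ⁻¹' O.regPart) (by
    refine isPathConnected_of_ne_zero (convex_polyball n ε) (isOpen_polyball n ε)
      (differentiable_prod_coord n).differentiableOn ?_ ?_ fun z hz hGz => ?_
    · obtain ⟨z, hz, hzt⟩ := exists_mem_torus_of_mem_nhds
        ((isOpen_polyball n ε).mem_nhds (zero_mem_polyball h0))
      exact ⟨z, hz, mem_torus_iff_prod.1 hzt⟩
    · exact ((O.chart x).continuousOn_map.mono (polyball_subset_polydisc h1)).isOpen_inter_preimage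
        (isOpen_polyball n ε) O.isOpen_regPart
    · exact O.map_mem_regPart_of_torus x (polyball_subset_polydisc h1 hz)
        (mem_torus_iff_prod.2 hGz))
  rwa [Set.image_inter_preimage] at this

/-- Conjugated by a fixed path to the torus part, the loops in a chart are the periods of lattice
vectors. The cocycle used extends the identity of the fundamental group, so its value on a loop at
`b` is the class of that loop. -/
theorem exists_finite_generators [PathConnectedSpace O.regPart] (q : X) (b : O.regPart) :
    ∃ S : Set (FundamentalGroup O.regPart b), S.Finite ∧ ∀ p : PathClass b b,
      p.InSet (Subtype.val ⁻¹' (O.chart q).nbhd 1) →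
        FundamentalGroup.fromPath p ∈ Subgroup.closure S := by
  by_cases hb : (b : X) ∈ (O.chart q).nbhd 1
  · obtain ⟨F, hF⟩ := PathCocycle.exists_toHom_eq b (MonoidHom.id (FundamentalGroup O.regPart b))
    obtain ⟨w, σ, hw, hσ⟩ := exists_path_thetaIn O.isOpen_regPart subset_rfl le_rfl b hb
    let P := (MulAut.conj (F σ)⁻¹).toMonoidHom.comp (O.periods subset_rfl F q w)
    obtain ⟨S, hS, hSf⟩ := Group.fg_iff.1 (O.fg_lattice q)
    refine ⟨P '' S, hSf.image P, fun p hp => ?_⟩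
    rw [← MonoidHom.map_closure, hS]
    obtain ⟨w', h2, h3⟩ := exists_seg_of_inSet O.isOpen_regPart subset_rfl
      O.regPart_subset_smoothPart le_rfl (b := O.thetaIn subset_rfl q w) hw (theta_mem_torusNbhd hw) (σ.symm.trans (p.trans σ))
      (hσ.symm.trans (hp.trans hσ))
    obtain ⟨v, hv, rfl⟩ := theta_eq_iff.1 (Subtype.ext (congrArg
      (fun x : O.regPart => (x : X)) h2) : O.theta q w = O.theta q w')
    refine ⟨Multiplicative.ofAdd ⟨v, hv⟩, trivial, ?_⟩
    have h4 : F p = FundamentalGroup.fromPath p := congrArg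
      (fun f : FundamentalGroup O.regPart b →* FundamentalGroup O.regPart b =>
        f (FundamentalGroup.fromPath p)) hF
    rw [← h4]
    change (F σ)⁻¹ * (O.periods subset_rfl F q w _) * (F σ)⁻¹⁻¹ = _
    have h5 : F ((seg w (shift v w)).map (O.thetaIn subset_rfl q)) = F σ * F p * (F σ)⁻¹ := by
      refine (F.map_cast _ rfl h2).symm.trans ?_
      refine (congrArg (fun p => F p) h3.symm).trans ?_
      rw [F.map_trans, F.map_trans, F.map_symm]
    rw [periods_ofAdd, h5]
    group
  · exact ⟨∅, Set.finite_empty, fun p hp => absurd hp.left hb⟩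

/-- By the Lebesgue number lemma, finitely many charts are so small that any two that meet lie
together in a chart of radius `1`, where loops are generated by finitely many classes. -/
theorem fg_fundamentalGroup [T2Space X] [CompactSpace X] [ConnectedSpace X] (x₀ : O.regPart) :
    Group.FG (FundamentalGroup O.regPart x₀) := by
  have : PathConnectedSpace O.regPart :=
    isPathConnected_iff_pathConnectedSpace.1 O.isPathConnected_regPart
  let _ : UniformSpace X := uniformSpaceOfCompactR1
  obtain ⟨V, hV, hVq⟩ := lebesgue_number_lemma (U := fun q : X => (O.chart q).nbhd 1)
    isCompact_univ (fun q => (O.chart q).isOpen_nbhd le_rfl)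
    (fun x _ => Set.mem_iUnion.2 ⟨x, mem_of_mem_nhds (O.map_mem_nhds x one_pos le_rfl)⟩)
  obtain ⟨V', hV', hsymm, hVV⟩ := comp_symm_mem_uniformity_sets hV
  have : ∀ x : X, ∃ δ, 0 < δ ∧ δ ≤ 1 ∧ ∀ y ∈ (O.chart x).nbhd δ, ∀ z ∈ (O.chart x).nbhd δ,
      (y, z) ∈ V' := by
    intro x
    obtain ⟨V'', hV'', hs, hV2⟩ := comp_symm_mem_uniformity_sets hV'
    obtain ⟨δ, h0, h1, hδ⟩ := O.exists_nbhd_subset (UniformSpace.ball_mem_nhds x hV'')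
    refine ⟨δ, h0, h1, fun y hy z hz => hV2 ?_⟩
    exact ⟨x, hs.symm _ _ (hδ hy), hδ hz⟩
  choose δ h0 h1 hδ using this
  obtain ⟨t, ht⟩ := isCompact_univ.elim_finite_subcover (fun x : X => (O.chart x).nbhd (δ x))
    (fun x => (O.chart x).isOpen_nbhd (h1 x))
    (fun x _ => Set.mem_iUnion.2 ⟨x, mem_of_mem_nhds (O.map_mem_nhds x (h0 x) (h1 x))⟩)
  choose q hq using fun x : X => hVq x trivial
  refine fundamentalGroup_fg x₀ (ι := t)
    (fun x => Subtype.val ⁻¹' (O.chart (x : X)).nbhd (δ x))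
    (fun x => Subtype.val ⁻¹' (O.chart (q x)).nbhd 1) ?_ ?_ ?_ ?_ ?_
  · exact fun x => ((O.chart (x : X)).isOpen_nbhd (h1 x)).preimage continuous_subtype_val
  · intro y
    obtain ⟨x, hx, hxy⟩ := Set.mem_iUnion₂.1 (ht (Set.mem_univ (y : X)))
    exact ⟨⟨x, hx⟩, hxy⟩
  · intro x
    have := O.isPathConnected_nbhd_inter_regPart (x : X) (h0 x) (h1 x)
    have e : (Subtype.val ⁻¹' (O.chart (x : X)).nbhd (δ x) : Set O.regPart) =
        Subtype.val ⁻¹' ((O.chart (x : X)).nbhd (δ x) ∩ O.regPart) := by ext; simp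
    rw [e]
    exact this.preimage_coe Set.inter_subset_right
  · rintro x x' ⟨z, hz, hz'⟩ y hy
    refine hq x (hVV ⟨z, ?_, hδ _ _ hz' _ hy⟩)
    exact hδ _ _ (mem_of_mem_nhds (O.map_mem_nhds x (h0 x) (h1 x))) _ hz
  · exact fun x b _ => O.exists_finite_generators (q x) b

end NCOrbifold
end

/-! ### The covering over the regular part of the base -/

noncomputable section

namespace IsUnbranchedCover

variable {n : ℕ} {X Y : Type*} [TopologicalSpace X] [TopologicalSpace Y]
  {OY : NCOrbifold n Y} {OX : NCOrbifold n X} {π : Y → X} (h : IsUnbranchedCover OY OX π)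

include h

/-- Existence of a local degree at every point includes that arbitrarily small neighbourhoods have
open images. -/
theorem isOpen_image {W : Set Y} (hW : IsOpen W) (hWp : W ⊆ OY.posPart) : IsOpen (π '' W) := by
  rw [isOpen_iff_mem_nhds]
  rintro _ ⟨y, hy, rfl⟩
  obtain ⟨d, hd, -⟩ := h.index_mul_degree ⟨y, hWp hy⟩
  obtain ⟨V, hVW, -, hyV, hV, -⟩ := hd (Subtype.val ⁻¹' W)
    ((hW.preimage continuous_subtype_val).mem_nhds hy)
  refine Filter.mem_of_superset
    ((OX.isOpen_posPart.isOpenMap_subtype_val _ hV).mem_nhds ⟨_, ⟨_, hyV, rfl⟩, rfl⟩) ?_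
  rintro _ ⟨_, ⟨v, hv, rfl⟩, rfl⟩
  exact ⟨v, hVW hv, rfl⟩

/-- The tube lemma for the closed map underlying a proper map. -/
theorem exists_nhds_preimage {x : X} (hx : x ∈ OX.posPart) {U : Set Y} (hU : IsOpen U)
    (hxU : ∀ y ∈ OY.posPart, π y = x → y ∈ U) :
    ∃ N ∈ 𝓝 x, ∀ y ∈ OY.posPart, π y ∈ N → y ∈ U := by
  have h1 : (Subtype.val ⁻¹' U : Set OY.posPart) ∈
      𝓝ˢ (h.mapsTo.restrict π OY.posPart OX.posPart ⁻¹' {⟨x, hx⟩}) :=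
    (hU.preimage continuous_subtype_val).mem_nhdsSet.2 fun y hy =>
      hxU y y.2 (congrArg Subtype.val hy)
  obtain ⟨N, hN, hNU⟩ := isClosedMap_iff_comap_nhds_le.1 h.proper.isClosedMap h1
  rw [nhds_subtype_eq_comap] at hN
  obtain ⟨N', hN', hN'N⟩ := hN
  exact ⟨N', hN', fun y hy hyN => hNU (show (⟨y, hy⟩ : OY.posPart) ∈ _ from hN'N hyN)⟩

theorem finite_fiber' {x : X} (hx : x ∈ OX.posPart) : {y ∈ OY.posPart | π y = x}.Finite := by
  refine ((h.finite_fiber ⟨x, hx⟩).image Subtype.val).subset ?_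
  rintro y ⟨hy, rfl⟩
  exact ⟨⟨y, hy⟩, rfl, rfl⟩

theorem continuousOn : ContinuousOn π OY.posPart := by
  rw [continuousOn_iff_continuous_domRestrict]
  exact continuous_subtype_val.comp h.proper.continuous

/-- The points over the regular part of `X`. -/
def starPart (_ : IsUnbranchedCover OY OX π) : Set Y := OY.posPart ∩ π ⁻¹' OX.regPart

theorem isOpen_inter_preimage {U : Set X} (hU : IsOpen U) : IsOpen (OY.posPart ∩ π ⁻¹' U) :=
  h.continuousOn.isOpen_inter_preimage OY.isOpen_posPart hU

theorem isOpen_starPart : IsOpen h.starPart := h.isOpen_inter_preimage OX.isOpen_regPart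

theorem commonPart_subset_starPart : h.commonPart ⊆ h.starPart :=
  fun _ hy => ⟨OY.regPart_subset_posPart hy.1, hy.2⟩

/-- The orbifold index of the image is `1`, so both factors of ν(y) deg_y π are `1`. The point `y`
may still lie on components of index `1`, so it belongs to `trivialPart` but not necessarily to
`regPart`. -/
theorem index_eq_one {y : Y} (hy : y ∈ h.starPart) :
    OY.pointIndex y = 1 ∧ HasLocalDegree (h.mapsTo.restrict π OY.posPart OX.posPart) ⟨y, hy.1⟩ 1 := by
  obtain ⟨d, hd, hdi⟩ := h.index_mul_degree ⟨y, hy.1⟩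
  have h1 : OX.pointIndex (π y) = 1 :=
    OX.mem_trivialPart_iff.1 (OX.regPart_subset_trivialPart hy.2)
  change _ = OX.pointIndex (π y) at hdi
  rw [h1, mul_eq_one] at hdi
  obtain ⟨h2, rfl⟩ := hdi
  exact ⟨h2, hd⟩

theorem starPart_subset_trivialPart : h.starPart ⊆ OY.trivialPart :=
  fun _ hy => OY.mem_trivialPart_iff.2 (h.index_eq_one hy).1

/-- The local degree is `1`. If two points of `V` had the same image, disjoint neighbourhoods of
them would have overlapping open images. A generic point of the overlap would then have two
preimages in `V`. -/
theorem exists_injOn [T2Space Y] {y : Y} (hy : y ∈ h.starPart) :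
    ∃ V, IsOpen V ∧ y ∈ V ∧ V ⊆ h.starPart ∧ Set.InjOn π V := by
  obtain ⟨V, hVs, hV, hyV, -, U, hU, -, hVU, hUc⟩ := (h.index_eq_one hy).2
    (Subtype.val ⁻¹' h.starPart)
    ((h.isOpen_starPart.preimage continuous_subtype_val).mem_nhds hy)
  have hV' : IsOpen (Subtype.val '' V) := OY.isOpen_posPart.isOpenMap_subtype_val _ hV
  refine ⟨Subtype.val '' V, hV', ⟨_, hyV, rfl⟩, ?_, ?_⟩
  · rintro _ ⟨v, hv, rfl⟩
    exact hVs hv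
  · rintro _ ⟨v, hv, rfl⟩ _ ⟨w, hw, rfl⟩ hvw
    by_contra hne
    have hne' : v ≠ w := fun h => hne (congrArg Subtype.val h)
    obtain ⟨A, B, hA, hB, hvA, hwB, hAB⟩ := t2_separation hne'
    have hop : ∀ {A : Set OY.posPart}, IsOpen A →
        IsOpen (h.mapsTo.restrict π OY.posPart OX.posPart '' A) := by
      intro A hA
      have := h.isOpen_image (OY.isOpen_posPart.isOpenMap_subtype_val _ hA)
        (by rintro _ ⟨a, -, rfl⟩; exact a.2)
      rw [Set.image_image] at this
      convert! this.preimage (continuous_subtype_val (p := fun x => x ∈ OX.posPart)) using 1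
      ext x
      constructor
      · rintro ⟨a, ha, rfl⟩; exact ⟨a, ha, rfl⟩
      · rintro ⟨a, ha, hax⟩; exact ⟨a, ha, Subtype.ext hax⟩
    have heq : h.mapsTo.restrict π OY.posPart OX.posPart v =
        h.mapsTo.restrict π OY.posPart OX.posPart w := Subtype.ext hvw
    obtain ⟨u, ⟨⟨a, ha, hau⟩, b, hb, hbu⟩, hu⟩ := mem_closure_iff.1 (hVU ⟨v, hv, rfl⟩) _
      ((hop (hA.inter hV)).inter (hop (hB.inter hV)))
      ⟨⟨v, ⟨hvA, hv⟩, rfl⟩, w, ⟨hwB, hw⟩, heq.symm⟩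
    obtain ⟨c, hc⟩ := Set.ncard_eq_one.1 (hUc u hu)
    have hac : a = c := hc.subset ⟨ha.2, hau⟩
    have hbc : b = c := hc.subset ⟨hb.2, hbu⟩
    exact Set.disjoint_left.1 hAB ha.1 (hac.trans hbc.symm ▸ hb.1)

/-- The restriction of `π` over the regular part of `X`. -/
def projStar : C(h.starPart, OX.regPart) where
  toFun y := ⟨π y, y.2.2⟩
  continuous_toFun := by
    refine Continuous.subtype_mk ?_ _
    exact h.continuousOn.comp_continuous continuous_subtype_val fun y => y.2.1

/-- The map is open and locally injective, so a local homeomorphism; being closed with finite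
fibres, it is a covering. -/
theorem isCoveringMap_projStar [T2Space Y] : IsCoveringMap h.projStar := by
  have hopen : IsOpenMap h.projStar := by
    intro W hW
    have := h.isOpen_image (h.isOpen_starPart.isOpenMap_subtype_val _ hW)
      (by rintro _ ⟨a, -, rfl⟩; exact a.2.1)
    rw [Set.image_image] at this
    convert! this.preimage (continuous_subtype_val (p := fun x => x ∈ OX.regPart)) using 1
    ext x
    constructor
    · rintro ⟨a, ha, rfl⟩; exact ⟨a, ha, rfl⟩
    · rintro ⟨a, ha, hax⟩; exact ⟨a, ha, Subtype.ext hax⟩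
  have hloc : IsLocalHomeomorph h.projStar := by
    rw [isLocalHomeomorph_iff_isOpenEmbedding_restrict]
    intro y
    obtain ⟨V, hV, hyV, -, hinj⟩ := h.exists_injOn y.2
    have hV' : IsOpen (Subtype.val ⁻¹' V : Set h.starPart) := hV.preimage continuous_subtype_val
    refine ⟨_, hV'.mem_nhds hyV, ?_⟩
    refine IsOpenEmbedding.of_continuous_injective_isOpenMap
      (h.projStar.continuous.comp continuous_subtype_val) ?_
      (hopen.comp hV'.isOpenMap_subtype_val)
    intro a b hab
    exact Subtype.ext (Subtype.ext (hinj a.2 b.2 (congrArg Subtype.val hab)))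
  have hclosed : IsClosedMap h.projStar := by
    rw [isClosedMap_iff_comap_nhds_le]
    intro x W hW
    obtain ⟨W', hW', hxW', hW'W⟩ := mem_nhdsSet_iff_exists.1 hW
    obtain ⟨N, hN, hNW⟩ := h.exists_nhds_preimage (OX.regPart_subset_posPart x.2)
      (h.isOpen_starPart.isOpenMap_subtype_val _ hW') (by
        intro y hy hyx
        have hys : y ∈ h.starPart := ⟨hy, by rw [Set.mem_preimage, hyx]; exact x.2⟩
        exact ⟨⟨y, hys⟩, hxW' (Subtype.ext hyx), rfl⟩)
    refine ⟨Subtype.val ⁻¹' N, continuous_subtype_val.continuousAt hN, fun y hy => hW'W ?_⟩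
    obtain ⟨y', hy', e⟩ := hNW y y.2.1 hy
    rwa [← Subtype.ext e]
  have hcov := hclosed.isCoveringMapOn_of_isLocalHomeomorphOn (s := Set.univ) (fun x _ => ?_)
    (isLocalHomeomorph_iff_isLocalHomeomorphOn_univ.1 hloc)
  · exact isCoveringMap_iff_isCoveringMapOn_univ.2 hcov
  · refine Set.Finite.of_finite_image ((h.finite_fiber' (OX.regPart_subset_posPart x.2)).subset ?_)
      Subtype.val_injective.injOn
    rintro _ ⟨y, hy, rfl⟩
    exact ⟨y.2.1, congrArg Subtype.val hy⟩

end IsUnbranchedCover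
end

noncomputable section

theorem PathClass.cast_eq_cast {T : Type*} [TopologicalSpace T] {a b c d a' b' a'' b'' : T}
    {p : PathClass a b} {q : PathClass c d} {ha : a' = a} {hb : b' = b} {hc : a' = c} {hd : b' = d}
    (h : p.cast ha hb = q.cast hc hd) (ea : a'' = c) (eb : b'' = d) (fa : a'' = a) (fb : b'' = b) :
    q.cast ea eb = p.cast fa fb := by
  subst ha hb hc hd ea eb
  exact h.symm

/-! ### Lifting of path classes -/

namespace IsCoveringMap

variable {E B : Type*} [TopologicalSpace E] [TopologicalSpace B] {f : C(E, B)}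

theorem exists_lift (hf : IsCoveringMap f) {e : E} {b : B} (q : PathClass (f e) b) :
    ∃ (e' : E) (he : f e' = b) (β : PathClass e e'), β.map f = q.cast rfl he :=
  ⟨_, _, hf.liftPathQuotient q ⟨e, rfl⟩, hf.map_liftPathQuotient q ⟨e, rfl⟩⟩

/-- Both ends are the image of `e` under the monodromy of the same class. -/
theorem eq_of_map_eq (hf : IsCoveringMap f) {e e₁ e₂ : E} (β : PathClass e e₁)
    (β' : PathClass e e₂) (he : f e₁ = f e₂) (h : β.map f = (β'.map f).cast rfl he) : e₁ = e₂ := by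
  have h1 := hf.monodromy_eq_of_map_eq (γ := β'.map f) (ex := ⟨e, rfl⟩) (ey := ⟨e₁, he⟩) β h
  have h2 := hf.monodromy_eq_of_map_eq (γ := β'.map f) (ex := ⟨e, rfl⟩) (ey := ⟨e₂, rfl⟩) β'
    (Path.Homotopic.Quotient.cast_rfl_rfl _).symm
  exact congrArg Subtype.val (h1.symm.trans h2)

/-- Lift a representative that stays in `N`; by uniqueness of lifts of path classes the result
represents `β`. -/
theorem inSet_preimage (hf : IsCoveringMap f) {e e' : E} {β : PathClass e e'} {N : Set B}
    (hβ : (β.map f).InSet N) : β.InSet (f ⁻¹' N) := by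
  obtain ⟨γ, hγ, hγβ⟩ := hβ
  have hs : γ.toContinuousMap 0 = f e := γ.source
  let Γ : Path e (hf.liftPath γ.toContinuousMap e hs 1) :=
    ⟨hf.liftPath γ.toContinuousMap e hs, hf.liftPath_zero _ e hs, rfl⟩
  have hΓ : ∀ t, f (Γ t) = γ t := fun t => congrFun (hf.liftPath_lifts γ.toContinuousMap e hs) t
  have h1 : f (hf.liftPath γ.toContinuousMap e hs 1) = f e' := (hΓ 1).trans γ.target
  have h2 : (PathClass.mk Γ).map f = (β.map f).cast rfl h1 := by
    rw [← hγβ]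
    exact congrArg PathClass.mk (Path.ext (funext hΓ))
  have h3 := hf.eq_of_map_eq _ _ h1 h2
  refine ⟨Γ.cast rfl h3.symm, fun t => ?_, hf.injective_path_homotopic_map e e' ?_⟩
  · rw [Path.cast_coe, Set.mem_preimage, hΓ]; exact hγ t
  · refine Eq.trans ?_ hγβ
    exact congrArg PathClass.mk (Path.ext (funext hΓ))

theorem exists_lift_logBall (hf : IsCoveringMap f) {n : ℕ} (g : C(logBall n 1, B))
    (w : logBall n 1) (e : E) (he : f e = g w) :
    ∃ F : C(logBall n 1, E), F w = e ∧ f.comp F = g := by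
  have : ContractibleSpace (logBall n 1) := convex_logBall.contractibleSpace ⟨w, w.2⟩
  have : LocallyPathConnectedSpace (logBall n 1) := isOpen_logBall.locallyPathConnectedSpace
  obtain ⟨F, ⟨h1, h2⟩, -⟩ := hf.existsUnique_continuousMap_lifts g w e he
  exact ⟨F, h1, ContinuousMap.ext fun x => congrFun h2 x⟩

end IsCoveringMap

theorem Path.Homotopic.Quotient.InSet.subset_left {T : Type*} [TopologicalSpace T] {U V V' : Set T}
    {a b : T} {p : PathClass a b} (hp : p.InSet U) (hV : IsOpen V) (hV' : IsOpen V')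
    (hd : Disjoint V V') (hU : U ⊆ V ∪ V') (ha : a ∈ V) : p.InSet V := by
  obtain ⟨γ, hγ, rfl⟩ := hp
  have h1 : IsPreconnected (Set.range γ) := isPreconnected_range γ.continuous
  have h2 : Set.range γ ⊆ V := h1.subset_left_of_subset_union hV hV' hd
    (Set.range_subset_iff.2 fun s => hU (hγ s)) ⟨a, ⟨0, γ.source⟩, ha⟩
  exact ⟨γ, fun s => h2 ⟨s, rfl⟩, rfl⟩

/-- The translations that do not change a map. -/
def deckLattice {n : ℕ} {T : Type*} [TopologicalSpace T] (F : C(logBall n 1, T)) :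
    AddSubgroup (imagVectors n) where
  carrier := {v | ∀ w, F (shift v w) = F w}
  zero_mem' := fun w => by rw [shift_zero]
  add_mem' := by
    intro u v hu hv w
    rw [shift_add, hv, hu]
  neg_mem' := by
    intro u hu w
    rw [← hu (shift (-u) w), ← shift_add, neg_add_cancel, shift_zero]

/-! ### Sheets of the orbifold covering -/

namespace IsUnbranchedCover

variable {n : ℕ} {X Y : Type*} [TopologicalSpace X] [TopologicalSpace Y]
  {OY : NCOrbifold n Y} {OX : NCOrbifold n X} {π : Y → X} (h : IsUnbranchedCover OY OX π)

/-- `V` is open and closed in the inverse image of the chart of radius `ε` at `π y`, and `y` is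
the only point of `V` over `π y`. -/
structure IsSheet (h : IsUnbranchedCover OY OX π) (y : Y) (V : Set Y) (ε : ℝ) : Prop where
  isOpen : IsOpen V
  mem : y ∈ V
  subset : V ⊆ OY.posPart
  pos : 0 < ε
  le_one : ε ≤ 1
  mapsTo : ∀ u ∈ V, π u ∈ (OX.chart (π y)).nbhd ε
  eq : ∀ u ∈ V, π u = π y → u = y
  separated : ∃ V', IsOpen V' ∧ Disjoint V V' ∧
    OY.posPart ∩ π ⁻¹' (OX.chart (π y)).nbhd ε ⊆ V ∪ V'

/-- The fibre is finite, so `y` and the remaining points of the fibre have disjoint neighbourhoods.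
As the map is closed, the preimage of a small chart is contained in their union. -/
theorem exists_isSheet [T2Space Y] {y : Y} (hy : y ∈ OY.posPart) {W : Set Y} (hW : W ∈ 𝓝 y) :
    ∃ V ε, h.IsSheet y V ε ∧ V ⊆ W := by
  have hp : π y ∈ OX.posPart := h.mapsTo hy
  have hfin := h.finite_fiber' hp
  obtain ⟨A, B, hA, hB, hyA, hFB, hAB⟩ := SeparatedNhds.of_isCompact_isCompact
    (isCompact_singleton (x := y)) ((hfin.subset Set.sdiff_subset).isCompact
      (s := {u ∈ OY.posPart | π u = π y} \ {y})) (by simp)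
  rw [Set.singleton_subset_iff] at hyA
  set V₀ := A ∩ interior W ∩ OY.posPart
  have hV₀ : IsOpen V₀ := (hA.inter isOpen_interior).inter OY.isOpen_posPart
  have hyV₀ : y ∈ V₀ := ⟨⟨hyA, mem_interior_iff_mem_nhds.2 hW⟩, hy⟩
  obtain ⟨N, hN, hNV⟩ := h.exists_nhds_preimage hp (hV₀.union hB) fun u hu hup => by
    by_cases huy : u = y
    · exact Or.inl (huy ▸ hyV₀)
    · exact Or.inr (hFB ⟨⟨hu, hup⟩, huy⟩)
  obtain ⟨ε, h0, h1, hε⟩ := OX.exists_nbhd_subset hN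
  have hsub : OY.posPart ∩ π ⁻¹' (OX.chart (π y)).nbhd ε ⊆ V₀ ∪ B :=
    fun u hu => hNV u hu.1 (hε hu.2)
  have hO := h.isOpen_inter_preimage ((OX.chart (π y)).isOpen_nbhd h1)
  refine ⟨OY.posPart ∩ π ⁻¹' (OX.chart (π y)).nbhd ε ∩ V₀, ε, ⟨hO.inter hV₀, ?_,
    fun u hu => hu.1.1, h0, h1, fun u hu => hu.1.2, ?_, B, hB, ?_, ?_⟩,
    fun u hu => interior_subset hu.2.1.2⟩
  · exact ⟨⟨hy, show π y ∈ _ from mem_of_mem_nhds (OX.map_mem_nhds (π y) h0 h1)⟩, hyV₀⟩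
  · intro u hu hup
    by_contra huy
    exact Set.disjoint_left.1 hAB hu.2.1.1 (hFB ⟨⟨hu.1.1, hup⟩, huy⟩)
  · exact hAB.mono_left fun u hu => hu.2.1.1
  · exact fun u hu => (hsub hu).imp (fun h => ⟨hu, h⟩) id

namespace IsSheet

variable {h} {y : Y} {V : Set Y} {ε : ℝ}

/-- Only `y` lies over `π y` in the sheet, so closedness of the map makes the parts of the sheet
over smaller charts shrink to `y`. -/
theorem exists_small (hV : h.IsSheet y V ε) {W : Set Y} (hW : W ∈ 𝓝 y) :
    ∃ δ, 0 < δ ∧ δ ≤ ε ∧ ∀ u ∈ V, π u ∈ (OX.chart (π y)).nbhd δ → u ∈ W := by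
  obtain ⟨V', hV', hd, hsub⟩ := hV.separated
  have hp : π y ∈ OX.posPart := h.mapsTo (hV.subset hV.mem)
  obtain ⟨N, hN, hNW⟩ := h.exists_nhds_preimage hp (isOpen_interior.union hV') fun u hu hup => by
    rcases hsub ⟨hu, by
        rw [Set.mem_preimage, hup]; exact hV.mapsTo y hV.mem⟩ with hu' | hu'
    · rw [hV.eq u hu' hup]
      exact Or.inl (mem_interior_iff_mem_nhds.2 hW)
    · exact Or.inr hu'
  obtain ⟨δ, h0, -, hδ⟩ := OX.exists_nbhd_subset hN
  refine ⟨min δ ε, lt_min h0 hV.pos, min_le_right _ _, fun u hu huδ => ?_⟩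
  rcases hNW u (hV.subset hu) (hδ ((OX.chart (π y)).nbhd_mono (min_le_left _ _) huδ)) with h1 | h1
  · exact interior_subset h1
  · exact absurd h1 (Set.disjoint_left.1 hd hu)

/-- In the chart at `y`, the preimage of the torus part is where the pull-back of an invariant
coordinate function does not vanish. The pull-back is holomorphic, and it is not identically zero
because π is open. -/
theorem isPathConnected_torus (hV : h.IsSheet y V ε) : ∃ C ∈ 𝓝 y, C ⊆ V ∧
    IsPathConnected (C ∩ π ⁻¹' OX.torusNbhd (π y) ε) := by
  obtain ⟨δ, h0, h1, hδ⟩ := OY.exists_nbhd_subset (hV.isOpen.mem_nhds hV.mem)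
  have hδ' : ∀ z ∈ polyball n δ, (OY.chart y).map z ∈ V := fun z hz => hδ ⟨z, hz, rfl⟩
  obtain ⟨g, hg, hgt⟩ := OX.exists_coordFunction (π y)
  have hiff : ∀ z ∈ polyball n δ, g (π ((OY.chart y).map z)) ≠ 0 ↔
      π ((OY.chart y).map z) ∈ OX.torusNbhd (π y) ε := fun z hz =>
    OX.mem_torusNbhd_of_ne_zero hgt hV.le_one (hV.mapsTo _ (hδ' z hz))
  have hT := OX.isOpen_torusNbhd (π y) hV.le_one
  refine ⟨(OY.chart y).nbhd δ, OY.map_mem_nhds y h0 h1, hδ, ?_⟩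
  have := OY.isPathConnected_map_image y h1
    (S := (OY.chart y).map ⁻¹' (OY.posPart ∩ π ⁻¹' OX.torusNbhd (π y) ε)) (by
      refine isPathConnected_of_ne_zero (G := fun z => g (π ((OY.chart y).map z)))
        (convex_polyball n δ) (isOpen_polyball n δ) ?_ ?_ ?_ ?_
      · refine (h.holomorphic _ g ((OX.chart (π y)).isOpen_nbhd le_rfl) hg y).mono fun z hz => ?_
        exact ⟨polyball_subset_polydisc h1 hz, hV.subset (hδ' z hz),
          (OX.chart (π y)).nbhd_mono hV.le_one (hV.mapsTo _ (hδ' z hz))⟩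
      · obtain ⟨_, ⟨_, ⟨z, hz, rfl⟩, rfl⟩, hx⟩ := OX.exists_mem_torusNbhd (q := π y) hV.le_one
          (h.isOpen_image ((OY.chart y).isOpen_nbhd h1) (hδ.trans hV.subset))
          ⟨π y, ⟨y, mem_of_mem_nhds (OY.map_mem_nhds y h0 h1), rfl⟩, hV.mapsTo y hV.mem⟩
        exact ⟨z, hz, (hiff z hz).2 hx⟩
      · exact ((OY.chart y).continuousOn_map.mono
          (polyball_subset_polydisc h1)).isOpen_inter_preimage (isOpen_polyball n δ)
          (h.isOpen_inter_preimage hT)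
      · exact fun z hz hgz => ⟨hV.subset (hδ' z hz), (hiff z hz).1 hgz⟩)
  rw [Set.image_inter_preimage] at this
  convert! this using 1
  ext u
  exact ⟨fun hu => ⟨hu.1, hV.subset (hδ hu.1), hu.2⟩, fun hu => ⟨hu.1, hu.2.2⟩⟩

variable [T2Space Y]

/-- The sheet is open and closed in the preimage of the chart, so a path that lies over the chart
and starts in the sheet cannot leave it. -/
theorem inSet (hV : h.IsSheet y V ε) {a b : h.starPart} (ha : (a : Y) ∈ V) {β : PathClass a b}
    (hβ : (β.map h.projStar).InSet (Subtype.val ⁻¹' (OX.chart (π y)).nbhd ε)) :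
    β.InSet (Subtype.val ⁻¹' V) := by
  obtain ⟨V', hV', hd, hsub⟩ := hV.separated
  refine (h.isCoveringMap_projStar.inSet_preimage hβ).subset_left
    (hV.isOpen.preimage continuous_subtype_val) (hV'.preimage continuous_subtype_val)
    (hd.preimage _) (fun u hu => hsub ⟨u.2.1, hu⟩) ha

theorem lift_mem (hV : h.IsSheet y V ε) {F : C(logBall n 1, h.starPart)}
    (hF : h.projStar.comp F = OX.theta (π y)) {w₀ w : logBall n 1}
    (hw₀ : (w₀ : Fin n → ℂ) ∈ logBall n ε) (hw₀V : (F w₀ : Y) ∈ V)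
    (hw : (w : Fin n → ℂ) ∈ logBall n ε) : (F w : Y) ∈ V := by
  refine (hV.inSet (β := (seg w₀ w).map F) hw₀V ?_).right
  rw [PathClass.map_map, PathClass.map_congr hF]
  refine Path.Homotopic.Quotient.InSet.cast ?_ _ _
  exact (seg_inSet hw₀ hw).map _ fun u hu => NCOrbifold.theta_mem_nbhd hu

/-- The points of a sheet over a point of the torus part are permuted transitively. -/
theorem exists_transitive (hV : h.IsSheet y V ε) : ∃ δ, 0 < δ ∧ δ ≤ ε ∧
    ∀ F : C(logBall n 1, h.starPart), h.projStar.comp F = OX.theta (π y) →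
    ∀ w : logBall n 1, (w : Fin n → ℂ) ∈ logBall n δ → (F w : Y) ∈ V →
    ∀ u : h.starPart, (u : Y) ∈ V → h.projStar u = OX.theta (π y) w →
      ∃ v ∈ OX.lattice (π y), F (shift v w) = u := by
  obtain ⟨C, hC, hCV, hCT⟩ := hV.isPathConnected_torus
  obtain ⟨δ, h0, hδε, hδ⟩ := hV.exists_small hC
  refine ⟨δ, h0, hδε, fun F hF w hw hFw u hu huw => ?_⟩
  have hFw' : ∀ w, h.projStar (F w) = OX.theta (π y) w :=
    fun w => congrArg (fun f : C(logBall n 1, OX.regPart) => f w) hF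
  have hmem : ∀ u : h.starPart, (u : Y) ∈ V → h.projStar u = OX.theta (π y) w →
      (u : Y) ∈ C ∩ π ⁻¹' OX.torusNbhd (π y) ε := by
    intro u hu huw
    have hu' : π u = OX.theta (π y) w := congrArg Subtype.val huw
    refine ⟨hδ u hu ?_, ?_⟩
    · rw [hu']; exact NCOrbifold.theta_mem_nbhd hw
    · rw [Set.mem_preimage, hu']
      exact NCOrbifold.theta_mem_torusNbhd (logBall_mono hδε hw)
  -- A path in the sheet over the torus part joins the two points. Its projection is a loop in the
  -- torus part, and this loop defines the translation `v`.
  obtain ⟨γ, hγ⟩ := hCT.exists_path (hmem _ hFw (hFw' w)) (hmem u hu huw)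
  have hγs : ∀ s, γ s ∈ h.starPart := fun s => ⟨hV.subset (hCV (hγ s).1),
    OX.torusNbhd_subset_regPart (π y) hV.le_one (hγ s).2⟩
  let β : PathClass (F w) u := PathClass.mk (γ.toSubtype hγs)
  obtain ⟨w', h2, h3⟩ := NCOrbifold.exists_seg_of_inSet OX.isOpen_regPart subset_rfl
    OX.regPart_subset_smoothPart hV.le_one (w := w) (logBall_mono hδε hw) (b := h.projStar u)
    (hmem u hu huw).2 ((β.map h.projStar).cast (hFw' w).symm rfl)
    (Path.Homotopic.Quotient.InSet.cast (Path.Homotopic.Quotient.InSet.mk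
      ((γ.toSubtype hγs).map h.projStar.continuous)
      fun s => OX.torusNbhd_subset_nbhd _ _ (hγ s).2) _ _)
  obtain ⟨v, hv, rfl⟩ := NCOrbifold.theta_eq_iff.1
    (huw.symm.trans h2 : OX.theta (π y) w = OX.theta (π y) w')
  refine ⟨v, hv, ?_⟩
  refine h.isCoveringMap_projStar.eq_of_map_eq ((seg w (shift v w)).map F) β
    ((hFw' _).trans h2.symm) ?_
  rw [PathClass.map_map, PathClass.map_congr hF]
  exact PathClass.cast_eq_cast h3 _ _ _ _

end IsSheet

end IsUnbranchedCover
end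

/-! ### The local degree as a lattice index -/

noncomputable section

namespace IsUnbranchedCover

variable {n : ℕ} {X Y : Type*} [TopologicalSpace X] [TopologicalSpace Y]
  {OY : NCOrbifold n Y} {OX : NCOrbifold n X} {π : Y → X} {h : IsUnbranchedCover OY OX π}

namespace IsSheet

variable {y : Y} {V : Set Y} {ε : ℝ}

/-- The number of points of a sheet over some points of the torus part. -/
theorem exists_ncard (hV : h.IsSheet y V ε) {d : ℕ} {hy : y ∈ OY.posPart}
    (hd : HasLocalDegree (h.mapsTo.restrict π OY.posPart OX.posPart) ⟨y, hy⟩ d) {δ : ℝ}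
    (h0 : 0 < δ) (hδε : δ ≤ ε) : ∃ w : logBall n 1, (w : Fin n → ℂ) ∈ logBall n δ ∧
      {u ∈ V | π u = OX.theta (π y) w}.ncard = d := by
  obtain ⟨W, hWV, hW, hyW, hWo, U, hU, -, hWU, hUd⟩ := hd (Subtype.val ⁻¹' V)
    ((hV.isOpen.preimage continuous_subtype_val).mem_nhds hV.mem)
  -- Over a chart this small, the sheet `V` and the neighbourhood `W` in which preimages are counted
  -- contain the same points.
  obtain ⟨δ', h0', hδ'ε, hδ'⟩ := hV.exists_small (W := Subtype.val '' W)
    ((OY.isOpen_posPart.isOpenMap_subtype_val _ hW).mem_nhds ⟨_, hyW, rfl⟩)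
  set r := min δ δ'
  have hr0 : 0 < r := lt_min h0 h0'
  have hr1 : r ≤ 1 := (min_le_left _ _).trans (hδε.trans hV.le_one)
  have hro := (OX.chart (π y)).isOpen_nbhd hr1
  obtain ⟨x, hxr, hxU⟩ := mem_closure_iff.1 (hWU ⟨_, hyW, rfl⟩) _
    (hro.preimage continuous_subtype_val) (show π y ∈ _ from mem_of_mem_nhds (OX.map_mem_nhds (π y) hr0 hr1))
  obtain ⟨x', ⟨u, hu, hux'⟩, hx't⟩ := OX.exists_mem_torusNbhd (q := π y) hr1
    (OX.isOpen_posPart.isOpenMap_subtype_val _ hU) ⟨x, ⟨x, hxU, rfl⟩, hxr⟩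
  obtain ⟨w, hw, rfl⟩ := NCOrbifold.exists_theta_eq hr1 hx't
  refine ⟨w, logBall_mono (min_le_left _ _) hw, ?_⟩
  rw [← hUd u hu, ← Set.ncard_image_of_injective _ Subtype.val_injective]
  congr 1
  ext v
  constructor
  · rintro ⟨hv, hvw⟩
    obtain ⟨v', hv', rfl⟩ := hδ' v hv (by
      rw [hvw]
      exact NCOrbifold.theta_mem_nbhd (logBall_mono (min_le_right _ _) hw))
    exact ⟨v', ⟨hv', Subtype.ext (hvw.trans hux'.symm)⟩, rfl⟩
  · rintro ⟨v', ⟨hv', hvu⟩, rfl⟩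
    exact ⟨hWV hv', (congrArg Subtype.val hvu).trans hux'⟩

/-- The lattice acts transitively on the points of the sheet over a point of the torus part near `π
y`, with stabilizer `deckLattice F`. The index is thus the number of these points, which is the
local degree for a suitable choice of the point. -/
theorem relIndex_deckLattice [T2Space Y] (hV : h.IsSheet y V ε) {F : C(logBall n 1, h.starPart)}
    (hF : h.projStar.comp F = OX.theta (π y)) {w₀ : logBall n 1}
    (hw₀ : (w₀ : Fin n → ℂ) ∈ logBall n ε) (hw₀V : (F w₀ : Y) ∈ V) :
    OY.pointIndex y * (deckLattice F).relIndex (OX.lattice (π y)) = OX.pointIndex (π y) := by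
  obtain ⟨d, hd, hdi⟩ := h.index_mul_degree ⟨y, hV.subset hV.mem⟩
  obtain ⟨δ, h0, hδε, htr⟩ := hV.exists_transitive
  obtain ⟨w, hw, hwd⟩ := hV.exists_ncard hd h0 hδε
  have hFw : ∀ w, h.projStar (F w) = OX.theta (π y) w :=
    fun w => congrArg (fun f : C(logBall n 1, OX.regPart) => f w) hF
  have hlift : ∀ {w : logBall n 1}, (w : Fin n → ℂ) ∈ logBall n ε → (F w : Y) ∈ V :=
    fun hw => hV.lift_mem hF hw₀ hw₀V hw
  have hwε := logBall_mono hδε hw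
  have hcard : (deckLattice F).relIndex (OX.lattice (π y)) = d := by
    rw [← hwd, AddSubgroup.relIndex, AddSubgroup.index, ← Nat.card_coe_set_eq]
    have hmem : ∀ v : OX.lattice (π y), (F (shift v.1 w) : Y) ∈ V ∧
        π (F (shift v.1 w)) = OX.theta (π y) w := fun v =>
      ⟨hlift (add_mem_logBall v.1.2 hwε),
        congrArg Subtype.val ((hFw _).trans (NCOrbifold.theta_shift v.2 w))⟩
    -- Lifts that agree at one point agree everywhere, so equality at `w` already gives a
    -- translation that preserves `F`.
    have hdeck : ∀ u v : OX.lattice (π y), F (shift u.1 w) = F (shift v.1 w) ↔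
        -u + v ∈ (deckLattice F).addSubgroupOf (OX.lattice (π y)) := by
      intro u v
      rw [AddSubgroup.mem_addSubgroupOf]
      constructor
      · intro huv w'
        have : ContractibleSpace (logBall n 1) :=
          convex_logBall.contractibleSpace ⟨w, w.2⟩
        have h1 : (F.comp (shift u.1) : logBall n 1 → h.starPart) = F.comp (shift v.1) := by
          refine h.isCoveringMap_projStar.eq_of_comp_eq (F.comp (shift u.1)).continuous
            (F.comp (shift v.1)).continuous (funext fun x => ?_) w huv
          exact ((hFw _).trans (NCOrbifold.theta_shift u.2 x)).trans
            ((hFw _).trans (NCOrbifold.theta_shift v.2 x)).symm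
        have h2 := congrFun h1 (shift (-u.1) w')
        simp only [ContinuousMap.comp_apply, ← shift_add, neg_add_cancel, shift_zero] at h2
        exact h2.symm
      · intro huv
        have h2 := huv (shift u.1 w)
        rw [← shift_add] at h2
        simpa using h2.symm
    refine Nat.card_congr (Equiv.ofBijective (Quotient.lift
      (fun v => (⟨F (shift v.1 w), hmem v⟩ : {u ∈ V | π u = OX.theta (π y) w})) ?_) ⟨?_, ?_⟩)
    · intro u v huv
      exact Subtype.ext (congrArg (fun x : h.starPart => (x : Y))
        ((hdeck u v).2 (QuotientAddGroup.leftRel_apply.1 huv)))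
    · rintro ⟨u⟩ ⟨v⟩ huv
      have huv' : (F (shift u.1 w) : Y) = F (shift v.1 w) :=
        congrArg (fun x : {u ∈ V | π u = OX.theta (π y) w} => (x : Y)) huv
      exact Quotient.sound (QuotientAddGroup.leftRel_apply.2 ((hdeck u v).1 (Subtype.ext huv')))
    · rintro ⟨u, hu, huw⟩
      have hus : u ∈ h.starPart := ⟨hV.subset hu, by
        rw [Set.mem_preimage, huw]; exact (OX.theta (π y) w).2⟩
      obtain ⟨v, hv, hvu⟩ := htr F hF w hw (hlift hwε) ⟨u, hus⟩ hu (Subtype.ext huw)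
      have hvu' : (F (shift v w) : Y) = u := congrArg Subtype.val hvu
      exact ⟨Quotient.mk _ ⟨v, hv⟩, Subtype.ext hvu'⟩
  rw [hcard]
  exact hdi

end IsSheet

end IsUnbranchedCover
end

/-! ### Loops in the base all of whose lifts are trivial -/

noncomputable section

namespace PathClass

variable {T : Type*} [TopologicalSpace T]

/-- The powers of the class of a loop. -/
def pow {a : T} (q : PathClass a a) : ℕ → PathClass a a
  | 0 => Path.Homotopic.Quotient.refl a
  | k + 1 => q.trans (pow q k)

theorem fromPath_pow {a : T} (q : PathClass a a) (k : ℕ) :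
    FundamentalGroup.fromPath q ^ k = FundamentalGroup.fromPath (pow q k) := by
  induction k with
  | zero => rfl
  | succ k ih => rw [pow_succ, ih]; rfl

theorem conj_pow {a b : T} (σ : PathClass a b) (q : PathClass b b) (k : ℕ) :
    pow (σ.trans (q.trans σ.symm)) k = σ.trans ((pow q k).trans σ.symm) := by
  induction k with
  | zero => simp [pow]
  | succ k ih => simp [pow, ih]

end PathClass

theorem PathCocycle.map_pow {T Γ : Type*} [TopologicalSpace T] [Group Γ] (F : PathCocycle T Γ)
    {a : T} (q : PathClass a a) (k : ℕ) : F (PathClass.pow q k) = F q ^ k := by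
  induction k with
  | zero => rw [PathClass.pow, F.map_refl, _root_.pow_zero]
  | succ k ih => rw [PathClass.pow, F.map_trans, ih, _root_.pow_succ]

/-- The loop given by a period of a map. -/
def periodLoop {n : ℕ} {T : Type*} [TopologicalSpace T] (f : C(logBall n 1, T))
    {v : imagVectors n} (hv : v ∈ deckLattice f) (w : logBall n 1) : PathClass (f w) (f w) :=
  ((seg w (shift v w)).map f).cast rfl (hv w).symm

theorem pow_periodLoop {n : ℕ} {T : Type*} [TopologicalSpace T] (f : C(logBall n 1, T))
    {v : imagVectors n} (hv : v ∈ deckLattice f) (w : logBall n 1) (k : ℕ) :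
    PathClass.pow (periodLoop f hv w) k = periodLoop f (nsmul_mem hv k) w := by
  induction k with
  | zero =>
    have : ∀ (u : imagVectors n) (hu : u ∈ deckLattice f), u = 0 →
        periodLoop f hu w = Path.Homotopic.Quotient.refl _ := by
      rintro u hu rfl
      have h1 : seg w (shift 0 w) = (Path.Homotopic.Quotient.refl w).cast rfl (shift_zero w) :=
        pathClass_logBall_eq _ _
      rw [periodLoop, h1]
      rfl
    exact (this _ _ (zero_smul ℕ v)).symm
  | succ k ih =>
    rw [PathClass.pow, ih]
    have h1 : seg w (shift ((k + 1) • v) w) = ((seg w (shift v w)).trans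
        (seg (shift v w) (shift v (shift (k • v) w)))).cast rfl (by
          rw [← shift_add, ← succ_nsmul]) := pathClass_logBall_eq _ _
    have h2 : f.comp (shift v) = f := ContinuousMap.ext hv
    have h3 : (seg (shift v w) (shift v (shift (k • v) w))).map f =
        ((seg w (shift (k • v) w)).map f).cast (hv w) (hv _) := by
      rw [← seg_map_shift, PathClass.map_map, PathClass.map_congr h2]
    have h4 : ((seg w (shift ((k + 1) • v) w)).map f) = (((seg w (shift v w)).map f).trans
        (((seg w (shift (k • v) w)).map f).cast (hv w) (hv _))).cast rfl
          (congrArg f (by rw [← shift_add, ← succ_nsmul])) := by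
      rw [h1, ← h3, ← PathClass.map_trans]
      generalize (seg w (shift v w)).trans (seg (shift v w) (shift v (shift (k • v) w))) = s
      induction s using Path.Homotopic.Quotient.ind with | mk γ => rfl
    rw [periodLoop, periodLoop, periodLoop, h4, Path.Homotopic.Quotient.cast_cast,
      ← PathClass.cast_trans_cast _ _ rfl (hv w).symm, Path.Homotopic.Quotient.cast_cast]

theorem periodLoop_congr {n : ℕ} {T : Type*} [TopologicalSpace T] {f f' : C(logBall n 1, T)}
    (hf : f = f') {v v' : imagVectors n} (hvv : v = v') (hv : v ∈ deckLattice f)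
    (hv' : v' ∈ deckLattice f') (w : logBall n 1) : periodLoop f hv w =
      (periodLoop f' hv' w).cast (congrArg (fun f : C(logBall n 1, T) => f w) hf)
        (congrArg (fun f : C(logBall n 1, T) => f w) hf) := by
  subst hf hvv
  rw [Path.Homotopic.Quotient.cast_rfl_rfl]

theorem map_periodLoop {n : ℕ} {T T' : Type*} [TopologicalSpace T] [TopologicalSpace T']
    {f : C(logBall n 1, T)} {v : imagVectors n} (hv : v ∈ deckLattice f) (w : logBall n 1)
    (g : C(T, T')) : (periodLoop f hv w).map g =
      periodLoop (g.comp f) (fun w => congrArg g (hv w)) w := by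
  unfold periodLoop
  generalize seg w (shift v w) = s
  induction s using Path.Homotopic.Quotient.ind with | mk γ => rfl

theorem NCOrbifold.mem_logBall_of_theta_mem {n : ℕ} {X : Type*} [TopologicalSpace X]
    {O : NCOrbifold n X} {p : X} {w : logBall n 1} {ε : ℝ} (h1 : ε ≤ 1)
    (hw : (O.theta p w : X) ∈ (O.chart p).nbhd ε) : (w : Fin n → ℂ) ∈ logBall n ε := by
  obtain ⟨z, hz, hzw⟩ := hw
  obtain ⟨a, ha, haz⟩ := QuotientChart.exists_act_of_map_eq (polyball_subset_polydisc h1 hz)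
    (expMap_mem_polyball (ε := 1).2 w.2) hzw
  rw [← expMap_mem_polyball, haz]
  exact QuotientChart.act_mem_polyball ha hz

namespace IsUnbranchedCover

variable {n : ℕ} {X Y : Type*} [TopologicalSpace X] [TopologicalSpace Y]
  {OY : NCOrbifold n Y} {OX : NCOrbifold n X} {π : Y → X} (h : IsUnbranchedCover OY OX π)
  {Γ : Type*} [Group Γ]

/-- All lifts of the loop are closed, and the cocycle is trivial on them. -/
def IsGood (h : IsUnbranchedCover OY OX π) (F : PathCocycle h.starPart Γ) {x : OX.regPart}
    (g : PathClass x x) : Prop :=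
  ∀ (u : h.starPart) (hu : h.projStar u = x),
    ∃ β : PathClass u u, β.map h.projStar = g.cast hu hu ∧ F β = 1

namespace IsGood

variable {h} {F : PathCocycle h.starPart Γ} {x : OX.regPart}

theorem refl (x : OX.regPart) : h.IsGood F (Path.Homotopic.Quotient.refl x) := by
  rintro u rfl
  exact ⟨Path.Homotopic.Quotient.refl u, rfl, F.map_refl u⟩

theorem trans {g g' : PathClass x x} (hg : h.IsGood F g) (hg' : h.IsGood F g') :
    h.IsGood F (g.trans g') := by
  rintro u rfl
  obtain ⟨β, h1, h2⟩ := hg u rfl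
  obtain ⟨β', h1', h2'⟩ := hg' u rfl
  refine ⟨β.trans β', ?_, by rw [F.map_trans, h2, h2', mul_one]⟩
  rw [PathClass.map_trans, h1, h1']
  simp only [Path.Homotopic.Quotient.cast_rfl_rfl]

theorem symm {g : PathClass x x} (hg : h.IsGood F g) : h.IsGood F g.symm := by
  rintro u rfl
  obtain ⟨β, h1, h2⟩ := hg u rfl
  refine ⟨β.symm, ?_, by rw [F.map_symm, h2, inv_one]⟩
  rw [PathClass.map_symm, h1]
  simp only [Path.Homotopic.Quotient.cast_rfl_rfl]

/-- A lift of the conjugate starts with a lift of `σ`, continues with a closed lift of `g`, and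
returns along the same lift of `σ`. -/
theorem conj [T2Space Y] {x' : OX.regPart} (σ : PathClass x x') {g : PathClass x' x'}
    (hg : h.IsGood F g) : h.IsGood F (σ.trans (g.trans σ.symm)) := by
  rintro u rfl
  obtain ⟨u', rfl, β, hβ⟩ := h.isCoveringMap_projStar.exists_lift σ
  obtain ⟨α, h1, h2⟩ := hg u' rfl
  refine ⟨β.trans (α.trans β.symm), ?_, by
    rw [F.map_trans, F.map_trans, F.map_symm, h2, mul_one, inv_mul_cancel]⟩
  rw [PathClass.map_trans, PathClass.map_trans, PathClass.map_symm, h1, hβ]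
  simp only [Path.Homotopic.Quotient.cast_rfl_rfl]

end IsGood

/-- The good loops form a normal subgroup. -/
def goodSubgroup (F : PathCocycle h.starPart Γ) (x : OX.regPart) :
    Subgroup (FundamentalGroup OX.regPart x) where
  carrier := {g | h.IsGood F (x := x) g}
  one_mem' := IsGood.refl x
  mul_mem' := fun ha hb => IsGood.trans hb ha
  inv_mem' := fun ha => IsGood.symm ha

theorem normal_goodSubgroup [T2Space Y] (F : PathCocycle h.starPart Γ) (x : OX.regPart) :
    (h.goodSubgroup F x).Normal := by
  refine ⟨fun g hg σ => ?_⟩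
  have := IsGood.conj (h := h) (F := F) (x := x) (x' := x) (σ⁻¹ : FundamentalGroup OX.regPart x) hg
  have e : σ * g * σ⁻¹ = (((σ⁻¹)⁻¹ : FundamentalGroup OX.regPart x) * g) * σ⁻¹ := by
    rw [inv_inv]
  rw [e]
  exact this

/-- A loop near `p` is conjugate to the period of some `v`. Around a point `y` over `p`, the
multiple `d • v` lifts to a closed loop, where `d` is the index of the deck lattice. The power
`ν(y)` of that loop is killed by the cocycle, and ν(y) d = ν(p). -/
theorem exists_nhds_isGood [T2Space Y] {F₀ : PathCocycle OY.regPart Γ}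
    (hF₀ : OY.KillsMeridians F₀) {F : PathCocycle OY.trivialPart Γ}
    (hF : F.comap (inclMap OY.regPart_subset_trivialPart) = F₀) {p : X} (hp : p ∈ OX.posPart) :
    ∃ N ∈ 𝓝 p, ∀ (x : OX.regPart) (m : PathClass x x), m.InSet (Subtype.val ⁻¹' N) →
      h.IsGood (F.comap (inclMap h.starPart_subset_trivialPart))
        (PathClass.pow m (OX.pointIndex p)) := by
  classical
  have hsheet : ∀ y : {y ∈ OY.posPart | π y = p}, ∃ V ε, h.IsSheet (y : Y) V ε ∧
      V ⊆ (OY.chart (y : Y)).nbhd 1 := fun y =>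
    h.exists_isSheet y.2.1 (OY.map_mem_nhds _ one_pos le_rfl)
  choose V ε hV hVn using hsheet
  have hfin : Finite {y ∈ OY.posPart | π y = p} := (h.finite_fiber' hp).to_subtype
  obtain ⟨N, hN, hNV⟩ := h.exists_nhds_preimage hp (isOpen_iUnion fun y => (hV y).isOpen)
    fun y hy hyp => Set.mem_iUnion.2 ⟨⟨y, hy, hyp⟩, (hV _).mem⟩
  have hN' : N ∩ ⋂ y, (OX.chart p).nbhd (ε y) ∈ 𝓝 p := by
    refine Filter.inter_mem hN (Filter.iInter_mem.2 fun y => ?_)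
    exact OX.map_mem_nhds p (hV y).pos (hV y).le_one
  obtain ⟨δ, h0, h1, hδ⟩ := OX.exists_nbhd_subset hN'
  refine ⟨(OX.chart p).nbhd δ, OX.map_mem_nhds p h0 h1, fun x m hm => ?_⟩
  obtain ⟨w, σ, v, hv, hw, hσ, rfl⟩ := NCOrbifold.exists_loop_eq OX.isOpen_regPart subset_rfl
    OX.regPart_subset_smoothPart h1 m hm
  rw [PathClass.conj_pow]
  refine IsGood.conj σ ?_
  intro e he
  obtain ⟨θ', hθe, hθ⟩ := h.isCoveringMap_projStar.exists_lift_logBall (OX.theta p) w e he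
  subst hθe
  have hπe : π (θ' w) = OX.theta p w := congrArg Subtype.val he
  -- The sheets around the points over `p` cover the preimage of the chosen neighbourhood, so the
  -- given starting point lies in one of them.
  obtain ⟨⟨y, hy, hyp⟩, heV⟩ := Set.mem_iUnion.1 (hNV (θ' w) (θ' w).2.1 (by
    rw [hπe]
    exact (hδ (NCOrbifold.theta_mem_nbhd hw)).1))
  set y' : {y ∈ OY.posPart | π y = p} := ⟨y, hy, hyp⟩
  subst hyp
  have hsub : (OX.chart (π y)).nbhd δ ⊆ (OX.chart (π y)).nbhd (ε y') := fun u hu =>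
    Set.mem_iInter.1 (hδ hu).2 y'
  have hwε : (w : Fin n → ℂ) ∈ logBall n (ε y') :=
    NCOrbifold.mem_logBall_of_theta_mem (hV y').le_one (hsub (NCOrbifold.theta_mem_nbhd hw))
  have hk := (hV y').relIndex_deckLattice hθ hwε heV
  set d := (deckLattice θ').relIndex (OX.lattice (π y))
  have hdv : d • v ∈ deckLattice θ' := AddSubgroup.nsmul_relIndex_mem _ hv
  set ℓ := periodLoop θ' hdv w
  have hℓ : ℓ.InSet (Subtype.val ⁻¹' V y') := by
    have h3 := (hV y').inSet (β := (seg w (shift (d • v) w)).map θ') heV (by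
      rw [PathClass.map_map, PathClass.map_congr hθ]
      refine Path.Homotopic.Quotient.InSet.cast ?_ _ _
      exact (seg_inSet hwε (add_mem_logBall (d • v).2 hwε)).map _
        fun u hu => NCOrbifold.theta_mem_nbhd hu)
    exact h3.cast _ _
  refine ⟨PathClass.pow ℓ (OY.pointIndex y), ?_, ?_⟩
  · have hv' : v ∈ deckLattice (OX.thetaIn subset_rfl (π y)) :=
      fun w => NCOrbifold.thetaIn_shift _ hv w
    change _ = (PathClass.pow (periodLoop (OX.thetaIn subset_rfl (π y)) hv' w) _).cast he he
    rw [pow_periodLoop, pow_periodLoop, map_periodLoop]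
    exact periodLoop_congr hθ (by rw [← mul_smul, hk]) _ _ _
  · rw [PathCocycle.map_pow, PathCocycle.comap_apply]
    exact hF₀.pow_pointIndex OY.isOpen_trivialPart OY.regPart_subset_trivialPart
      OY.trivialPart_subset_smoothPart hF _ (hℓ.map _ fun u hu => hVn y' hu)

/-- The relations of the orbifold fundamental group of the base are good. -/
theorem normalClosure_le_goodSubgroup [T2Space Y] {F₀ : PathCocycle OY.regPart Γ}
    (hF₀ : OY.KillsMeridians F₀) {F : PathCocycle OY.trivialPart Γ}
    (hF : F.comap (inclMap OY.regPart_subset_trivialPart) = F₀) (x₀ : OX.regPart) :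
    Subgroup.normalClosure {g : FundamentalGroup OX.regPart x₀ |
      ∃ i h, OX.IsMeridian i h ∧ g = h ^ OX.index i} ≤
      h.goodSubgroup (F.comap (inclMap h.starPart_subset_trivialPart)) x₀ := by
  have := h.normal_goodSubgroup (F.comap (inclMap h.starPart_subset_trivialPart)) x₀
  refine Subgroup.normalClosure_le_normal ?_
  rintro _ ⟨i, _, ⟨p, hp, z, hz, x, δ, γ, hγ, rfl⟩, rfl⟩
  by_cases h0 : OX.index i = 0
  · rw [h0, pow_zero]
    exact one_mem _
  -- At a generic point of the component the orbifold index equals `index i`, so the local statement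
  -- applies with exactly the prescribed exponent.
  obtain ⟨p', hp', hN⟩ := NCOrbifold.TurnsAround.exists_conj hz hγ
  obtain ⟨N, hNp, hNm⟩ := h.exists_nhds_isGood hF₀ hF (p := p')
    (OX.mem_posPart_iff.2 (by rw [hp']; exact h0))
  obtain ⟨x', σ, m, hm, he⟩ := hN N hNp
  rw [PathClass.fromPath_pow, Path.Homotopic.Quotient.mk_trans, Path.Homotopic.Quotient.mk_trans,
    Path.Homotopic.Quotient.mk_symm, Path.Homotopic.Quotient.trans_assoc, PathClass.conj_pow]
  refine IsGood.conj _ ?_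
  have h2 : Path.Homotopic.Quotient.mk γ = σ.trans (m.trans σ.symm) := he
  rw [h2, PathClass.conj_pow, ← hp']
  exact IsGood.conj _ (hNm x' m hm)

end IsUnbranchedCover
end

/-! ### Pulling back cocycles from the base to the cover -/

noncomputable section

namespace NCOrbifold

variable {n : ℕ} {X : Type*} [TopologicalSpace X]

theorem exists_path_of_isPathThickIn (O : NCOrbifold n X) {U T : Set X}
    (hT : IsOpen T) (hUT : U ⊆ T)
    (h : IsPathThickIn U T) (x : T) :
    ∃ (a : U), Nonempty (PathClass x (inclMap hUT a)) := by
  obtain ⟨δ, h0, h1, hδ⟩ := O.exists_nbhd_subset (hT.mem_nhds x.2)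
  have h2 : IsPathConnected ((O.chart (x : X)).nbhd δ) := by
    have := O.isPathConnected_map_image (x : X) h1 (S := Set.univ) (by
      rw [Set.inter_univ]
      exact (convex_polyball n δ).isPathConnected ⟨0, zero_mem_polyball h0⟩)
    rwa [Set.inter_univ] at this
  have h3 : IsOpen (Subtype.val ⁻¹' (O.chart (x : X)).nbhd δ : Set T) :=
    ((O.chart (x : X)).isOpen_nbhd h1).preimage continuous_subtype_val
  obtain ⟨a, ha, haU⟩ := (IsPathThick.dense h).inter_open_nonempty _ h3
    ⟨x, show (x : X) ∈ _ from mem_of_mem_nhds (O.map_mem_nhds _ h0 h1)⟩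
  obtain ⟨γ, hγ⟩ := h2.exists_path (mem_of_mem_nhds (O.map_mem_nhds _ h0 h1)) ha
  exact ⟨⟨a, haU⟩, ⟨PathClass.mk (γ.toSubtype (U := T) fun s => hδ (hγ s))⟩⟩

end NCOrbifold

theorem PathClass.cast_symm_trans_conj {T : Type*} [TopologicalSpace T] {a b b' : T}
    (σ : PathClass a b) (ℓ : PathClass b b) (e : b' = b) :
    (σ.cast rfl e).symm.trans ((σ.trans (ℓ.trans σ.symm)).trans (σ.cast rfl e)) = ℓ.cast e e := by
  subst e
  simp only [Path.Homotopic.Quotient.cast_rfl_rfl, Path.Homotopic.Quotient.trans_assoc,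
    PathClass.symm_trans_cancel, Path.Homotopic.Quotient.symm_trans,
    Path.Homotopic.Quotient.trans_refl]

namespace IsUnbranchedCover

variable {n : ℕ} {X Y : Type*} [TopologicalSpace X] [TopologicalSpace Y]
  {OY : NCOrbifold n Y} {OX : NCOrbifold n X} {π : Y → X} (h : IsUnbranchedCover OY OX π)
  {Γ Γ' : Type*} [Group Γ] [Group Γ']

section Lattice

variable {h}

/-- `F` and its translate are lifts of the same map on a connected space, so agreement at one point
suffices. -/
theorem mem_deckLattice_of_eq [T2Space Y] {p : X} {F : C(logBall n 1, h.starPart)}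
    (hF : h.projStar.comp F = OX.theta p) {v : imagVectors n} (hv : v ∈ OX.lattice p)
    {w : logBall n 1} (hw : F (shift v w) = F w) : v ∈ deckLattice F := by
  have : ContractibleSpace (logBall n 1) := convex_logBall.contractibleSpace ⟨w, w.2⟩
  have hFw : ∀ w, h.projStar (F w) = OX.theta p w :=
    fun w => congrArg (fun f : C(logBall n 1, OX.regPart) => f w) hF
  have h1 : (F.comp (shift v) : logBall n 1 → h.starPart) = F :=
    h.isCoveringMap_projStar.eq_of_comp_eq (F.comp (shift v)).continuous F.continuous
      (funext fun x => (hFw _).trans ((NCOrbifold.theta_shift hv x).trans (hFw x).symm)) w hw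
  exact fun w' => congrFun h1 w'

theorem deckLattice_le {p : X} {F : C(logBall n 1, h.starPart)}
    (hF : h.projStar.comp F = OX.theta p) (w : logBall n 1) : deckLattice F ≤ OX.lattice p := by
  intro v hv
  have hFw : ∀ w, h.projStar (F w) = OX.theta p w :=
    fun w => congrArg (fun f : C(logBall n 1, OX.regPart) => f w) hF
  obtain ⟨v', hv', hvv⟩ := NCOrbifold.theta_eq_iff.1
    (show OX.theta p w = OX.theta p (shift v w) by rw [← hFw, ← hFw, hv w])
  have : v = v' := by
    have := congrArg (fun x : logBall n 1 => (x : Fin n → ℂ)) hvv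
    exact Subtype.ext (add_left_cancel this)
  exact this ▸ hv'

variable {FX : PathCocycle OX.regPart Γ} (hFX : OX.KillsMeridians FX)
  {S : PathCocycle h.starPart Γ'}
  (hS : ∀ (x : OX.regPart) (q : PathClass x x), FX q = 1 → h.IsGood S q)

include hFX hS

/-- The periods in `merLattice` are killed by `FX`, so by `hS` their lifts are closed. -/
theorem merLattice_le_deckLattice [T2Space Y] {p : X} {F : C(logBall n 1, h.starPart)}
    (hF : h.projStar.comp F = OX.theta p) (w : logBall n 1) : OX.merLattice p ≤ deckLattice F := by
  intro v hv
  have hFw : ∀ w, h.projStar (F w) = OX.theta p w :=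
    fun w => congrArg (fun f : C(logBall n 1, OX.regPart) => f w) hF
  have hvl := OX.merLattice_le p hv
  refine mem_deckLattice_of_eq hF hvl (w := w) ?_
  obtain ⟨β, hβ, -⟩ := hS (OX.theta p w) (((seg w (shift v w)).map (OX.theta p)).cast rfl
    (NCOrbifold.theta_shift hvl w).symm) (by
      rw [FX.map_cast]; exact hFX.eq_one p hv w) (F w) (hFw w)
  refine h.isCoveringMap_projStar.eq_of_map_eq ((seg w (shift v w)).map F) β
    ((hFw _).trans ((NCOrbifold.theta_shift hvl w).trans (hFw w).symm)) ?_
  rw [hβ, PathClass.map_map, PathClass.map_congr hF, Path.Homotopic.Quotient.cast_cast,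
    Path.Homotopic.Quotient.cast_cast]

/-- Multiplicativity of indices in `merLattice ≤ deckLattice ≤ lattice`. The total index is ν(π y),
which is ν(y) times the upper index; that index can be cancelled because ν(π y) ≠ 0 in the positive
part. -/
theorem relIndex_merLattice_deckLattice [T2Space Y] {y : Y} {V : Set Y} {ε : ℝ}
    (hV : h.IsSheet y V ε) {F : C(logBall n 1, h.starPart)}
    (hF : h.projStar.comp F = OX.theta (π y)) {w : logBall n 1}
    (hw : (w : Fin n → ℂ) ∈ logBall n ε) (hwV : (F w : Y) ∈ V) :
    (OX.merLattice (π y)).relIndex (deckLattice F) = OY.pointIndex y := by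
  have hp : π y ∈ OX.posPart := h.mapsTo (hV.subset hV.mem)
  have h1 := AddSubgroup.relIndex_mul_relIndex (OX.merLattice (π y)) (deckLattice F)
    (OX.lattice (π y)) (merLattice_le_deckLattice hFX hS hF w) (deckLattice_le hF w)
  have h2 := hV.relIndex_deckLattice hF hw hwV
  rw [OX.relIndex_merLattice hp, ← h2] at h1
  refine mul_right_cancel₀ (fun h0 => OX.mem_posPart_iff.1 hp ?_) h1
  rw [← h2, h0, mul_zero]

/-- Loops near `y` are killed downstairs by the power `pointIndex y`. -/
theorem map_proj_pow_pointIndex [T2Space Y] {y : Y} {V : Set Y} {ε : ℝ}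
    (hV : h.IsSheet y V ε) {a : h.commonPart} (q : PathClass a a)
    (hq : q.InSet (Subtype.val ⁻¹' V)) : FX (q.map h.proj) ^ OY.pointIndex y = 1 := by
  obtain ⟨w, σ, v, hv, hw, hσ, hqσ⟩ := NCOrbifold.exists_loop_eq OX.isOpen_regPart subset_rfl
    OX.regPart_subset_smoothPart hV.le_one (p := π y) (q.map h.proj)
    (hq.map h.proj fun u hu => hV.mapsTo _ hu)
  let a' : h.starPart := inclMap h.commonPart_subset_starPart a
  obtain ⟨e, he, β, hβ⟩ := h.isCoveringMap_projStar.exists_lift (e := a') σ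
  have heV : (e : Y) ∈ V := by
    refine (hV.inSet (a := a') (β := β) hq.left ?_).right
    rw [hβ]
    exact hσ.cast _ _
  obtain ⟨θ', rfl, hθ⟩ := h.isCoveringMap_projStar.exists_lift_logBall (OX.theta (π y)) w e he
  have hθw : ∀ w, h.projStar (θ' w) = OX.theta (π y) w :=
    fun w => congrArg (fun f : C(logBall n 1, OX.regPart) => f w) hθ
  let q' : PathClass a' a' := q.map (inclMap h.commonPart_subset_starPart)
  have hq' : q'.map h.projStar = q.map h.proj := PathClass.map_map _ _ _
  -- The loop `q` is itself a closed lift of its projection, so the translation describing the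
  -- projection preserves `θ'`.
  have hvd : v ∈ deckLattice θ' := by
    refine mem_deckLattice_of_eq hθ hv (w := w) ?_
    refine h.isCoveringMap_projStar.eq_of_map_eq ((seg w (shift v w)).map θ')
      (β.symm.trans (q'.trans β))
      ((hθw _).trans ((NCOrbifold.theta_shift hv w).trans (hθw w).symm)) ?_
    rw [PathClass.map_trans, PathClass.map_trans, PathClass.map_symm, hβ, hq', hqσ,
      PathClass.map_map, PathClass.map_congr hθ]
    refine Eq.trans ?_ (congrArg (fun p => Path.Homotopic.Quotient.cast p rfl _)
      (PathClass.cast_symm_trans_conj σ _ he).symm)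
    simp only [Path.Homotopic.Quotient.cast_cast]
    rfl
  have hmer : OY.pointIndex y • v ∈ OX.merLattice (π y) := by
    rw [← relIndex_merLattice_deckLattice hFX hS hV hθ hw heV]
    exact AddSubgroup.nsmul_relIndex_mem _ hvd
  have hv' : v ∈ deckLattice (OX.thetaIn subset_rfl (π y)) :=
    fun w => NCOrbifold.thetaIn_shift _ hv w
  rw [hqσ, PathCocycle.conj_pow_eq_one_iff]
  change FX (periodLoop (OX.thetaIn subset_rfl (π y)) hv' w) ^ _ = 1
  rw [← PathCocycle.map_pow, pow_periodLoop, periodLoop, FX.map_cast]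
  exact hFX.eq_one (π y) hmer w

end Lattice

/-- The preimage of the regular part contains the nonvanishing locus of the pull-back of an
invariant coordinate function, which is holomorphic and, π being open, not identically zero. -/
theorem isPathThickIn_preimage (h : IsUnbranchedCover OY OX π) {T : Set Y} (hT : IsOpen T) (hTs : T ⊆ OY.regPart) :
    IsPathThickIn (T ∩ π ⁻¹' OX.regPart) T := by
  have hTp : T ⊆ OY.posPart := hTs.trans OY.regPart_subset_posPart
  refine OY.isPathThickIn hT (hTs.trans OY.regPart_subset_smoothPart)
    ((h.continuousOn.mono hTp).isOpen_inter_preimage hT OX.isOpen_regPart) fun y hy => ?_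
  have hN : T ∩ (OY.posPart ∩ π ⁻¹' (OX.chart (π y)).nbhd 1) ∈ 𝓝 y :=
    (hT.inter (h.isOpen_inter_preimage ((OX.chart (π y)).isOpen_nbhd le_rfl))).mem_nhds
      ⟨hy, hTp hy, show π y ∈ _ from mem_of_mem_nhds (OX.map_mem_nhds (π y) one_pos le_rfl)⟩
  obtain ⟨ε, h0, h1, hε⟩ := OY.exists_nbhd_subset hN
  have hε' : ∀ z ∈ polyball n ε, (OY.chart y).map z ∈
      T ∩ (OY.posPart ∩ π ⁻¹' (OX.chart (π y)).nbhd 1) := fun z hz => hε ⟨z, hz, rfl⟩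
  obtain ⟨g, hg, hgt⟩ := OX.exists_coordFunction (π y)
  have hiff : ∀ z ∈ polyball n ε, g (π ((OY.chart y).map z)) ≠ 0 ↔
      π ((OY.chart y).map z) ∈ OX.torusNbhd (π y) 1 := fun z hz =>
    OX.mem_torusNbhd_of_ne_zero hgt le_rfl (hε' z hz).2.2
  refine ⟨ε, h0, h1, fun z => g (π ((OY.chart y).map z)), ?_, ?_, ?_⟩
  · refine (h.holomorphic _ g ((OX.chart (π y)).isOpen_nbhd le_rfl) hg y).mono fun z hz => ?_
    exact ⟨polyball_subset_polydisc h1 hz, (hε' z hz).2⟩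
  · obtain ⟨_, ⟨_, ⟨z, hz, rfl⟩, rfl⟩, hx⟩ := OX.exists_mem_torusNbhd (q := π y) le_rfl
      (h.isOpen_image ((OY.chart y).isOpen_nbhd h1) fun u hu => (hε hu).2.1)
      ⟨π y, ⟨y, mem_of_mem_nhds (OY.map_mem_nhds y h0 h1), rfl⟩,
        mem_of_mem_nhds (OX.map_mem_nhds (π y) one_pos le_rfl)⟩
    exact ⟨z, hz, (hiff z hz).2 hx⟩
  · exact fun z hz hgz => ⟨(hε' z hz).1,
      OX.torusNbhd_subset_regPart (π y) le_rfl ((hiff z hz).1 hgz)⟩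

theorem commonPart_subset_regPart : h.commonPart ⊆ OY.regPart := fun _ hy => hy.1

theorem isPathThickIn_commonPart : IsPathThickIn h.commonPart OY.regPart :=
  h.isPathThickIn_preimage OY.isOpen_regPart subset_rfl

/-- A cocycle on the regular part of the base pulls back to the regular part of the cover. -/
theorem exists_pullback [T2Space Y] {FX : PathCocycle OX.regPart Γ} (hFX : OX.KillsMeridians FX)
    {S : PathCocycle h.starPart Γ'}
    (hS : ∀ (x : OX.regPart) (q : PathClass x x), FX q = 1 → h.IsGood S q) :
    ∃ F : PathCocycle OY.regPart Γ, OY.KillsMeridians F ∧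
      F.comap (inclMap h.commonPart_subset_regPart) = FX.comap h.proj := by
  obtain ⟨F, hF⟩ := PathCocycle.exists_extend_inclusion h.isPathThickIn_commonPart
    h.commonPart_subset_regPart (FX.comap h.proj) fun y hy => by
      obtain ⟨V, ε, hV, -⟩ := h.exists_isSheet (OY.regPart_subset_posPart hy) Filter.univ_mem
      refine ⟨V, hV.isOpen.mem_nhds hV.mem, fun a p hp => ?_⟩
      -- The orbifold index at a regular point of `Y` is `1`, so the pulled back cocycle is trivial
      -- on nearby loops and extends over the thin complement of `commonPart`.
      have := map_proj_pow_pointIndex hFX hS hV p hp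
      rwa [OY.mem_trivialPart_iff.1 (OY.regPart_subset_trivialPart hy), pow_one] at this
  refine ⟨F, ?_, hF⟩
  intro i p hp z hz x γ hγ
  by_cases h0 : OY.index i = 0
  · rw [h0, pow_zero]
  obtain ⟨y, hy, hN⟩ := hγ.exists_conj hz
  obtain ⟨V, ε, hV, -⟩ := h.exists_isSheet (y := y)
    (OY.mem_posPart_iff.2 (by rw [hy]; exact h0)) Filter.univ_mem
  obtain ⟨x', σ, m, hm, he⟩ := hN V (hV.isOpen.mem_nhds hV.mem)
  rw [he, PathCocycle.conj_pow_eq_one_iff]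
  -- The loop `m` may leave `commonPart`. It is deformed into it inside the regular part of the
  -- sheet, since the local statement needs a loop that remains in `V`.
  set T := OY.regPart ∩ V
  have hT : IsOpen T := OY.isOpen_regPart.inter hV.isOpen
  have hTr : T ⊆ OY.regPart := Set.inter_subset_left
  have hthick := h.isPathThickIn_preimage hT hTr
  have hUT : T ∩ π ⁻¹' OX.regPart ⊆ T := Set.inter_subset_left
  have hUc : T ∩ π ⁻¹' OX.regPart ⊆ h.commonPart := fun u hu => ⟨hu.1.1, hu.2⟩
  obtain ⟨m', hm'⟩ := hm.exists_inclusion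
  obtain ⟨a, ⟨τ⟩⟩ := NCOrbifold.exists_path_of_isPathThickIn OY hT hUT hthick
    ⟨x', x'.2, hm.left⟩
  obtain ⟨q, hq⟩ := hthick.exists_map_eq hUT (τ.symm.trans (m'.trans τ))
  have h1 := map_proj_pow_pointIndex hFX hS hV (q.map (inclMap hUc)) (by
    induction q using Path.Homotopic.Quotient.ind with | mk δ =>
    exact ⟨δ.map (inclMap hUc).continuous, fun s => (δ s).2.1.2, rfl⟩)
  have h2 : FX ((q.map (inclMap hUc)).map h.proj) =
      F ((τ.symm.trans (m'.trans τ)).map (inclMap hTr)) := by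
    rw [← PathCocycle.comap_apply, ← hF, PathCocycle.comap_apply, PathClass.map_map, ← hq,
      PathClass.map_map]
    rfl
  rw [h2, ← PathCocycle.comap_apply, hy] at h1
  have h3 := (PathCocycle.conj_pow_eq_one_iff (F.comap (inclMap hTr)) τ.symm m' (OY.index i)).1
    (by rwa [PathClass.symm_symm])
  rw [← hm']
  exact h3

end IsUnbranchedCover
end

/-! ### Comparison of the two orbifold fundamental groups -/

noncomputable section

namespace NCOrbifold

variable {n : ℕ} {X : Type*} [TopologicalSpace X] (O : NCOrbifold n X)

/-- The universal cocycle with values in the orbifold fundamental group. -/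
theorem exists_orbCocycle [PathConnectedSpace O.regPart] (x₀ : O.regPart) :
    ∃ F : PathCocycle O.regPart (O.orbGroup x₀), O.KillsMeridians F ∧
      F.toHom x₀ = QuotientGroup.mk' _ := by
  obtain ⟨F, hF⟩ := PathCocycle.exists_toHom_eq x₀ (QuotientGroup.mk' (Subgroup.normalClosure
    {g : FundamentalGroup O.regPart x₀ | ∃ i h, O.IsMeridian i h ∧ g = h ^ O.index i}))
  refine ⟨F, (killsMeridians_iff x₀ F).2 fun i g hg => ?_, hF⟩
  rw [hF, ← map_pow]
  exact (QuotientGroup.eq_one_iff _).2 (Subgroup.subset_normalClosure ⟨i, g, hg, rfl⟩)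

variable {O} in
theorem KillsMeridians.normalClosure_le_ker [PathConnectedSpace O.regPart] {Γ : Type*} [Group Γ]
    {F : PathCocycle O.regPart Γ} (hF : O.KillsMeridians F) (x₀ : O.regPart) :
    Subgroup.normalClosure {g : FundamentalGroup O.regPart x₀ |
      ∃ i h, O.IsMeridian i h ∧ g = h ^ O.index i} ≤ (F.toHom x₀).ker := by
  refine Subgroup.normalClosure_le_normal ?_
  rintro _ ⟨i, g, hg, rfl⟩
  change F.toHom x₀ (g ^ _) = 1
  rw [map_pow]
  exact (killsMeridians_iff x₀ F).1 hF i g hg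

variable {O} in
-- Loops near a point are killed by its orbifold index, which is `1` on `trivialPart`. The extension
-- is needed because the covering space `starPart` may contain divisor points of index `1`.
theorem KillsMeridians.exists_extend {Γ : Type*} [Group Γ]
    {F : PathCocycle O.regPart Γ} (hF : O.KillsMeridians F) :
    ∃ F' : PathCocycle O.trivialPart Γ, F'.comap (inclMap O.regPart_subset_trivialPart) = F := by
  refine PathCocycle.exists_extend_inclusion
    (O.isPathThickIn_regPart O.isOpen_trivialPart O.trivialPart_subset_smoothPart) _ F ?_
  intro t ht
  refine ⟨(O.chart t).nbhd 1, O.map_mem_nhds t one_pos le_rfl, fun a p hp => ?_⟩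
  have hid : F.comap (inclMap subset_rfl) = F := by
    cases F with | mk F hFt =>
    rw [PathCocycle.comap, PathCocycle.mk.injEq]
    funext a b p
    induction p using Path.Homotopic.Quotient.ind with | mk γ => rfl
  have := hF.pow_pointIndex O.isOpen_regPart subset_rfl O.regPart_subset_smoothPart hid p hp
  rwa [O.mem_trivialPart_iff.1 ht, pow_one] at this

end NCOrbifold

namespace IsUnbranchedCover

variable {n : ℕ} {X Y : Type*} [TopologicalSpace X] [TopologicalSpace Y]
  {OY : NCOrbifold n Y} {OX : NCOrbifold n X} {π : Y → X} (h : IsUnbranchedCover OY OX π)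

/-- The map from the fundamental group of the common part to the orbifold fundamental group of the
cover. -/
def toOrbCover (y₀ : h.commonPart) :
    FundamentalGroup h.commonPart y₀ →* OY.orbGroup (h.inc y₀) :=
  (QuotientGroup.mk' _).comp (FundamentalGroup.map (inclMap h.commonPart_subset_regPart) y₀)

/-- `commonPart` is thick in the regular part, so every loop there can be deformed into it. -/
theorem toOrbCover_surjective (y₀ : h.commonPart) : Function.Surjective (h.toOrbCover y₀) := by
  intro g
  obtain ⟨g, rfl⟩ := QuotientGroup.mk'_surjective _ g
  obtain ⟨q, hq⟩ := h.isPathThickIn_commonPart.exists_map_eq h.commonPart_subset_regPart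
    (a := y₀) (b := y₀) g
  exact ⟨q, congrArg (QuotientGroup.mk' _) hq⟩

/-- The map from the fundamental group of the common part to the orbifold fundamental group of the
base. -/
def toOrbBase (y₀ : h.commonPart) :
    FundamentalGroup h.commonPart y₀ →* OX.orbGroup (h.proj y₀) :=
  (QuotientGroup.mk' _).comp (FundamentalGroup.map h.proj y₀)

variable [T2Space Y] [PathConnectedSpace OX.regPart] [PathConnectedSpace OY.regPart]

omit [PathConnectedSpace OX.regPart] in
-- The projection of the loop lies in the normal closure of the relations of the base, so all its
-- lifts are closed and killed by the universal cocycle of `Y`. The loop is, up to homotopy, the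
-- lift from its own starting point.
theorem ker_toOrbBase_le (y₀ : h.commonPart) : (h.toOrbBase y₀).ker ≤ (h.toOrbCover y₀).ker := by
  intro q hq
  obtain ⟨F₀, hF₀, hF₀Y⟩ := OY.exists_orbCocycle (h.inc y₀)
  obtain ⟨F, hF⟩ := hF₀.exists_extend
  have h1 := h.normalClosure_le_goodSubgroup hF₀ hF (h.proj y₀)
    ((QuotientGroup.eq_one_iff _).1 (MonoidHom.mem_ker.1 hq))
  obtain ⟨β, hβ, hFβ⟩ := h1 (inclMap h.commonPart_subset_starPart y₀) rfl
  let q' : PathClass y₀ y₀ := q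
  have hβ' : β.map h.projStar = q'.map h.proj :=
    hβ.trans (Path.Homotopic.Quotient.cast_rfl_rfl (q'.map h.proj))
  have h2 : β = q'.map (inclMap h.commonPart_subset_starPart) := by
    refine h.isCoveringMap_projStar.injective_path_homotopic_map _ _ (hβ'.trans ?_)
    exact (PathClass.map_map (inclMap h.commonPart_subset_starPart) h.projStar q').symm
  rw [h2, PathCocycle.comap_apply, PathClass.map_map] at hFβ
  have h3 : F₀ (q'.map (inclMap h.commonPart_subset_regPart)) = 1 := by
    rw [← hF, PathCocycle.comap_apply, PathClass.map_map]
    exact hFβ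
  rw [MonoidHom.mem_ker]
  refine Eq.trans ?_ h3
  exact (congrArg (fun f : FundamentalGroup OY.regPart (h.inc y₀) →* OY.orbGroup (h.inc y₀) =>
    f (FundamentalGroup.map (inclMap h.commonPart_subset_regPart) y₀ q)) hF₀Y).symm

/-- The pull-back of the universal cocycle of `X` extends to the regular part of `Y` and kills the
prescribed powers of meridians there. It is therefore trivial on every loop that is trivial in the
orbifold group of `Y`. -/
theorem ker_toOrbCover_le (y₀ : h.commonPart) : (h.toOrbCover y₀).ker ≤ (h.toOrbBase y₀).ker := by
  intro q hq
  obtain ⟨FX, hFX, hFXx⟩ := OX.exists_orbCocycle (h.proj y₀)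
  -- With values in the trivial group, goodness of a loop only says that its lifts are closed, and
  -- this is all that the pull-back requires.
  let F₀ : PathCocycle OY.regPart Unit := ⟨fun _ => 1, fun _ _ => rfl⟩
  have hF₀ : OY.KillsMeridians F₀ := fun _ _ _ _ _ _ _ _ => rfl
  obtain ⟨F₁, hF₁⟩ := hF₀.exists_extend
  have hS : ∀ (x : OX.regPart) (p : PathClass x x), FX p = 1 →
      h.IsGood (F₁.comap (inclMap h.starPart_subset_trivialPart)) p := by
    intro x p hp
    let σ : PathClass (h.proj y₀) x := PathClass.mk (PathConnectedSpace.somePath _ _)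
    have h1 : FX (σ.trans (p.trans σ.symm)) = 1 := by
      rw [FX.map_trans, FX.map_trans, hp, FX.map_symm, mul_one, inv_mul_cancel]
    have h2 : QuotientGroup.mk' (Subgroup.normalClosure {g : FundamentalGroup OX.regPart
        (h.proj y₀) | ∃ i h, OX.IsMeridian i h ∧ g = h ^ OX.index i})
        (FundamentalGroup.fromPath (σ.trans (p.trans σ.symm))) = 1 := by
      rw [← hFXx]
      exact h1
    have h3 : h.IsGood _ (σ.trans (p.trans σ.symm)) :=
      h.normalClosure_le_goodSubgroup hF₀ hF₁ (h.proj y₀) ((QuotientGroup.eq_one_iff _).1 h2)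
    have h4 := IsGood.conj σ.symm h3
    simpa using h4
  obtain ⟨F, hFk, hF⟩ := h.exists_pullback hFX hS
  let q' : PathClass y₀ y₀ := q
  have h1 : F.toHom (h.inc y₀) (FundamentalGroup.map (inclMap h.commonPart_subset_regPart) y₀ q)
      = 1 :=
    hFk.normalClosure_le_ker (h.inc y₀) ((QuotientGroup.eq_one_iff _).1 (MonoidHom.mem_ker.1 hq))
  have h2 : FX (q'.map h.proj) = 1 := by
    rw [← PathCocycle.comap_apply, ← hF]
    exact h1
  rw [MonoidHom.mem_ker]
  refine Eq.trans ?_ h2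
  exact (congrArg (fun f : FundamentalGroup OX.regPart (h.proj y₀) →* OX.orbGroup (h.proj y₀) =>
    f (FundamentalGroup.map h.proj y₀ q)) hFXx).symm

/-- The orbifold fundamental group of the cover is a subgroup of that of the base. -/
theorem nonempty_mulEquiv_imageGroup (y₀ : h.commonPart) :
    Nonempty (OY.orbGroup (h.inc y₀) ≃* h.imageGroup y₀) := by
  have hker : (h.toOrbCover y₀).ker = (h.toOrbBase y₀).ker :=
    le_antisymm (h.ker_toOrbCover_le y₀) (h.ker_toOrbBase_le y₀)
  exact ⟨((QuotientGroup.quotientKerEquivOfSurjective _ (h.toOrbCover_surjective y₀)).symm.trans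
    (QuotientGroup.quotientMulEquivOfEq hker)).trans
      (QuotientGroup.quotientKerEquivRange (h.toOrbBase y₀))⟩

end IsUnbranchedCover
end

/-! ### Homomorphisms to the complex numbers and the first Betti number -/

noncomputable section

open scoped Classical in
/-- The extension of a function on a subgroup by zero. -/
def Subgroup.extendZero {G : Type*} [Group G] (N : Subgroup G) (f : N → ℂ) (x : G) : ℂ :=
  if h : x ∈ N then f ⟨x, h⟩ else 0

theorem Subgroup.extendZero_of_mem {G : Type*} [Group G] (N : Subgroup G) (f : N → ℂ) {x : G}
    (h : x ∈ N) : N.extendZero f x = f ⟨x, h⟩ := dif_pos h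

/-- The homomorphisms from a group to the complex numbers. -/
def homSpace (G : Type*) [Group G] : Submodule ℂ (G → ℂ) where
  carrier := {f | ∀ x y, f (x * y) = f x + f y}
  add_mem' := by
    intro f g hf hg x y
    simp only [Pi.add_apply, hf x y, hg x y]
    ring
  zero_mem' := by simp
  smul_mem' := by
    intro c f hf x y
    simp only [Pi.smul_apply, hf x y, smul_add]

section HomSpace

variable {G : Type*} [Group G]

/-- A homomorphism to the complex numbers, as a multiplicative homomorphism. -/
def homSpace.toMonoidHom (f : homSpace G) : G →* Multiplicative ℂ :=
  MonoidHom.mk' (fun g => Multiplicative.ofAdd (f.1 g)) fun x y =>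
    congrArg Multiplicative.ofAdd (f.2 x y)

theorem homSpace.map_inv (f : homSpace G) (g : G) : f.1 g⁻¹ = -f.1 g :=
  congrArg Multiplicative.toAdd (_root_.map_inv (homSpace.toMonoidHom f) g)

theorem homSpace.map_pow (f : homSpace G) (g : G) (n : ℕ) : f.1 (g ^ n) = n * f.1 g := by
  have := congrArg Multiplicative.toAdd (_root_.map_pow (homSpace.toMonoidHom f) g n)
  rw [toAdd_pow, nsmul_eq_mul] at this
  exact this

variable (G) in
-- Additive homomorphisms to ℂ factor through the abelianization modulo torsion, which is free of
-- rank `groupBetti G`; a homomorphism is given by its values on a basis.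
theorem exists_homSpace_equiv [Group.FG G] :
    Nonempty ((Fin (groupBetti G) → ℂ) ≃ₗ[ℂ] homSpace G) := by
  set A := Additive (Abelianization G)
  have hG : Group.FG (Abelianization G) :=
    QuotientGroup.fg (commutator G)
  have hA : Module.Finite ℤ A := Module.Finite.iff_addGroup_fg.2
    (AddGroup.fg_iff_mul_fg.2 hG)
  set T := Submodule.torsion ℤ A
  have hr : Module.finrank ℤ (A ⧸ T) = groupBetti G :=
    congrArg Cardinal.toNat (rank_quotient_eq_of_le_torsion le_rfl)
  let b : Module.Basis (Fin (groupBetti G)) ℤ (A ⧸ T) := Module.finBasisOfFinrankEq ℤ (A ⧸ T) hr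
  let q (g : G) : A ⧸ T := T.mkQ (Additive.ofMul (Abelianization.of g))
  have hq : ∀ x y, q (x * y) = q x + q y := fun x y => by
    simp only [q, _root_.map_mul, ofMul_mul, map_add]
  have hqs : Function.Surjective q := by
    intro a
    obtain ⟨a, rfl⟩ := T.mkQ_surjective a
    obtain ⟨g, hg⟩ := QuotientGroup.mk_surjective (s := commutator G) a.toMul
    exact ⟨g, congrArg (fun a => T.mkQ (Additive.ofMul a)) hg⟩
  let Φ : (Fin (groupBetti G) → ℂ) →ₗ[ℂ] homSpace G :=
    { toFun := fun v => ⟨fun g => b.constr ℂ v (q g), fun x y => by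
        simp only [hq, map_add]⟩
      map_add' := fun v w => Subtype.ext (funext fun g => by simp)
      map_smul' := fun c v => Subtype.ext (funext fun g => by simp) }
  refine ⟨LinearEquiv.ofBijective Φ ⟨?_, ?_⟩⟩
  · intro v w hvw
    refine (b.constr ℂ).injective (LinearMap.ext fun a => ?_)
    obtain ⟨g, rfl⟩ := hqs a
    exact congrFun (congrArg Subtype.val hvw) g
  · intro f
    let φ : A →+ ℂ := AddMonoidHom.mk' (fun a => (Abelianization.lift (homSpace.toMonoidHom f) a.toMul).toAdd)
      fun x y => by
        change ((Abelianization.lift (homSpace.toMonoidHom f)) (x.toMul * y.toMul)).toAdd = _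
        rw [_root_.map_mul, toAdd_mul]
    have hφ : T ≤ LinearMap.ker φ.toIntLinearMap := by
      rintro a ⟨⟨m, hm⟩, hma⟩
      have h1 : φ.toIntLinearMap (m • a) = 0 := by
        have : m • a = 0 := hma
        rw [this, map_zero]
      rw [map_smul] at h1
      exact (smul_eq_zero.1 h1).resolve_left (nonZeroDivisors.ne_zero hm)
    refine ⟨(b.constr ℂ).symm (T.liftQ _ hφ), Subtype.ext (funext fun g => ?_)⟩
    change b.constr ℂ ((b.constr ℂ).symm (T.liftQ _ hφ)) (q g) = _
    rw [LinearEquiv.apply_symm_apply]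
    rfl

theorem finrank_homSpace [Group.FG G] : Module.finrank ℂ (homSpace G) = groupBetti G := by
  obtain ⟨e⟩ := exists_homSpace_equiv G
  rw [← e.finrank_eq, Module.finrank_fin_fun]

instance finite_homSpace [Group.FG G] : Module.Finite ℂ (homSpace G) :=
  Module.Finite.equiv (exists_homSpace_equiv G).some

/-- The homomorphisms from a normal subgroup to the complex numbers on which conjugation acts by a
given function. -/
def eqHomSpace (N : Subgroup G) [N.Normal] (χ : G → ℂ) : Submodule ℂ (N → ℂ) where
  carrier := {f | (∀ x y, f (x * y) = f x + f y) ∧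
    ∀ g x, f (MulAut.conjNormal g x) = χ g * f x}
  add_mem' := by
    rintro f g ⟨hf, hf'⟩ ⟨hg, hg'⟩
    refine ⟨fun x y => ?_, fun a x => ?_⟩
    · simp only [Pi.add_apply, hf x y, hg x y]; ring
    · simp only [Pi.add_apply, hf' a x, hg' a x]; ring
  zero_mem' := by simp
  smul_mem' := by
    rintro c f ⟨hf, hf'⟩
    refine ⟨fun x y => ?_, fun a x => ?_⟩
    · simp only [Pi.smul_apply, hf x y, smul_add]
    · simp only [Pi.smul_apply, hf' a x, smul_eq_mul]; ring

variable {N : Subgroup G} [N.Normal]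

/-- A homomorphism of an `eqHomSpace`. -/
def eqHomSpace.toHom {χ : G → ℂ} (f : eqHomSpace N χ) : homSpace N := ⟨f.1, f.2.1⟩

theorem eqHomSpace.conj {χ : G → ℂ} (f : eqHomSpace N χ) (g : G) {x : G} (hx : x ∈ N) :
    N.extendZero f.1 (g * x * g⁻¹) = χ g * N.extendZero f.1 x := by
  rw [N.extendZero_of_mem _ hx, N.extendZero_of_mem _ (Subgroup.Normal.conj_mem ‹_› x hx g)]
  exact f.2.2 g ⟨x, hx⟩

omit [N.Normal] in
theorem homSpace.extendZero_mul (f : homSpace N) {x y : G} (hx : x ∈ N) (hy : y ∈ N) :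
    N.extendZero f.1 (x * y) = N.extendZero f.1 x + N.extendZero f.1 y := by
  rw [N.extendZero_of_mem _ hx, N.extendZero_of_mem _ hy, N.extendZero_of_mem _ (mul_mem hx hy)]
  exact f.2 ⟨x, hx⟩ ⟨y, hy⟩

omit [N.Normal] in
theorem homSpace.extendZero_inv (f : homSpace N) {x : G} (hx : x ∈ N) :
    N.extendZero f.1 x⁻¹ = -N.extendZero f.1 x := by
  rw [N.extendZero_of_mem _ hx, N.extendZero_of_mem _ (inv_mem hx)]
  exact homSpace.map_inv f ⟨x, hx⟩

/-- Invariant homomorphisms on a normal subgroup of finite index extend uniquely. -/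
theorem finrank_eqHomSpace_one [N.FiniteIndex] :
    Module.finrank ℂ (eqHomSpace N fun _ => 1) = Module.finrank ℂ (homSpace G) := by
  let Φ : homSpace G →ₗ[ℂ] eqHomSpace N fun _ => 1 :=
    { toFun := fun f => ⟨fun x => f.1 x, fun x y => f.2 x y, fun g x => by
        simp only [MulAut.conjNormal_apply]
        rw [f.2, f.2, homSpace.map_inv f]; ring⟩
      map_add' := fun f g => rfl
      map_smul' := fun c f => rfl }
  refine (LinearEquiv.ofBijective Φ ⟨?_, ?_⟩).finrank_eq.symm
  · rw [injective_iff_map_eq_zero]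
    intro f hf
    refine Subtype.ext (funext fun g => ?_)
    have h1 : f.1 (g ^ N.index) = 0 :=
      congrFun (congrArg Subtype.val hf) ⟨_, Subgroup.pow_index_mem N g⟩
    rw [homSpace.map_pow f] at h1
    exact (mul_eq_zero.1 h1).resolve_left (Nat.cast_ne_zero.2 Subgroup.FiniteIndex.index_ne_zero)
  · intro f
    -- The extension is the transfer divided by the index: by invariance under conjugation, the
    -- transfer multiplies values on `N` by the index.
    let φ := MonoidHom.transfer (homSpace.toMonoidHom (eqHomSpace.toHom f))
    refine ⟨⟨fun g => (N.index : ℂ)⁻¹ * (φ g).toAdd, fun x y => by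
      simp only [_root_.map_mul, toAdd_mul, mul_add]⟩, Subtype.ext (funext fun x => ?_)⟩
    have h1 : φ (x : G) = (homSpace.toMonoidHom (eqHomSpace.toHom f)) x ^ N.index := by
      let T : N.LeftTransversal := default
      rw [MonoidHom.transfer_def _ T, Subgroup.leftTransversals.diff]
      have h2 : ∀ q : G ⧸ N, ((x : G)⁻¹ • q) = q := by
        intro q
        obtain ⟨g, rfl⟩ := QuotientGroup.mk_surjective q
        refine (QuotientGroup.eq.2 ?_).symm
        have := Subgroup.Normal.conj_mem ‹N.Normal› _ (inv_mem x.2) g⁻¹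
        simpa [mul_assoc] using this
      have h3 : ∀ q : G ⧸ N, ∀ h, (homSpace.toMonoidHom (eqHomSpace.toHom f))
          ⟨((T.2.leftQuotientEquiv q : G))⁻¹ * (((x : G) • T).2.leftQuotientEquiv q : G), h⟩ =
          (homSpace.toMonoidHom (eqHomSpace.toHom f)) x := by
        intro q h
        have h4 : (⟨_, h⟩ : N) =
            MulAut.conjNormal ((T.2.leftQuotientEquiv q : G))⁻¹ x := by
          refine Subtype.ext ?_
          rw [MulAut.conjNormal_apply]
          change _ * (((x : G) • T).2.leftQuotientEquiv q : G) = _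
          rw [Subgroup.smul_apply_eq_smul_apply_inv_smul, h2]
          simp [mul_assoc]
        rw [h4]
        exact congrArg Multiplicative.ofAdd ((f.2.2 _ x).trans (one_mul _))
      let _ := N.fintypeQuotientOfFiniteIndex
      refine (Finset.prod_congr rfl fun q _ => h3 q _).trans ?_
      rw [Finset.prod_const, Finset.card_univ, ← Nat.card_eq_fintype_card, Subgroup.index]
    change (N.index : ℂ)⁻¹ * (φ (x : G)).toAdd = f.1 x
    rw [h1, toAdd_pow, nsmul_eq_mul, ← mul_assoc, inv_mul_cancel₀
      (Nat.cast_ne_zero.2 Subgroup.FiniteIndex.index_ne_zero), one_mul]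
    rfl

end HomSpace
end

/-! ### Isotypic decomposition under the finite abelian quotient -/

noncomputable section

section Isotypic

variable {Q V : Type*} [CommGroup Q] [Finite Q] [AddCommGroup V] [Module ℂ V]
  (ρ : Q →* Module.End ℂ V)

instance finite_characters : Finite (Q →* ℂˣ) :=
  Finite.of_equiv Q (CommGroup.monoidHom_mulEquiv_of_hasEnoughRootsOfUnity Q ℂ).some.symm.toEquiv

omit [Finite Q] in
/-- The vectors on which a commutative group acts by a character. -/
def isotypic (ξ : Q →* ℂˣ) : Submodule ℂ V where
  carrier := {v | ∀ q, ρ q v = (ξ q : ℂ) • v}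
  add_mem' := fun hv hw q => by rw [map_add, hv q, hw q, smul_add]
  zero_mem' := by simp
  smul_mem' := fun c v hv q => by rw [map_smul, hv q, smul_comm]

omit [Finite Q] in
theorem sum_character [Fintype Q] (ξ : Q →* ℂˣ) [Decidable (ξ = 1)] :
    ∑ q, (ξ q : ℂ) = if ξ = 1 then (Nat.card Q : ℂ) else 0 := by
  classical
  have h := sum_hom_units ((Units.coeHom ℂ).comp ξ)
  have h1 : (Units.coeHom ℂ).comp ξ = 1 ↔ ξ = 1 := by
    constructor
    · intro h; ext q; exact DFunLike.congr_fun h q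
    · rintro rfl; rfl
  simp only [h1] at h
  rw [Nat.card_eq_fintype_card]
  refine h.trans ?_
  push_cast
  rfl

theorem sum_character_apply [Fintype (Q →* ℂˣ)] (q : Q) [Decidable (q = 1)] :
    ∑ ξ : Q →* ℂˣ, (ξ q : ℂ) = if q = 1 then (Nat.card Q : ℂ) else 0 := by
  classical
  have h := sum_character (Q := Q →* ℂˣ) (MonoidHom.eval q)
  have h1 : (MonoidHom.eval q : (Q →* ℂˣ) →* ℂˣ) = 1 ↔ q = 1 := by
    constructor
    · intro h
      by_contra hq
      obtain ⟨ξ, hξ⟩ := CommGroup.exists_apply_ne_one_of_hasEnoughRootsOfUnity Q ℂ hq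
      exact hξ (DFunLike.congr_fun h ξ)
    · rintro rfl
      ext ξ
      simp
  simp only [h1, CommGroup.card_monoidHom_of_hasEnoughRootsOfUnity Q ℂ] at h
  exact h

/-- The projection to the isotypic component. -/
def isotypicProj (ξ : Q →* ℂˣ) : Module.End ℂ V :=
  (Nat.card Q : ℂ)⁻¹ • ∑ᶠ q, ((ξ q)⁻¹ : ℂ) • ρ q

omit [Finite Q] in
theorem isotypicProj_apply [Fintype Q] (ξ : Q →* ℂˣ) (v : V) :
    isotypicProj ρ ξ v = (Nat.card Q : ℂ)⁻¹ • ∑ q, ((ξ q)⁻¹ : ℂ) • ρ q v := by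
  rw [isotypicProj, finsum_eq_sum_of_fintype, LinearMap.smul_apply, LinearMap.sum_apply]
  rfl

theorem isotypicProj_mem (ξ : Q →* ℂˣ) (v : V) : isotypicProj ρ ξ v ∈ isotypic ρ ξ := by
  have := Fintype.ofFinite Q
  intro p
  rw [isotypicProj_apply, map_smul, map_sum, smul_comm (ξ p : ℂ),
    Finset.smul_sum (r := (ξ p : ℂ))]
  refine congrArg (fun v : V => (Nat.card Q : ℂ)⁻¹ • v) ?_
  refine Fintype.sum_equiv (Equiv.mulLeft p) _ _ fun q => ?_
  rw [map_smul, smul_smul, Equiv.coe_mulLeft, map_mul, map_mul]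
  change _ • (ρ p * ρ q) v = _
  congr 1
  rw [Units.val_mul, mul_inv, ← mul_assoc, mul_inv_cancel₀ (Units.ne_zero _), one_mul]

theorem isotypicProj_of_mem [DecidableEq (Q →* ℂˣ)] {ξ η : Q →* ℂˣ} {v : V}
    (hv : v ∈ isotypic ρ η) : isotypicProj ρ ξ v = if ξ = η then v else 0 := by
  have := Fintype.ofFinite Q
  rw [isotypicProj_apply]
  have h1 : ∀ q, ((ξ q)⁻¹ : ℂ) • ρ q v = ((η / ξ) q : ℂ) • v := by
    intro q
    rw [hv q, smul_smul]
    congr 1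
    rw [MonoidHom.div_apply, Units.val_div_eq_div_val, div_eq_inv_mul]
  simp only [h1]
  rw [← Finset.sum_smul, sum_character, smul_smul]
  have h0 : (Nat.card Q : ℂ) ≠ 0 := Nat.cast_ne_zero.2 Nat.card_pos.ne'
  by_cases h : ξ = η
  · subst h
    rw [if_pos (div_self' ξ), if_pos rfl, inv_mul_cancel₀ h0, one_smul]
  · rw [if_neg (fun h' => h (div_eq_one.1 h').symm), if_neg h, mul_zero, zero_smul]

theorem sum_isotypicProj [Fintype (Q →* ℂˣ)] (v : V) : ∑ ξ, isotypicProj ρ ξ v = v := by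
  classical
  have := Fintype.ofFinite Q
  have h0 : (Nat.card Q : ℂ) ≠ 0 := Nat.cast_ne_zero.2 Nat.card_pos.ne'
  simp only [isotypicProj_apply]
  rw [← Finset.smul_sum, Finset.sum_comm]
  have h1 : ∀ q : Q, ∑ ξ : Q →* ℂˣ, ((ξ q)⁻¹ : ℂ) • ρ q v =
      if q = 1 then (Nat.card Q : ℂ) • v else 0 := by
    intro q
    have h2 : ∀ ξ : Q →* ℂˣ, ((ξ q)⁻¹ : ℂ) = (ξ q⁻¹ : ℂ) := fun ξ => by
      rw [map_inv, Units.val_inv_eq_inv_val]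
    simp only [h2]
    rw [← Finset.sum_smul, sum_character_apply]
    by_cases hq : q = 1
    · subst hq; simp
    · rw [if_neg (by simpa using hq), if_neg hq, zero_smul]
  simp only [h1]
  rw [Finset.sum_ite_eq' Finset.univ (1 : Q), if_pos (Finset.mem_univ _), smul_smul,
    inv_mul_cancel₀ h0, one_smul]

/-- The decomposition of a representation of a finite abelian group. -/
theorem finrank_eq_finsum_isotypic [Module.Finite ℂ V] :
    Module.finrank ℂ V = ∑ᶠ ξ : Q →* ℂˣ, Module.finrank ℂ (isotypic ρ ξ) := by
  classical
  have := Fintype.ofFinite (Q →* ℂˣ)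
  let Φ : V →ₗ[ℂ] ((ξ : Q →* ℂˣ) → isotypic ρ ξ) :=
    LinearMap.pi fun ξ => (isotypicProj ρ ξ).codRestrict _ (isotypicProj_mem ρ ξ)
  have hΦ : Function.Bijective Φ := by
    constructor
    · intro v w hvw
      rw [← sum_isotypicProj ρ v, ← sum_isotypicProj ρ w]
      exact Finset.sum_congr rfl fun ξ _ => congrArg Subtype.val (congrFun hvw ξ)
    · intro w
      refine ⟨∑ ξ, (w ξ : V), funext fun η => Subtype.ext ?_⟩
      change isotypicProj ρ η _ = _
      rw [map_sum]
      simp only [isotypicProj_of_mem ρ (w _).2]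
      rw [Finset.sum_ite_eq Finset.univ η, if_pos (Finset.mem_univ _)]
  rw [(LinearEquiv.ofBijective Φ hΦ).finrank_eq, Module.finrank_pi_fintype,
    finsum_eq_sum_of_fintype]

end Isotypic

section HomSpace

variable {G : Type*} [Group G] {N : Subgroup G} [N.Normal]

variable (N) in
/-- Conjugation on the homomorphisms from a normal subgroup to the complex numbers. -/
def conjHom : G →* Module.End ℂ (homSpace N) where
  toFun g :=
    { toFun := fun f => ⟨fun x => f.1 (MulAut.conjNormal g⁻¹ x), fun x y => by
        simp only [map_mul]; exact f.2 _ _⟩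
      map_add' := fun _ _ => rfl
      map_smul' := fun _ _ => rfl }
  map_one' := by
    refine LinearMap.ext fun f => Subtype.ext (funext fun x => congrArg f.1 ?_)
    simp
  map_mul' g h := by
    refine LinearMap.ext fun f => Subtype.ext (funext fun x => congrArg f.1 ?_)
    simp

theorem le_ker_conjHom : N ≤ (conjHom N).ker := by
  intro g hg
  refine LinearMap.ext fun f => Subtype.ext (funext fun x => ?_)
  have h1 : MulAut.conjNormal g⁻¹ x = (⟨g, hg⟩ : N)⁻¹ * x * ⟨g, hg⟩ := by
    ext; simp
  change f.1 (MulAut.conjNormal g⁻¹ x) = f.1 x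
  rw [h1, f.2, f.2, homSpace.map_inv f]
  ring

/-- To be a left action, `conjHom` conjugates by `g⁻¹`; hence the inverse character. Inversion
permutes the characters, so it disappears in the sum over all of them. -/
theorem finrank_isotypic_conjHom [Finite (G ⧸ N)] (Q : Type*) [CommGroup Q] (e : Q ≃* G ⧸ N)
    (ξ : Q →* ℂˣ) :
    Module.finrank ℂ (isotypic ((QuotientGroup.lift N (conjHom N) le_ker_conjHom).comp
      e.toMonoidHom) ξ) = Module.finrank ℂ (eqHomSpace N fun g => (ξ⁻¹ (e.symm g) : ℂ)) := by
  let ρ := (QuotientGroup.lift N (conjHom N) le_ker_conjHom).comp e.toMonoidHom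
  have hρ : ∀ (g : G) (f : homSpace N) (x : N),
      (ρ (e.symm g) f).1 x = f.1 (MulAut.conjNormal g⁻¹ x) := by
    intro g f x
    have : ρ (e.symm g) = conjHom N g := by
      simp [ρ]
    rw [this]
    rfl
  let Φ : isotypic ρ ξ →ₗ[ℂ] eqHomSpace N fun g => (ξ⁻¹ (e.symm g) : ℂ) :=
    { toFun := fun f => ⟨f.1.1, f.1.2, fun g x => by
        have h1 := congrFun (congrArg Subtype.val (f.2 (e.symm g⁻¹))) x
        have h2 := hρ g⁻¹ f.1 x
        rw [inv_inv] at h2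
        rw [← h2]
        refine h1.trans ?_
        have h3 : ξ (e.symm ((g⁻¹ : G) : G ⧸ N)) = ξ⁻¹ (e.symm g) := by
          rw [MonoidHom.inv_apply, ← map_inv, ← map_inv]; rfl
        exact congrArg (fun u : ℂˣ => (u : ℂ) * f.1.1 x) h3⟩
      map_add' := fun _ _ => rfl
      map_smul' := fun _ _ => rfl }
  refine (LinearEquiv.ofBijective Φ ⟨?_, ?_⟩).finrank_eq
  · intro f f' hff
    have h2 : f.1.1 = f'.1.1 := congrArg (fun f : eqHomSpace N fun g => (ξ⁻¹ (e.symm g) : ℂ) => f.1) hff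
    exact Subtype.ext (Subtype.ext h2)
  · intro f
    refine ⟨⟨eqHomSpace.toHom f, fun q => ?_⟩, rfl⟩
    obtain ⟨q, rfl⟩ := e.symm.surjective q
    obtain ⟨g, rfl⟩ := QuotientGroup.mk_surjective q
    refine Subtype.ext (funext fun x => (hρ g _ x).trans ?_)
    refine (f.2.2 g⁻¹ x).trans ?_
    have h3 : ξ⁻¹ (e.symm ((g⁻¹ : G) : G ⧸ N)) = ξ (e.symm g) := by
      rw [MonoidHom.inv_apply, ← map_inv, ← map_inv]
      exact congrArg (fun a => ξ (e.symm a)) (inv_inv (g : G ⧸ N))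
    exact congrArg (fun u : ℂˣ => (u : ℂ) * f.1 x) h3

theorem groupBetti_eq_finsum_of_equiv [Group.FG G] [Finite (G ⧸ N)] {Q : Type*} [CommGroup Q]
    (e : Q ≃* G ⧸ N) : groupBetti N =
      ∑ᶠ ξ : Q →* ℂˣ, Module.finrank ℂ (eqHomSpace N fun g => (ξ (e.symm g) : ℂ)) := by
  have : N.FiniteIndex := Subgroup.finiteIndex_of_finite_quotient
  have : Finite Q := Finite.of_equiv _ e.symm.toEquiv
  have h1 := finrank_eq_finsum_isotypic ((QuotientGroup.lift N (conjHom N) le_ker_conjHom).comp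
    e.toMonoidHom)
  rw [finrank_homSpace] at h1
  rw [h1]
  exact finsum_eq_of_bijective Inv.inv (inv_involutive (G := Q →* ℂˣ)).bijective
    fun ξ => finrank_isotypic_conjHom Q e ξ

theorem groupBetti_eq_finsum [Group.FG G] [Finite (G ⧸ N)]
    (hcomm : ∀ a b : G ⧸ N, a * b = b * a) :
    groupBetti N = ∑ᶠ ξ : (G ⧸ N) →* ℂˣ, Module.finrank ℂ (eqHomSpace N fun g => (ξ g : ℂ)) := by
  let _ : CommGroup (G ⧸ N) := { mul_comm := hcomm }
  exact groupBetti_eq_finsum_of_equiv (Q := G ⧸ N) (MulEquiv.refl _)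

end HomSpace

/-! ### Restriction of equivariant homomorphisms to the derived subgroup -/

section Restriction

open scoped commutatorElement

variable {G : Type*} [Group G] {N : Subgroup G} [N.Normal]

theorem commutatorElement_mem_commutator (g h : G) : ⁅g, h⁆ ∈ commutator G :=
  Subgroup.commutator_mem_commutator (Subgroup.mem_top g) (Subgroup.mem_top h)

/-- For a nontrivial character, restriction to the derived subgroup is an isomorphism. -/
theorem finrank_eqHomSpace_commutator (hN : commutator G ≤ N) (χ : G →* ℂˣ)
    (hχ : ∀ x ∈ N, χ x = 1) (h1 : χ ≠ 1) :
    Module.finrank ℂ (eqHomSpace N fun g => (χ g : ℂ)) =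
      Module.finrank ℂ (eqHomSpace (commutator G) fun g => (χ g : ℂ)) := by
  obtain ⟨g₀, hg₀⟩ : ∃ g₀, (χ g₀ : ℂ) - 1 ≠ 0 := by
    by_contra! h
    exact h1 (MonoidHom.ext fun g => Units.ext (sub_eq_zero.1 (h g)))
  let Φ : (eqHomSpace N fun g => (χ g : ℂ)) →ₗ[ℂ]
      eqHomSpace (commutator G) fun g => (χ g : ℂ) :=
    { toFun := fun f => ⟨fun x => f.1 ⟨x, hN x.2⟩,
        fun x y => f.2.1 ⟨x, hN x.2⟩ ⟨y, hN y.2⟩, fun g x => f.2.2 g ⟨x, hN x.2⟩⟩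
      map_add' := fun _ _ => rfl
      map_smul' := fun _ _ => rfl }
  refine (LinearEquiv.ofBijective Φ ⟨?_, ?_⟩).finrank_eq
  · rw [injective_iff_map_eq_zero]
    intro f hf
    refine Subtype.ext (funext fun x => ?_)
    -- Equivariance gives f([g₀, x]) = (χ(g₀) - 1) f(x), so `f` is determined by its values on
    -- commutators.
    have h2 : f.1 ⟨⁅g₀, (x : G)⁆, hN (commutatorElement_mem_commutator _ _)⟩ = 0 :=
      congrFun (congrArg Subtype.val hf) ⟨_, commutatorElement_mem_commutator _ _⟩
    have h3 : (⟨⁅g₀, (x : G)⁆, hN (commutatorElement_mem_commutator _ _)⟩ : N) =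
        MulAut.conjNormal g₀ x * x⁻¹ := by
      ext
      simp [commutatorElement_def]
    have h5 : f.1 x⁻¹ = -f.1 x := homSpace.map_inv (eqHomSpace.toHom f) x
    rw [h3, f.2.1, f.2.2, h5] at h2
    change _ * f.1 x + -f.1 x = 0 at h2
    have h4 : ((χ g₀ : ℂ) - 1) * f.1 x = 0 := by rw [← h2]; ring
    exact (mul_eq_zero.1 h4).resolve_left hg₀
  · intro φ
    set F := (commutator G).extendZero φ.1
    have hmul : ∀ {x y : G}, x ∈ commutator G → y ∈ commutator G → F (x * y) = F x + F y :=
      fun hx hy => homSpace.extendZero_mul (eqHomSpace.toHom φ) hx hy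
    have hinv : ∀ {x : G}, x ∈ commutator G → F x⁻¹ = -F x :=
      fun hx => homSpace.extendZero_inv (eqHomSpace.toHom φ) hx
    have hconj : ∀ (g : G) {x : G}, x ∈ commutator G → F (g * x * g⁻¹) = χ g * F x :=
      fun g x hx => eqHomSpace.conj φ g hx
    have hc : ∀ g h : G, ⁅g, h⁆ ∈ commutator G := commutatorElement_mem_commutator
    have hcon : ∀ (g : G) {x : G}, x ∈ commutator G → g * x * g⁻¹ ∈ commutator G :=
      fun g x hx => (inferInstance : (commutator G).Normal).conj_mem x hx g
    have hleft : ∀ g h x : G, F ⁅g * h, x⁆ = χ g * F ⁅h, x⁆ + F ⁅g, x⁆ := by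
      intro g h x
      rw [← hconj g (hc h x), ← hmul (hcon g (hc h x)) (hc g x)]
      congr 1
      simp only [commutatorElement_def]
      group
    have hright : ∀ g x y : G, F ⁅g, x * y⁆ = F ⁅g, x⁆ + χ x * F ⁅g, y⁆ := by
      intro g x y
      rw [← hconj x (hc g y), ← hmul (hc g x) (hcon x (hc g y))]
      congr 1
      simp only [commutatorElement_def]
      group
    have hder : ∀ {k : G} (x : N), k ∈ commutator G → F ⁅k, (x : G)⁆ = 0 := by
      intro k x hk
      have h2 : ⁅k, (x : G)⁆ = k * ((x : G) * k⁻¹ * (x : G)⁻¹) := by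
        simp only [commutatorElement_def]
        group
      rw [h2, hmul hk (hcon _ (inv_mem hk)), hconj _ (inv_mem hk), hinv hk, hχ x x.2]
      simp
    -- Evaluate on the commutators of `g * h` and `h * g` with `x`: these elements differ by a
    -- factor in the derived subgroup, which `hder` shows to be irrelevant.
    have hsymm : ∀ (g h : G) (x : N), ((χ g : ℂ) - 1) * F ⁅h, (x : G)⁆ =
        ((χ h : ℂ) - 1) * F ⁅g, (x : G)⁆ := by
      intro g h x
      have h2 : g * h = ⁅g, h⁆ * (h * g) := by
        simp only [commutatorElement_def]
        group
      have h3 := hleft ⁅g, h⁆ (h * g) x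
      rw [← h2, hder x (hc g h), hχ _ (hN (hc g h)), hleft, hleft] at h3
      rw [Units.val_one] at h3
      linear_combination h3
    have hF : ∀ {c : G}, c ∈ commutator G → F ⁅g₀, c⁆ = ((χ g₀ : ℂ) - 1) * F c := by
      intro c hc'
      have h2 : ⁅g₀, c⁆ = (g₀ * c * g₀⁻¹) * c⁻¹ := commutatorElement_def _ _
      rw [h2, hmul (hcon _ hc') (inv_mem hc'), hconj _ hc', hinv hc']
      ring
    -- The formula from the injectivity argument serves as definition. Additivity is `hright` with χ
    -- = 1 on `N`, equivariance comes from `hsymm`, and `hF` gives the values on the derived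
    -- subgroup.
    refine ⟨⟨fun x => F ⁅g₀, (x : G)⁆ / ((χ g₀ : ℂ) - 1), fun x y => ?_, fun g x => ?_⟩,
      Subtype.ext (funext fun x => ?_)⟩
    · change F ⁅g₀, (x : G) * (y : G)⁆ / _ = _
      rw [hright, hχ x x.2, Units.val_one, one_mul, add_div]
    · have h2 : ((MulAut.conjNormal g x : N) : G) = ⁅g, (x : G)⁆ * (x : G) := by
        rw [MulAut.conjNormal_apply, commutatorElement_def]
        group
      simp only [h2]
      rw [hright, hχ _ (hN (hc g x)), Units.val_one, one_mul, hF (hc g x), add_div,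
        mul_div_cancel_left₀ _ hg₀]
      field_simp
      linear_combination hsymm g₀ g x
    · change F ⁅g₀, (x : G)⁆ / _ = φ.1 x
      rw [hF x.2, mul_div_cancel_left₀ _ hg₀]
      exact Subgroup.extendZero_of_mem _ _ x.2

end Restriction
end

/-! ### Minors, ranks and Fitting ideals -/

noncomputable section

section Minors

open scoped Matrix

theorem exists_linearIndependent_rows {n m k : ℕ} (A : Matrix (Fin n) (Fin m) ℂ)
    (hk : k ≤ A.rank) :
    ∃ r : Fin k → Fin n, LinearIndependent ℂ fun i => A (r i) := by
  rw [Matrix.rank_eq_finrank_span_row] at hk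
  obtain ⟨f, hf, -, hli⟩ := Submodule.exists_fun_fin_finrank_span_eq ℂ (Set.range A.row)
  choose r hr using hf
  refine ⟨fun i => r (Fin.castLE hk i), ?_⟩
  have h1 : (fun i => A (r (Fin.castLE hk i))) = f ∘ Fin.castLE hk := funext fun i => hr _
  rw [h1]
  exact hli.comp _ (Fin.castLE_injective hk)

/-- A matrix of rank at least `k` has a nonzero minor of order `k`. -/
theorem exists_minor_ne_zero {n m k : ℕ} (A : Matrix (Fin n) (Fin m) ℂ) (hk : k ≤ A.rank) :
    ∃ (r : Fin k → Fin n) (c : Fin k → Fin m), (A.submatrix r c).det ≠ 0 := by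
  obtain ⟨r, hr⟩ := exists_linearIndependent_rows A hk
  set B : Matrix (Fin k) (Fin m) ℂ := A.submatrix r id
  have hB : Bᵀ.rank = k := by
    rw [Matrix.rank_transpose, LinearIndependent.rank_matrix (M := B) hr, Fintype.card_fin]
  obtain ⟨c, hc⟩ := exists_linearIndependent_rows Bᵀ hB.ge
  refine ⟨r, c, ?_⟩
  rw [← Matrix.det_transpose]
  have h1 : IsUnit (A.submatrix r c)ᵀ :=
    Matrix.linearIndependent_rows_iff_isUnit.1 hc
  exact ((Matrix.isUnit_iff_isUnit_det _).1 h1).ne_zero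

theorem le_rank_of_minor_ne_zero {n m k : ℕ} (A : Matrix (Fin n) (Fin m) ℂ) {r : Fin k → Fin n}
    {c : Fin k → Fin m} (h : (A.submatrix r c).det ≠ 0) : k ≤ A.rank := by
  have h1 := Matrix.rank_of_det_ne_zero h
  rw [Fintype.card_fin] at h1
  exact h1 ▸ Matrix.rank_submatrix_le A r c

end Minors

section Presentation

open scoped Matrix

variable {R M : Type*} [CommRing R] [AddCommGroup M] [Module R M] (σ : R →+* ℂ)

/-- The number of generators is the dimension of the fibre plus the rank of the specialized
matrix. -/
theorem IsPresentation.finrank_add_rank {n m : ℕ} {A : Matrix (Fin n) (Fin m) R}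
    {ψ : (Fin n → R) →ₗ[R] M} (h : IsPresentation A ψ) :
    Module.finrank ℂ (M →ₛₗ[σ] ℂ) + (A.map σ).rank = n := by
  let e (i : Fin n) : Fin n → R := Pi.single i 1
  have hsum : ∀ (l : (Fin n → R) →ₛₗ[σ] ℂ) (x : Fin n → R), l x = ∑ i, σ (x i) * l (e i) := by
    intro l x
    conv_lhs => rw [pi_eq_sum_univ' x]
    rw [map_sum]
    exact Finset.sum_congr rfl fun i _ => by rw [map_smulₛₗ, smul_eq_mul]
  let Φ : (M →ₛₗ[σ] ℂ) →ₗ[ℂ] (Fin n → ℂ) :=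
    { toFun := fun l i => l (ψ (e i))
      map_add' := fun _ _ => rfl
      map_smul' := fun _ _ => rfl }
  have hΦ : Function.Injective Φ := by
    intro l l' hl
    refine LinearMap.ext fun x => ?_
    obtain ⟨x, rfl⟩ := h.1 x
    have h1 := hsum (l.comp ψ) x
    have h2 := hsum (l'.comp ψ) x
    simp only [LinearMap.comp_apply] at h1 h2
    rw [h1, h2]
    exact Finset.sum_congr rfl fun i _ => congrArg _ (congrFun hl i)
  -- A functional is given by its values on the generators, subject to the condition that it
  -- vanishes on the relations, which are the columns of `A`.
  have hr : LinearMap.range Φ = LinearMap.ker (A.map σ)ᵀ.mulVecLin := by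
    ext v
    rw [LinearMap.mem_ker, Matrix.mulVecLin_apply]
    have hv : (A.map σ)ᵀ.mulVec v = fun j => ∑ i, σ (A i j) * v i := by
      funext j; rfl
    rw [hv]
    constructor
    · rintro ⟨l, rfl⟩
      funext j
      have h1 : A.mulVecLin (Pi.single j 1) ∈ LinearMap.ker ψ := h.2 ▸ ⟨_, rfl⟩
      have h2 := hsum (l.comp ψ) (A.mulVecLin (Pi.single j 1))
      rw [LinearMap.comp_apply, LinearMap.mem_ker.1 h1, map_zero] at h2
      rw [Matrix.mulVecLin_apply, Matrix.mulVec_single_one] at h2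
      exact h2.symm
    · intro hv
      let L : (Fin n → R) →ₛₗ[σ] ℂ :=
        { toFun := fun x => ∑ i, σ (x i) * v i
          map_add' := fun x y => by
            simp only [Pi.add_apply, map_add, add_mul, Finset.sum_add_distrib]
          map_smul' := fun c x => by
            simp only [Pi.smul_apply, smul_eq_mul, map_mul, mul_assoc, Finset.mul_sum] }
      have hL : LinearMap.ker ψ ≤ LinearMap.ker L := by
        rw [h.2]
        rintro _ ⟨y, rfl⟩
        rw [LinearMap.mem_ker]
        change ∑ i, σ (∑ j, A i j * y j) * v i = 0
        simp only [map_sum, map_mul, Finset.sum_mul]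
        rw [Finset.sum_comm]
        refine Finset.sum_eq_zero fun j _ => ?_
        have h1 : ∑ i, σ (A i j) * v i = 0 := congrFun hv j
        calc ∑ i, σ (A i j) * σ (y j) * v i = σ (y j) * ∑ i, σ (A i j) * v i := by
              rw [Finset.mul_sum]
              exact Finset.sum_congr rfl fun i _ => by ring
          _ = 0 := by rw [h1, mul_zero]
      refine ⟨((LinearMap.ker ψ).liftQ L hL).comp
        (ψ.quotKerEquivOfSurjective h.1).symm.toLinearMap, funext fun i => ?_⟩
      have h1 : (ψ.quotKerEquivOfSurjective h.1).symm (ψ (e i)) =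
          (LinearMap.ker ψ).mkQ (e i) := by
        rw [LinearEquiv.symm_apply_eq]; rfl
      change (LinearMap.ker ψ).liftQ L hL
        ((ψ.quotKerEquivOfSurjective h.1).symm (ψ (e i))) = v i
      rw [h1, Submodule.mkQ_apply, Submodule.liftQ_apply]
      change ∑ j, σ ((Pi.single i 1 : Fin n → R) j) * v j = v i
      rw [Finset.sum_eq_single i]
      · simp
      · intro j _ hj; simp [Pi.single_eq_of_ne hj]
      · simp
  rw [(LinearEquiv.ofInjective Φ hΦ).finrank_eq, hr, ← Matrix.rank_transpose, Matrix.rank, add_comm,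
    LinearMap.finrank_range_add_finrank_ker, Module.finrank_fin_fun]

/-- The Fitting ideals compute the dimension of the fibres. -/
theorem forall_fittingIdeal_iff {n m : ℕ} {A : Matrix (Fin n) (Fin m) R}
    {ψ : (Fin n → R) →ₗ[R] M} (h : IsPresentation A ψ) (k : ℕ) :
    (∀ f ∈ fittingIdeal R M k, σ f = 0) ↔ k ≤ Module.finrank ℂ (M →ₛₗ[σ] ℂ) := by
  constructor
  · intro hk
    by_contra! hlt
    have h1 := h.finrank_add_rank σ
    -- The rank is `n` minus the fibre dimension, hence at least `n + 1 - k`. For `k > n` the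
    -- truncated order is `0` and the minor is the empty determinant `1`.
    obtain ⟨r, c, hrc⟩ := exists_minor_ne_zero (k := n + 1 - k) (A.map σ) (by omega)
    refine hrc ?_
    have h2 := hk _ (Ideal.subset_span ⟨n, m, A, ψ, h, r, c, rfl⟩)
    rw [RingHom.map_det] at h2
    exact h2
  · intro hk f hf
    suffices h : fittingIdeal R M k ≤ RingHom.ker σ from h hf
    refine Ideal.span_le.2 ?_
    rintro _ ⟨n', m', A', ψ', h', r, c, rfl⟩
    -- The fibre dimension does not depend on the presentation, so the rank bound makes these minors
    -- vanish for every presentation.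
    have h1 := h'.finrank_add_rank σ
    by_contra hne
    have h2 : ((A'.map σ).submatrix r c).det ≠ 0 := by
      intro h0
      refine hne ?_
      rw [SetLike.mem_coe, RingHom.mem_ker, RingHom.map_det]
      exact h0
    have h3 := le_rank_of_minor_ne_zero _ h2
    omega

end Presentation

/-- By the Fitting criterion the set of admissible `k` is the initial segment up to the fibre
dimension. It is bounded, so its supremum in `ℕ` is a genuine maximum. -/
theorem charDepth_eq {G : Type*} [Group G] {n m : ℕ}
    {A : Matrix (Fin n) (Fin m) (MonoidAlgebra ℂ (Abelianization G))}
    {ψ : (Fin n → MonoidAlgebra ℂ (Abelianization G)) →ₗ[MonoidAlgebra ℂ (Abelianization G)]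
      AlexanderModule G} (h : IsPresentation A ψ) (χ : G →* ℂˣ) :
    charDepth χ = Module.finrank ℂ (AlexanderModule G →ₛₗ[(evalChar χ).toRingHom] ℂ) := by
  have h1 : {k | χ ∈ charVar G k} =
      Set.Iic (Module.finrank ℂ (AlexanderModule G →ₛₗ[(evalChar χ).toRingHom] ℂ)) := by
    ext k
    exact forall_fittingIdeal_iff (evalChar χ).toRingHom h k
  rw [charDepth, h1, csSup_Iic]
end

/-! ### The Alexander module and its equivariant functionals -/

noncomputable section

open scoped TensorProduct commutatorElement

section Alexander

variable {G : Type*} [Group G]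

/-- The class of an element of the derived subgroup in the Alexander module. -/
def alexanderClass (x : commutator G) : AlexanderModule G :=
  (alexanderRep G).asModuleEquiv.symm (1 ⊗ₜ[ℤ] Additive.ofMul (Abelianization.of x))

theorem alexanderClass_mul (x y : commutator G) :
    alexanderClass (x * y) = alexanderClass x + alexanderClass y := by
  rw [alexanderClass, map_mul, ofMul_mul, TensorProduct.tmul_add, map_add]
  rfl

theorem alexanderRep_of (g : G) (c : ℂ) (x : commutator G) :
    alexanderRep G (Abelianization.of g) (c ⊗ₜ[ℤ] Additive.ofMul (Abelianization.of x)) =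
      c ⊗ₜ[ℤ] Additive.ofMul (Abelianization.of (MulAut.conjNormal g x)) := rfl

theorem alexanderClass_conj (g : G) (x : commutator G) :
    alexanderClass (MulAut.conjNormal g x) =
      MonoidAlgebra.of ℂ (Abelianization G) (Abelianization.of g) • alexanderClass x := by
  rw [alexanderClass, alexanderClass, ← Representation.asModuleEquiv_symm_map_rho,
    alexanderRep_of]

variable (G) in
theorem span_alexanderClass :
    Submodule.span (MonoidAlgebra ℂ (Abelianization G)) (Set.range (alexanderClass (G := G))) =
      ⊤ := by
  rw [eq_top_iff]
  rintro m -
  obtain ⟨t, rfl⟩ := (alexanderRep G).asModuleEquiv.symm.surjective m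
  induction t using TensorProduct.induction_on with
  | zero => rw [map_zero]; exact zero_mem _
  | add a b ha hb => rw [map_add]; exact add_mem ha hb
  | tmul c a =>
    obtain ⟨x, hx⟩ := QuotientGroup.mk_surjective (s := commutator (commutator G)) a.toMul
    have ha : a = Additive.ofMul (Abelianization.of x) := hx.symm
    have h1 : c ⊗ₜ[ℤ] a = c • ((1 : ℂ) ⊗ₜ[ℤ] a) := by
      rw [TensorProduct.smul_tmul', smul_eq_mul, mul_one]
    rw [h1, map_smul, ha]
    exact Submodule.smul_of_tower_mem _ c (Submodule.subset_span ⟨x, rfl⟩)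

/-- Commutators of products and inverses are products of conjugates of commutators of the factors
and of their inverses, so modulo a normal subgroup it suffices to treat generators, one argument
after the other. -/
theorem commutator_le_of_closure {K : Subgroup G} [K.Normal] {S : Set G}
    (hS : Subgroup.closure S = ⊤) (h : ∀ s ∈ S, ∀ t ∈ S, ⁅s, t⁆ ∈ K) : commutator G ≤ K := by
  have h1 : ∀ s ∈ S, ∀ g, ⁅s, g⁆ ∈ K := by
    intro s hs g
    have hg : g ∈ Subgroup.closure S := hS ▸ Subgroup.mem_top g
    induction hg using Subgroup.closure_induction with
    | mem t ht => exact h s hs t ht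
    | one => simp
    | mul a b _ _ ha hb =>
      have e : ⁅s, a * b⁆ = ⁅s, a⁆ * (a * ⁅s, b⁆ * a⁻¹) := by
        simp only [commutatorElement_def]; group
      rw [e]
      exact mul_mem ha (‹K.Normal›.conj_mem _ hb a)
    | inv a _ ha =>
      have e : ⁅s, a⁻¹⁆ = a⁻¹ * ⁅s, a⁆⁻¹ * a⁻¹⁻¹ := by
        simp only [commutatorElement_def]; group
      rw [e]
      exact ‹K.Normal›.conj_mem _ (inv_mem ha) a⁻¹
  refine Subgroup.commutator_le.2 fun g hgt g' _ => ?_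
  clear hgt
  have hg : g ∈ Subgroup.closure S := hS ▸ Subgroup.mem_top g
  induction hg using Subgroup.closure_induction with
  | mem t ht => exact h1 t ht g'
  | one => simp
  | mul a b _ _ ha hb =>
    have e : ⁅a * b, g'⁆ = (a * ⁅b, g'⁆ * a⁻¹) * ⁅a, g'⁆ := by
      simp only [commutatorElement_def]; group
    rw [e]
    exact mul_mem (‹K.Normal›.conj_mem _ hb a) ha
  | inv a _ ha =>
    have e : ⁅a⁻¹, g'⁆ = a⁻¹ * ⁅a, g'⁆⁻¹ * a⁻¹⁻¹ := by
      simp only [commutatorElement_def]; group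
    rw [e]
    exact ‹K.Normal›.conj_mem _ (inv_mem ha) a⁻¹

variable (G) in
-- The derived subgroup is the normal closure of the commutators of a finite set of generators, and
-- conjugation becomes multiplication by group elements in the module. So these finitely many
-- classes generate it.
theorem finite_alexanderModule [Group.FG G] :
    Module.Finite (MonoidAlgebra ℂ (Abelianization G)) (AlexanderModule G) := by
  obtain ⟨S, hS, hSf⟩ := Group.fg_iff.1 ‹Group.FG G›
  set c : S × S → AlexanderModule G := fun p =>
    alexanderClass ⟨⁅(p.1 : G), (p.2 : G)⁆, commutatorElement_mem_commutator _ _⟩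
  set L := Submodule.span (MonoidAlgebra ℂ (Abelianization G)) (Set.range c)
  have hone : alexanderClass (1 : commutator G) = 0 := by
    have := alexanderClass_mul (1 : commutator G) 1
    rw [mul_one] at this
    exact left_eq_add.1 this
  let K : Subgroup G :=
    { carrier := {x | ∃ h : x ∈ commutator G, alexanderClass ⟨x, h⟩ ∈ L}
      one_mem' := ⟨one_mem _, by
        have : (⟨1, one_mem _⟩ : commutator G) = 1 := rfl
        rw [this, hone]; exact zero_mem _⟩
      mul_mem' := by
        rintro x y ⟨hx, hxL⟩ ⟨hy, hyL⟩
        refine ⟨mul_mem hx hy, ?_⟩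
        have := alexanderClass_mul (⟨x, hx⟩ : commutator G) ⟨y, hy⟩
        exact this ▸ add_mem hxL hyL
      inv_mem' := by
        rintro x ⟨hx, hxL⟩
        refine ⟨inv_mem hx, ?_⟩
        have := alexanderClass_mul (⟨x, hx⟩ : commutator G) ⟨x⁻¹, inv_mem hx⟩
        have e : (⟨x, hx⟩ : commutator G) * ⟨x⁻¹, inv_mem hx⟩ = 1 := Subtype.ext (mul_inv_cancel x)
        rw [e, hone] at this
        exact (add_mem_cancel_left hxL).1 (this ▸ zero_mem L) }
  have hK : K.Normal := by
    refine ⟨fun x ⟨hx, hxL⟩ g => ⟨(inferInstance : (commutator G).Normal).conj_mem x hx g, ?_⟩⟩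
    have := alexanderClass_conj g ⟨x, hx⟩
    have h2 := L.smul_mem (MonoidAlgebra.of ℂ (Abelianization G) (Abelianization.of g)) hxL
    exact this ▸ h2
  have hle : commutator G ≤ K := commutator_le_of_closure hS fun s hs t ht =>
    ⟨commutatorElement_mem_commutator s t, Submodule.subset_span ⟨(⟨s, hs⟩, ⟨t, ht⟩), rfl⟩⟩
  have hL : L = ⊤ := by
    rw [eq_top_iff, ← span_alexanderClass, Submodule.span_le]
    rintro _ ⟨x, rfl⟩
    exact (hle x.2).2
  have := hSf.to_subtype
  exact ⟨hL ▸ Submodule.fg_span (Set.finite_range c)⟩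

variable (G) in
-- The group ring of a finitely generated abelian group is Noetherian, so the relations between
-- finitely many generators are finitely generated.
theorem exists_isPresentation [Group.FG G] : ∃ (n m : ℕ)
    (A : Matrix (Fin n) (Fin m) (MonoidAlgebra ℂ (Abelianization G)))
    (ψ : (Fin n → MonoidAlgebra ℂ (Abelianization G)) →ₗ[MonoidAlgebra ℂ (Abelianization G)]
      AlexanderModule G), IsPresentation A ψ := by
  have := finite_alexanderModule G
  have hG : Group.FG (Abelianization G) := QuotientGroup.fg (commutator G)
  have hM : Monoid.FG (Abelianization G) := Group.fg_iff_monoid_fg.1 hG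
  have hN : IsNoetherianRing (MonoidAlgebra ℂ (Abelianization G)) :=
    Algebra.FiniteType.isNoetherianRing ℂ _
  obtain ⟨n, ψ, hψ⟩ := Module.Finite.exists_fin' (MonoidAlgebra ℂ (Abelianization G))
    (AlexanderModule G)
  obtain ⟨m, φ, hφ⟩ := Module.Finite.exists_fin' (MonoidAlgebra ℂ (Abelianization G))
    (LinearMap.ker ψ)
  refine ⟨n, m, LinearMap.toMatrix' ((LinearMap.ker ψ).subtype ∘ₗ φ), ψ, hψ, ?_⟩
  rw [← Matrix.toLin'_apply', Matrix.toLin'_toMatrix', LinearMap.range_comp,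
    LinearMap.range_eq_top.2 hφ, Submodule.map_top, Submodule.range_subtype]

theorem evalChar_of (χ : G →* ℂˣ) (g : G) :
    evalChar χ (MonoidAlgebra.of ℂ (Abelianization G) (Abelianization.of g)) = χ g := by
  rw [evalChar, MonoidAlgebra.lift_of]
  rfl

/-- Equivariant homomorphisms on the derived subgroup are functionals on the Alexander module. -/
theorem finrank_semilinear (χ : G →* ℂˣ) :
    Module.finrank ℂ (AlexanderModule G →ₛₗ[(evalChar χ).toRingHom] ℂ) =
      Module.finrank ℂ (eqHomSpace (commutator G) fun g => (χ g : ℂ)) := by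
  let Φ : (AlexanderModule G →ₛₗ[(evalChar χ).toRingHom] ℂ) →ₗ[ℂ]
      eqHomSpace (commutator G) fun g => (χ g : ℂ) :=
    { toFun := fun l => ⟨fun x => l (alexanderClass x), fun x y => by
          simp only [alexanderClass_mul, map_add], fun g x => by
          simp only [alexanderClass_conj]
          rw [map_smulₛₗ]
          exact congrArg (· * l (alexanderClass x)) (evalChar_of χ g)⟩
      map_add' := fun _ _ => rfl
      map_smul' := fun _ _ => rfl }
  refine (LinearEquiv.ofBijective Φ ⟨?_, ?_⟩).finrank_eq
  · intro l l' hl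
    refine LinearMap.ext_on (span_alexanderClass G) ?_
    rintro _ ⟨x, rfl⟩
    exact congrFun (congrArg Subtype.val hl) x
  · intro f
    let φ : Additive (Abelianization (commutator G)) →+ ℂ := AddMonoidHom.mk'
      (fun a => (Abelianization.lift (homSpace.toMonoidHom (eqHomSpace.toHom f)) a.toMul).toAdd)
      fun x y => by
        change ((Abelianization.lift (homSpace.toMonoidHom (eqHomSpace.toHom f)))
          (x.toMul * y.toMul)).toAdd = _
        rw [map_mul, toAdd_mul]
    let T : (ℂ ⊗[ℤ] Additive (Abelianization (commutator G))) →ₗ[ℂ] ℂ :=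
      LinearMap.liftBaseChange ℂ φ.toIntLinearMap
    have hT : ∀ (c : ℂ) (x : commutator G),
        T (c ⊗ₜ[ℤ] Additive.ofMul (Abelianization.of x)) = c * f.1 x := fun c x => by
      rw [LinearMap.liftBaseChange_tmul, smul_eq_mul]
      rfl
    have hTg : ∀ (g : G) (t : ℂ ⊗[ℤ] Additive (Abelianization (commutator G))),
        T (alexanderRep G (Abelianization.of g) t) = χ g * T t := by
      intro g t
      induction t using TensorProduct.induction_on with
      | zero => simp
      | add a b ha hb => rw [map_add, map_add, ha, hb, map_add, mul_add]
      | tmul c a =>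
        obtain ⟨x, hx⟩ := QuotientGroup.mk_surjective (s := commutator (commutator G)) a.toMul
        have ha : a = Additive.ofMul (Abelianization.of x) := hx.symm
        rw [ha, alexanderRep_of, hT, hT, f.2.2]
        ring
    -- Equivariance under group elements extends linearly to the group ring; this is the
    -- semilinearity along `evalChar χ`.
    have hTr : ∀ (r : MonoidAlgebra ℂ (Abelianization G))
        (t : ℂ ⊗[ℤ] Additive (Abelianization (commutator G))),
        T ((alexanderRep G).asAlgebraHom r t) = evalChar χ r * T t := by
      intro r t
      induction r using MonoidAlgebra.induction_linear with
      | zero => simp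
      | add a b ha hb => rw [map_add, LinearMap.add_apply, map_add, ha, hb, map_add, add_mul]
      | single a c =>
        obtain ⟨g, rfl⟩ := QuotientGroup.mk_surjective (s := commutator G) a
        have h1 : (MonoidAlgebra.single (QuotientGroup.mk g : Abelianization G) c :
            MonoidAlgebra ℂ (Abelianization G)) =
            c • MonoidAlgebra.of ℂ (Abelianization G) (Abelianization.of g) := by
          rw [MonoidAlgebra.of_apply, MonoidAlgebra.smul_single, smul_eq_mul, mul_one]
          rfl
        rw [h1, map_smul, map_smul, evalChar_of, Representation.asAlgebraHom_of,
          LinearMap.smul_apply, map_smul, hTg, smul_eq_mul, smul_eq_mul, mul_assoc]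
    refine ⟨{ toFun := fun m => T ((alexanderRep G).asModuleEquiv m),
              map_add' := fun x y => by rw [map_add, map_add]
              map_smul' := fun r m => by
                rw [Representation.asModuleEquiv_map_smul, hTr]; rfl },
      Subtype.ext (funext fun x => ?_)⟩
    change T ((alexanderRep G).asModuleEquiv (alexanderClass x)) = f.1 x
    rw [alexanderClass, LinearEquiv.apply_symm_apply, hT, one_mul]

theorem charDepth_eq_finrank [Group.FG G] (χ : G →* ℂˣ) :
    charDepth χ = Module.finrank ℂ (eqHomSpace (commutator G) fun g => (χ g : ℂ)) := by
  obtain ⟨n, m, A, ψ, h⟩ := exists_isPresentation G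
  rw [charDepth_eq h χ, finrank_semilinear]

/-- The first Betti number of a normal subgroup with finite abelian quotient. -/
theorem groupBetti_eq_add_finsum_charDepth [Group.FG G] (N : Subgroup G) [N.Normal]
    [Finite (G ⧸ N)] (hcomm : ∀ a b : G ⧸ N, a * b = b * a) :
    groupBetti N = groupBetti G + ∑ᶠ ξ : {ξ : (G ⧸ N) →* ℂˣ // ξ ≠ 1},
      charDepth (ξ.1.comp (QuotientGroup.mk' N)) := by
  have hN : N.FiniteIndex := Subgroup.finiteIndex_of_finite_quotient
  have hfin : Finite ((G ⧸ N) →* ℂˣ) := by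
    let _ : CommGroup (G ⧸ N) := { mul_comm := hcomm }
    exact finite_characters (Q := G ⧸ N)
  have hle : commutator G ≤ N := by
    refine Subgroup.commutator_le.2 fun g _ h _ => ?_
    rw [← QuotientGroup.eq_one_iff, commutatorElement_def]
    change (g : G ⧸ N) * h * (g : G ⧸ N)⁻¹ * (h : G ⧸ N)⁻¹ = 1
    rw [hcomm g h]
    group
  have hdepth : ∀ ξ : {ξ : (G ⧸ N) →* ℂˣ // ξ ≠ 1},
      charDepth (ξ.1.comp (QuotientGroup.mk' N)) =
        Module.finrank ℂ (eqHomSpace N fun g => (ξ.1 g : ℂ)) := by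
    intro ξ
    rw [charDepth_eq_finrank]
    refine (finrank_eqHomSpace_commutator hle (ξ.1.comp (QuotientGroup.mk' N)) ?_ ?_).symm
    · intro x hx
      rw [MonoidHom.comp_apply, QuotientGroup.mk'_apply, (QuotientGroup.eq_one_iff x).2 hx, map_one]
    · intro h1
      refine ξ.2 (MonoidHom.ext fun q => ?_)
      obtain ⟨g, rfl⟩ := QuotientGroup.mk_surjective q
      exact DFunLike.congr_fun h1 g
  rw [groupBetti_eq_finsum hcomm, ← finrank_homSpace (G := G), ← finrank_eqHomSpace_one (N := N)]
  simp only [hdepth]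
  let d (ξ : (G ⧸ N) →* ℂˣ) : ℕ := Module.finrank ℂ (eqHomSpace N fun g => (ξ g : ℂ))
  have h1 : ∑ᶠ ξ : {ξ : (G ⧸ N) →* ℂˣ // ξ ≠ 1}, d ξ.1 = ∑ᶠ (ξ) (_ : ξ ≠ 1), d ξ :=
    finsum_subtype_eq_finsum_cond _
  have h2 : d 1 = Module.finrank ℂ (eqHomSpace N fun _ => 1) := by
    simp only [d, MonoidHom.one_apply, Units.val_one]
  rw [← h2]
  exact ((congrArg (d 1 + ·) h1).trans (add_finsum_cond_ne 1 (Set.toFinite _))).symm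

end Alexander
end

/-! ### The extended Sakuma formula -/

theorem groupBetti_congr {G H : Type*} [Group G] [Group H] (e : G ≃* H) :
    groupBetti G = groupBetti H :=
  LinearEquiv.finrank_eq (AddEquiv.toIntLinearEquiv (MulEquiv.toAdditive e.abelianizationCongr))

theorem mainTheorem2 {n : ℕ} {X Y : Type*}
    [TopologicalSpace X] [T2Space X] [CompactSpace X] [ConnectedSpace X]
    [TopologicalSpace Y] [T2Space Y] [CompactSpace Y] [ConnectedSpace Y]
    (OX : NCOrbifold n X) (OY : NCOrbifold n Y) (π : Y → X)
    (hπ : IsUnbranchedCover OY OX π) (y₀ : hπ.commonPart)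
    [(hπ.imageGroup y₀).Normal]
    [Finite (OX.orbGroup (hπ.proj y₀) ⧸ hπ.imageGroup y₀)]
    (hcomm : ∀ a b : OX.orbGroup (hπ.proj y₀) ⧸ hπ.imageGroup y₀, a * b = b * a) :
    OY.orbBetti (hπ.inc y₀) = OX.orbBetti (hπ.proj y₀) +
      ∑ᶠ ξ : {ξ : (OX.orbGroup (hπ.proj y₀) ⧸ hπ.imageGroup y₀) →* ℂˣ // ξ ≠ 1},
        charDepth (ξ.1.comp (QuotientGroup.mk' (hπ.imageGroup y₀))) := by
  have : PathConnectedSpace OX.regPart :=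
    isPathConnected_iff_pathConnectedSpace.1 OX.isPathConnected_regPart
  have : PathConnectedSpace OY.regPart :=
    isPathConnected_iff_pathConnectedSpace.1 OY.isPathConnected_regPart
  have : Group.FG (FundamentalGroup OX.regPart (hπ.proj y₀)) :=
    OX.fg_fundamentalGroup (hπ.proj y₀)
  have : Group.FG (OX.orbGroup (hπ.proj y₀)) := QuotientGroup.fg _
  obtain ⟨e⟩ := hπ.nonempty_mulEquiv_imageGroup y₀
  exact (groupBetti_congr e).trans (groupBetti_eq_add_finsum_charDepth (hπ.imageGroup y₀) hcomm)
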